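/- Work on the three-dimensional torus $\mathbb T^3=\mathbb R^3/\mathbb Z^3$, with Fourier coefficients $\hat u(k)=\int_{\mathbb T^3}u(x)e^{-ik\cdot x}\,dx$, $k\in 2\pi\mathbb Z^3$. Let $\Lambda=(-\Delta)^{1/2}$, so that $\Lambda^r$ and $e^{a\Lambda^s}$ are the Fourier multipliers with symbols $|k|^r$ and $e^{a|k|^s}$. Let $H$ be the space of real vector fields $u\in L^2(\mathbb T^3;\mathbb R^3)$ with $\int u=0$ and $\operatorname{div}u=0$. For $r\ge 0$ let $\dot H^{r}$ be the homogeneous Sobolev space with $\|u\|_{\dot H^r}^2=\sum_k|k|^{2r}|\hat u(k)|^2$, and for $\varphi>0$ let $$\|u\|_{\dot{\mathcal G}^{\sigma,s}_{\varphi}}=\Big(\sum_{k\in 2\pi\mathbb Z^3}e^{2\varphi|k|^s}|k|^{2\sigma s}|\hat u(k)|^2\Big)^{1/2}=\|e^{\varphi\Lambda^s}u\|_{\dot H^{\sigma s}},\qquad \dot{\mathcal G}^{\sigma,s}_{\varphi}=\{u\in\dot H^{\sigma s}:\|u\|_{\dot{\mathcal G}^{\sigma,s}_{\varphi}}<\infty\}.$$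 Let $\Omega=\{\omega\in C([0,\infty);\mathbb R):\omega(0)=0\}$, $W_t(\omega)=\omega(t)$, and $$\Omega^{\alpha,\beta}_\mu=\{\omega\in\Omega:\ \alpha+\beta t\ge\mu W_t(\omega)\ \text{ for all } t\ge 0\}.$$ For a path $\omega$ put $\Gamma=\Gamma(t)=e^{-\mu W_t\Lambda^s}$, $P(B,J)=(B\cdot\nabla)J-(J\cdot\nabla)B$, $V=\nabla\times U$ and $Q(U,V)=\Gamma P(\Gamma^{-1}U,\Gamma^{-1}V)$, and consider the system $$\partial_tU+Q(U,V)=-\tfrac12\mu^2\Lambda^{s+1}U,\qquad \operatorname{div}U=0,\qquad U(0)=U_0,\tag{$*$}$$ where the evolution equation is understood for each Fourier coefficient, at every $t\ge0$ (one-sided derivative at $t=0$). **Proposition.** Let $s\in(\frac34,1]$ and $\sigma\in(\frac{7}{4s},2)$. There is a constant $c_{\sigma,s}>0$ depending only on $\sigma$ and $s$ such that the following holds. Let $\mu,\alpha,\delta>0$, $\beta\in(0,\frac12\mu^2)$, $\phi(t)=\alpha+\beta t$, and let $U_0\in H\cap\dot{\mathcal G}^{\sigma,s}_{\alpha+\delta}$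 satisfy $$\|U_0\|_{\dot{\mathcal G}^{\sigma,s}_{\alpha+\delta}}<\frac{1}{c_{\sigma,s}}\,(\mu^2-2\beta).$$ Then for every sample path $\omega\in\Omega^{\alpha,\beta}_\mu$ the system $(*)$ has a unique global solution $U\in C([0,\infty);H\cap\dot{\mathcal G}^{\sigma,s}_{\phi(t)+\delta})$, which means that $U(t)\in H\cap\dot{\mathcal G}^{\sigma,s}_{\phi(t)+\delta}$ for every $t\ge0$ and that $t\mapsto e^{(\phi(t)+\delta)\Lambda^s}U(t)$ is continuous with values in $\dot H^{\sigma s}$. Moreover, $t\mapsto\|U(t)\|_{\dot{\mathcal G}^{\sigma,s}_{\phi(t)+\delta}}$ is nonincreasing on $[0,\infty)$. -/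

import Mathlib

open MeasureTheory Topology
open scoped NNReal

namespace EMHD

/-- The three-dimensional torus `ℝ³ / ℤ³`.  Its characters are
`x ↦ exp (i k · x)` with wave vectors `k ∈ 2πℤ³`. -/
abbrev Torus3 : Type := UnitAddTorus (Fin 3)

/-- The Haar probability measure of the torus. -/
noncomputable abbrev haar : Measure Torus3 := Measure.pi fun _ => AddCircle.haarAddCircle

/-- Complex scalar `L²` functions on the torus. -/
abbrev ScalarL2 : Type := Lp ℂ 2 haar

/-- Real vector fields of class `L²` on the torus. -/
abbrev VectorL2 : Type := Lp (EuclideanSpace ℝ (Fin 3)) 2 haar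

/-- The wave vector `k = 2πn ∈ 2πℤ³`. -/
noncomputable def wave (n : Fin 3 → ℤ) : EuclideanSpace ℝ (Fin 3) :=
  WithLp.toLp 2 fun i => 2 * Real.pi * (n i : ℝ)

/-- The components of a real vector field, regarded as complex-valued functions. -/
noncomputable def component (u : VectorL2) (i : Fin 3) : ScalarL2 :=
  (Complex.ofRealCLM.comp (EuclideanSpace.proj (𝕜 := ℝ) i)).compLp u

/-- The Fourier coefficient `û(k) = ∫ u(x) exp(-i k · x) dx ∈ ℂ³` at `k = 2πn`. -/
noncomputable def coeff (u : VectorL2) (n : Fin 3 → ℤ) : EuclideanSpace ℂ (Fin 3) :=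
  WithLp.toLp 2 fun i => UnitAddTorus.mFourierCoeff (component u i) n

/-! ### Function spaces -/

/-- The space `H` of square integrable real vector fields with zero mean and zero divergence
(`div u = 0` in the sense of distributions, that is `k · û(k) = 0` for all `k`). -/
def solenoidal : Set VectorL2 :=
  {u | ∫ x, u x ∂haar = 0 ∧ ∀ n, ∑ i, (wave n i : ℂ) * coeff u n i = 0}

/-- The homogeneous Sobolev space of order `r`: `∑ₖ |k|^(2r) |û(k)|² < ∞`. -/
def homSobolev (r : ℝ) : Set VectorL2 :=
  {u | Summable fun n => ‖wave n‖ ^ (2 * r) * ‖coeff u n‖ ^ 2}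

/-- The homogeneous Gevrey class with parameters `σ`, `s` and radius `φ`. -/
def gevreyClass (σ s φ : ℝ) : Set VectorL2 :=
  {u | u ∈ homSobolev (σ * s) ∧
    Summable fun n =>
      Real.exp (2 * φ * ‖wave n‖ ^ s) * ‖wave n‖ ^ (2 * σ * s) * ‖coeff u n‖ ^ 2}

/-- The homogeneous Gevrey norm with parameters `σ`, `s` and radius `φ`. -/
noncomputable def gevreyNorm (σ s φ : ℝ) (u : VectorL2) : ℝ :=
  Real.sqrt (∑' n,
    Real.exp (2 * φ * ‖wave n‖ ^ s) * ‖wave n‖ ^ (2 * σ * s) * ‖coeff u n‖ ^ 2)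

/-- `U ∈ C([0,∞); Ġ_{ψ(t)})` for a time-dependent radius `ψ`: every `U t` lies in the Gevrey class
of radius `ψ t`, and `t ↦ e^{ψ(t)Λˢ} U(t)` is continuous with values in the homogeneous Sobolev
space of order `σ s`. -/
def ContinuousGevrey (σ s : ℝ) (ψ : ℝ≥0 → ℝ) (U : ℝ≥0 → VectorL2) : Prop :=
  (∀ t, U t ∈ gevreyClass σ s (ψ t)) ∧
  ∀ t, Filter.Tendsto
    (fun r : ℝ≥0 => ∑' n, ‖wave n‖ ^ (2 * σ * s) *
      ‖Real.exp (ψ r * ‖wave n‖ ^ s) • coeff (U r) n -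
        Real.exp (ψ t * ‖wave n‖ ^ s) • coeff (U t) n‖ ^ 2)
    (𝓝 t) (𝓝 0)

/-! ### Fourier multipliers and the nonlinearity -/

open Classical in
/-- The (unbounded) Fourier multiplier with symbol `m`, with domain
`{f ∈ L² : m f̂ ∈ ℓ²}`; it is extended by the value `0` off its domain. -/
noncomputable def multiplier (m : (Fin 3 → ℤ) → ℂ) (f : ScalarL2) : ScalarL2 :=
  if h : Memℓp (fun n => m n * UnitAddTorus.mFourierCoeff f n) 2 then
    (UnitAddTorus.mFourierBasis (d := Fin 3)).repr.symm ⟨_, h⟩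
  else 0

/-- On its domain the multiplier acts on Fourier coefficients as it should. -/
theorem mFourierCoeff_multiplier (m : (Fin 3 → ℤ) → ℂ) (f : ScalarL2)
    (h : Memℓp (fun n => m n * UnitAddTorus.mFourierCoeff f n) 2) (n : Fin 3 → ℤ) :
    UnitAddTorus.mFourierCoeff (multiplier m f) n = m n * UnitAddTorus.mFourierCoeff f n := by
  rw [← UnitAddTorus.mFourierBasis_repr, multiplier, dif_pos h,
    LinearIsometryEquiv.apply_symm_apply]

/-- The partial derivative `∂ⱼ`, with symbol `i kⱼ`. -/
noncomputable def partialD (j : Fin 3) (f : ScalarL2) : ScalarL2 :=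
  multiplier (fun n => Complex.I * (wave n j : ℂ)) f

/-- The operator `e^{a Λˢ}`, with symbol `exp (a |k|ˢ)`. -/
noncomputable def expLambda (a s : ℝ) (f : ScalarL2) : ScalarL2 :=
  multiplier (fun n => (Real.exp (a * ‖wave n‖ ^ s) : ℂ)) f

/-- The curl; the indices are cyclic modulo `3`. -/
noncomputable def curl (F : Fin 3 → ScalarL2) : Fin 3 → ScalarL2 := fun i =>
  partialD (i + 1) (F (i + 2)) - partialD (i + 2) (F (i + 1))

/-- `P(F, G) = (F · ∇) G - (G · ∇) F`. -/
noncomputable def bracketP (F G : Fin 3 → ScalarL2) (i : Fin 3) (x : Torus3) : ℂ :=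
  ∑ j, (F j x * partialD j (G i) x - G j x * partialD j (F i) x)

/-- The Fourier coefficients of `Q(F, G) = Γ P(Γ⁻¹ F, Γ⁻¹ G)`, where `Γ = e^{-a Λˢ}`. -/
noncomputable def coeffQ (a s : ℝ) (F G : Fin 3 → ScalarL2) (n : Fin 3 → ℤ) :
    EuclideanSpace ℂ (Fin 3) :=
  WithLp.toLp 2 fun i =>
    (Real.exp (-a * ‖wave n‖ ^ s) : ℂ) *
      UnitAddTorus.mFourierCoeff
        (bracketP (fun l => expLambda a s (F l)) (fun l => expLambda a s (G l)) i) n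

/-! ### Sample paths and solutions -/

/-- Wiener space: continuous real paths on `[0,∞)` that start at `0`. -/
def pathSpace : Set C(ℝ≥0, ℝ) := {ω | ω 0 = 0}

/-- The paths with `μ W_t ≤ α + β t` for all `t ≥ 0`. -/
def goodPaths (μ α β : ℝ) : Set C(ℝ≥0, ℝ) :=
  {ω | ω ∈ pathSpace ∧ ∀ t : ℝ≥0, μ * ω t ≤ α + β * t}

/-- `U` is, for the sample path `ω`, a global solution in `C([0,∞); H ∩ Ġ_{ψ(t)})` of
`∂ₜU + Q(U, V) = -(μ²/2) Λ^{s+1} U`, `div U = 0`, `U(0) = U₀`, where `V = ∇ × U` and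
`Q(U, V) = Γ P(Γ⁻¹U, Γ⁻¹V)` with `Γ = e^{-μ W_t Λˢ}`.  The evolution equation holds
coefficientwise in Fourier space, for all `t ≥ 0` (with the one-sided derivative at `t = 0`). -/
structure IsGlobalSolution (μ σ s : ℝ) (ψ : ℝ≥0 → ℝ) (ω : C(ℝ≥0, ℝ)) (U₀ : VectorL2)
    (U : ℝ≥0 → VectorL2) : Prop where
  solenoidal : ∀ t, U t ∈ solenoidal
  continuous : ContinuousGevrey σ s ψ U
  initial : U 0 = U₀
  equation : ∀ (n : Fin 3 → ℤ) (t : ℝ≥0),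
    HasDerivWithinAt (fun r : ℝ => coeff (U r.toNNReal) n)
      (-coeffQ (μ * ω t) s (component (U t)) (curl (component (U t))) n
        - (1 / 2 * μ ^ 2 * ‖wave n‖ ^ (s + 1)) • coeff (U t) n)
      (Set.Ici 0) (t : ℝ)

end EMHD

/-!
The equation is solved on the Fourier side.  A solenoidal field is replaced by the family
`a : ℤ³ → ℂ³` of its Fourier coefficients; for solenoidal `U` one has
`P (U, curl U) = curl (curl U × U)`, so that the nonlinearity becomes the bilinear convolution
`quad` with the kernel `-k × ((m × v) × u)`, conjugated by `exp (A |k| ^ s)` with `A = μ W_t`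
(`coeffQ_eq_quad`).

The heart of the matter is the energy estimate `exists_energyRate_bounds`.  The triple product
`curl w · (curl v × u)` behind the nonlinearity is antisymmetric in `v` and the test function `w`
(`inner_interaction_antisymm`), so that in the energy balance only differences of weights enter.
Because `|k| ^ s ≤ |m| ^ s + |k - m| ^ s` and `A ≤ ψ`, the exponentials lose nothing, and the
difference of the weights leaves at most `1 - s` derivatives on one of the three factors, the other
two carrying the dissipation (`mul_abs_weightDiff_le`).  The factor with `1 - s` derivatives is
summed in a Wiener norm, which the Gevrey norm dominates since `σ s + s > 5 / 2`.  The outcome is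
`|nonlinear term| ≤ c ‖U‖ D`, where `D` is the dissipation.  The Brownian multiplier provides
`μ² D`, and the growth of the radius `α + β t + δ` costs at most `2 β D`.  Hence the energy decreases
as long as `c ‖U‖ < μ² - 2 β`, and this is preserved in time.

Solutions are limits of Galerkin approximations on cubes of modes (`exists_galerkin`).  The
difference of two approximate solutions is estimated by Gronwall's lemma in the weaker norm of
radius `α + β t` without derivatives (`exists_stability`), where the gap `δ` absorbs all derivatives
that fall on the truncation errors.  This shows that the approximations are Cauchy
(`IsGalerkinFamily.exists_norm_sub_sq_le`) and that any solution is their limit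
(`IsCoeffSolution.tendsto`), which gives uniqueness.

The energy of the limit is first studied at radii smaller than `α + β t + δ`, where all series
converge uniformly.  Passing to the full radius, the energy is nonincreasing
(`IsLimit.fullEnergy_antitone`), and over a time interval it drops by at most a constant times the
dissipation over that interval, which is integrable; so it is continuous
(`IsLimit.tendsto_fullEnergy`).  Together with the continuity of every coefficient this gives strong
continuity in the Gevrey class (`tendsto_tsum_norm_sub_sq`).
-/

namespace EMHD

/-! ### Elementary inequalities for the symmetrised weights -/

lemma rpow_sub_rpow_le_mul {s x y : ℝ} (hs : s ≤ 1) (hy : 0 < y) (hxy : y ≤ x) :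
    x ^ s - y ^ s ≤ x ^ (s - 1) * (x - y) := by
  have hx : 0 < x := hy.trans_le hxy
  have h1 : x ^ (s - 1) * x = x ^ s := by
    rw [← Real.rpow_add_one hx.ne', sub_add_cancel]
  have h2 : y ^ (s - 1) * y = y ^ s := by
    rw [← Real.rpow_add_one hy.ne', sub_add_cancel]
  have h3 : x ^ (s - 1) ≤ y ^ (s - 1) := Real.rpow_le_rpow_of_nonpos hy hxy (by linarith)
  nlinarith [mul_le_mul_of_nonneg_right h3 hy.le]

/-- The gain of the symmetrisation: the difference `e^p - e^{-p}` is small relative to `e^q`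
as soon as `p` is small relative to `q`. -/
lemma exp_neg_mul_exp_sub_exp_neg_le {p q θ : ℝ} (hθ : 0 ≤ θ) (hp : 0 ≤ p) (hpq : p ≤ q)
    (hpθ : p ≤ θ * q) :
    Real.exp (-q) * (Real.exp p - Real.exp (-p)) ≤ 2 * θ := by
  rcases le_or_gt (1 / 2) θ with h | h
  · have h1 : Real.exp (-q) * Real.exp p ≤ 1 := by
      rw [← Real.exp_add]; exact Real.exp_le_one_iff.2 (by linarith)
    have h2 : 0 < Real.exp (-q) * Real.exp (-p) := by positivity
    nlinarith
  · have hq : 0 ≤ q := hp.trans hpq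
    have e1 : Real.exp (-q) * (Real.exp p - Real.exp (-p))
        = Real.exp (-(q - p)) * (1 - Real.exp (-(2 * p))) := by
      rw [mul_sub, mul_sub, ← Real.exp_add, ← Real.exp_add, mul_one, ← Real.exp_add]
      ring_nf
    have e2 : 1 - Real.exp (-(2 * p)) ≤ 2 * p := by
      linarith [Real.add_one_le_exp (-(2 * p))]
    have e3 : Real.exp (-(q - p)) ≤ Real.exp (-(q / 2)) :=
      Real.exp_le_exp.2 (by nlinarith)
    have e4 : Real.exp (-(q / 2)) * q ≤ 1 := by
      have := Real.quadratic_le_exp_of_nonneg (x := q / 2) (by positivity)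
      rw [Real.exp_neg, inv_mul_le_iff₀ (Real.exp_pos _)]
      nlinarith [sq_nonneg (q / 2 - 1)]
    calc _ = Real.exp (-(q - p)) * (1 - Real.exp (-(2 * p))) := e1
      _ ≤ Real.exp (-(q - p)) * (2 * p) := by gcongr
      _ ≤ Real.exp (-(q / 2)) * (2 * (θ * q)) := by gcongr
      _ = 2 * θ * (Real.exp (-(q / 2)) * q) := by ring
      _ ≤ 2 * θ * 1 := by gcongr
      _ = 2 * θ := by ring

lemma rpow_sub_rpow_le_rpow_mul {m t x y z : ℝ} (hm : m = 0 ∨ 1 ≤ m) (ht : 0 ≤ t) (ht1 : t ≤ 1)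
    (hy : 0 < y) (hxy : y ≤ x) (hxz : x ≤ y + z) :
    x ^ m - y ^ m ≤ m * x ^ m * (z / x) ^ t := by
  have hx : 0 < x := hy.trans_le hxy
  rcases hm with rfl | hm
  · simp
  have hb := one_add_mul_self_le_rpow_one_add (s := y / x - 1)
    (by have : 0 < y / x := by positivity
        linarith) hm
  have e : (1 + (y / x - 1)) = y / x := by ring
  rw [e, Real.div_rpow hy.le hx.le, le_div_iff₀ (by positivity)] at hb
  have h0 : 0 ≤ 1 - y / x := by
    rw [sub_nonneg, div_le_one hx]; exact hxy
  have h1 : 1 - y / x ≤ z / x := by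
    rw [sub_le_iff_le_add, ← add_div, le_div_iff₀ hx]; linarith
  have h2 : 1 - y / x ≤ (z / x) ^ t := by
    calc 1 - y / x = (1 - y / x) ^ (1 : ℝ) := (Real.rpow_one _).symm
      _ ≤ (1 - y / x) ^ t := Real.rpow_le_rpow_of_exponent_ge_of_imp h0
          (by have : 0 < y / x := by positivity
              linarith) ht1 (fun h h' => by norm_num at *)
      _ ≤ (z / x) ^ t := Real.rpow_le_rpow h0 h1 ht
  have hxm : 0 < x ^ m := by positivity
  nlinarith [mul_le_mul_of_nonneg_left h2 (by positivity : 0 ≤ m * x ^ m)]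

/-- The change of the weight `x ^ m * exp (lam * (x ^ s - z ^ s - y ^ s))` of an interaction when
the frequencies `x` and `y` are exchanged. -/
noncomputable def weightDiff (m s lam x y z : ℝ) : ℝ :=
  x ^ m * Real.exp (lam * (x ^ s - z ^ s - y ^ s)) -
    y ^ m * Real.exp (lam * (y ^ s - z ^ s - x ^ s))

lemma abs_weightDiff_comm (m s lam x y z : ℝ) :
    |weightDiff m s lam x y z| = |weightDiff m s lam y x z| := by
  unfold weightDiff; rw [abs_sub_comm]

lemma abs_weightDiff_le {m s lam x y z : ℝ} (hm : m = 0 ∨ 1 ≤ m) (hs : 0 < s) (hs1 : s ≤ 1)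
    (hlam : 0 ≤ lam) (hy : 0 < y) (hxy : y ≤ x) (hz : 0 < z) (hxz : x ≤ y + z) :
    |weightDiff m s lam x y z| ≤ (2 + m) * x ^ m * (z / x) ^ (1 - s) := by
  have hx : 0 < x := hy.trans_le hxy
  have hm0 : 0 ≤ m := by rcases hm with h | h <;> linarith
  have hyx : y ^ s ≤ x ^ s := Real.rpow_le_rpow hy.le hxy hs.le
  have hsub : x ^ s - y ^ s ≤ z ^ s := by
    have h1 : x ^ s ≤ (y + z) ^ s := Real.rpow_le_rpow hx.le hxz hs.le
    have h2 := Real.rpow_add_le_add_rpow hy.le hz.le hs.le hs1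
    linarith
  have hθ : x ^ s - y ^ s ≤ (z / x) ^ (1 - s) * z ^ s := by
    calc x ^ s - y ^ s ≤ x ^ (s - 1) * (x - y) := rpow_sub_rpow_le_mul hs1 hy hxy
      _ ≤ x ^ (s - 1) * z := by gcongr; linarith
      _ = (z / x) ^ (1 - s) * z ^ s := by
        rw [Real.div_rpow hz.le hx.le, div_mul_eq_mul_div, ← Real.rpow_add hz, sub_add_cancel,
          Real.rpow_one, ← neg_sub 1 s, Real.rpow_neg hx.le]
        field_simp
  have hA := exp_neg_mul_exp_sub_exp_neg_le (p := lam * (x ^ s - y ^ s)) (q := lam * z ^ s)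
    (θ := (z / x) ^ (1 - s)) (by positivity) (mul_nonneg hlam (by linarith)) (by gcongr)
    (by nlinarith [mul_le_mul_of_nonneg_left hθ hlam])
  have hB := rpow_sub_rpow_le_rpow_mul hm (sub_nonneg.2 hs1) (by linarith) hy hxy hxz
  have hxym : y ^ m ≤ x ^ m := Real.rpow_le_rpow hy.le hxy hm0
  have e1 : Real.exp (lam * (x ^ s - z ^ s - y ^ s))
      = Real.exp (-(lam * z ^ s)) * Real.exp (lam * (x ^ s - y ^ s)) := by
    rw [← Real.exp_add]; ring_nf
  have e2 : Real.exp (lam * (y ^ s - z ^ s - x ^ s))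
      = Real.exp (-(lam * z ^ s)) * Real.exp (-(lam * (x ^ s - y ^ s))) := by
    rw [← Real.exp_add]; ring_nf
  have e3 : Real.exp (lam * (y ^ s - z ^ s - x ^ s)) ≤ 1 := by
    apply Real.exp_le_one_iff.2
    have : 0 < z ^ s := by positivity
    apply mul_nonpos_of_nonneg_of_nonpos hlam; linarith
  have e4 : Real.exp (lam * (y ^ s - z ^ s - x ^ s)) ≤
      Real.exp (lam * (x ^ s - z ^ s - y ^ s)) := by
    apply Real.exp_le_exp.2; gcongr
  have hnn : 0 ≤ weightDiff m s lam x y z := by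
    unfold weightDiff
    rw [sub_nonneg]; gcongr
  rw [abs_of_nonneg hnn]
  have key : weightDiff m s lam x y z = x ^ m * (Real.exp (-(lam * z ^ s)) *
      (Real.exp (lam * (x ^ s - y ^ s)) - Real.exp (-(lam * (x ^ s - y ^ s)))))
      + (x ^ m - y ^ m) * Real.exp (lam * (y ^ s - z ^ s - x ^ s)) := by
    unfold weightDiff; rw [e1, e2]; ring
  rw [key]
  have hxm : 0 < x ^ m := by positivity
  have t1 := mul_le_mul_of_nonneg_left hA hxm.le
  have t2 := mul_le_mul_of_nonneg_left e3 (sub_nonneg.2 hxym)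
  nlinarith

/-- The order-zero bound: the symmetrised interaction costs `s + 1` derivatives, shared evenly
between the two high-frequency factors. -/
lemma mul_abs_weightDiff_zero_le {s lam x y z : ℝ} (hs : 0 < s) (hs1 : s ≤ 1)
    (hlam : 0 ≤ lam) (hx : 0 < x) (hy : 0 < y) (hz : 0 < z) (hxz : x ≤ y + z) (hyz : y ≤ x + z) :
    x * y * |weightDiff 0 s lam x y z| ≤
      2 * (x ^ ((s + 1) / 2) * y ^ ((s + 1) / 2) * z ^ (1 - s)) := by
  wlog hxy : y ≤ x generalizing x y
  · have := this hy hx hyz hxz (le_of_not_ge hxy)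
    rw [abs_weightDiff_comm, mul_comm x y, mul_comm (x ^ _)]; exact this
  have h := abs_weightDiff_le (m := 0) (.inl rfl) hs hs1 hlam hy hxy hz hxz
  rw [Real.rpow_zero] at h
  have e1 : x * (z / x) ^ (1 - s) = x ^ s * z ^ (1 - s) := by
    rw [Real.div_rpow hz.le hx.le, Real.rpow_sub hx, Real.rpow_one]
    field_simp
  have e2 : x ^ s = x ^ ((s + 1) / 2) * x ^ ((s - 1) / 2) := by
    rw [← Real.rpow_add hx]; ring_nf
  have e3 : x ^ ((s - 1) / 2) ≤ y ^ ((s - 1) / 2) :=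
    Real.rpow_le_rpow_of_nonpos hy hxy (by linarith)
  have e4 : y ^ ((s - 1) / 2) * y = y ^ ((s + 1) / 2) := by
    rw [← Real.rpow_add_one hy.ne']; ring_nf
  calc x * y * |weightDiff 0 s lam x y z| ≤ x * y * ((2 + 0) * 1 * (z / x) ^ (1 - s)) := by gcongr
    _ = 2 * (x * (z / x) ^ (1 - s)) * y := by ring
    _ = 2 * (x ^ ((s + 1) / 2) * (x ^ ((s - 1) / 2) * y) * z ^ (1 - s)) := by
        rw [e1, e2]; ring
    _ ≤ 2 * (x ^ ((s + 1) / 2) * (y ^ ((s - 1) / 2) * y) * z ^ (1 - s)) := by gcongr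
    _ = _ := by rw [e4]

/-- The bound at order `r ≥ 1/2`: the symmetrised interaction costs `s + 1` derivatives, shared
evenly between two of the three factors, and `1 - s` derivatives on the remaining one. -/
lemma mul_abs_weightDiff_le {r s lam x y z : ℝ} (hr : 1 ≤ 2 * r) (hs : 0 < s) (hs1 : s ≤ 1)
    (hlam : 0 ≤ lam) (hx : 0 < x) (hy : 0 < y) (hz : 0 < z) (hxz : x ≤ y + z) (hyz : y ≤ x + z) :
    x * y * |weightDiff (2 * r) s lam x y z| ≤ (2 + 2 * r) * 2 ^ (r + (s - 1) / 2) *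
      (x ^ (r + (s + 1) / 2) * y ^ (r + (s + 1) / 2) * z ^ (1 - s) +
        x ^ (r + (s + 1) / 2) * y ^ (1 - s) * z ^ (r + (s + 1) / 2) +
        x ^ (1 - s) * y ^ (r + (s + 1) / 2) * z ^ (r + (s + 1) / 2)) := by
  wlog hxy : y ≤ x generalizing x y
  · have := this hy hx hyz hxz (le_of_not_ge hxy)
    rw [abs_weightDiff_comm, mul_comm x y]
    refine this.trans (le_of_eq ?_)
    ring
  have h := abs_weightDiff_le (m := 2 * r) (.inr hr) hs hs1 hlam hy hxy hz hxz
  set ρ := r + (s + 1) / 2 with hρ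
  set q := r + (s - 1) / 2 with hq
  have hq0 : 0 ≤ q := by rw [hq]; linarith
  have e1 : x * x ^ (2 * r) * (z / x) ^ (1 - s) = x ^ ρ * x ^ q * z ^ (1 - s) := by
    have : x * x ^ (2 * r) = x ^ ρ * x ^ q * x ^ (1 - s) := by
      rw [← Real.rpow_add hx, ← Real.rpow_add hx, mul_comm, ← Real.rpow_add_one hx.ne']
      congr 1; rw [hρ, hq]; ring
    rw [Real.div_rpow hz.le hx.le, this]
    field_simp
  have hmain : x * y * |weightDiff (2 * r) s lam x y z| ≤
      (2 + 2 * r) * (x ^ ρ * x ^ q * y * z ^ (1 - s)) := by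
    calc x * y * |weightDiff (2 * r) s lam x y z|
        ≤ x * y * ((2 + 2 * r) * x ^ (2 * r) * (z / x) ^ (1 - s)) := by gcongr
      _ = (2 + 2 * r) * y * (x * x ^ (2 * r) * (z / x) ^ (1 - s)) := by ring
      _ = _ := by rw [e1]; ring
  refine hmain.trans ?_
  rw [mul_assoc (2 + 2 * r)]
  refine mul_le_mul_of_nonneg_left ?_ (by linarith)
  -- the larger one of `y` and `z` is comparable to `x` and takes over the factor `x ^ q`
  rcases le_or_gt z y with hzy | hzy
  · have e2 : x ^ q ≤ 2 ^ q * y ^ q := by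
      rw [← Real.mul_rpow (by norm_num) hy.le]
      exact Real.rpow_le_rpow hx.le (by linarith) hq0
    have e3 : y ^ q * y = y ^ ρ := by
      rw [← Real.rpow_add_one hy.ne']; congr 1; rw [hρ, hq]; ring
    calc x ^ ρ * x ^ q * y * z ^ (1 - s) ≤ x ^ ρ * (2 ^ q * y ^ q) * y * z ^ (1 - s) := by gcongr
      _ = 2 ^ q * (x ^ ρ * (y ^ q * y) * z ^ (1 - s)) := by ring
      _ = 2 ^ q * (x ^ ρ * y ^ ρ * z ^ (1 - s)) := by rw [e3]
      _ ≤ _ := by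
        refine mul_le_mul_of_nonneg_left ?_ (by positivity)
        have h1 : 0 < x ^ ρ * y ^ (1 - s) * z ^ ρ := by positivity
        have h2 : 0 < x ^ (1 - s) * y ^ ρ * z ^ ρ := by positivity
        linarith
  · have e2 : x ^ q ≤ 2 ^ q * z ^ q := by
      rw [← Real.mul_rpow (by norm_num) hz.le]
      exact Real.rpow_le_rpow hx.le (by linarith) hq0
    have e3 : z ^ q * z ^ (1 - s) = z ^ ρ * z ^ (-s) := by
      rw [← Real.rpow_add hz, ← Real.rpow_add hz]; congr 1; rw [hρ, hq]; ring
    have e4 : z ^ (-s) ≤ y ^ (-s) := Real.rpow_le_rpow_of_nonpos hy hzy.le (by linarith)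
    have e5 : y ^ (-s) * y = y ^ (1 - s) := by
      rw [← Real.rpow_add_one hy.ne']; congr 1; ring
    calc x ^ ρ * x ^ q * y * z ^ (1 - s) ≤ x ^ ρ * (2 ^ q * z ^ q) * y * z ^ (1 - s) := by gcongr
      _ = 2 ^ q * (x ^ ρ * (z ^ q * z ^ (1 - s)) * y) := by ring
      _ = 2 ^ q * (x ^ ρ * (z ^ ρ * z ^ (-s)) * y) := by rw [e3]
      _ ≤ 2 ^ q * (x ^ ρ * (z ^ ρ * y ^ (-s)) * y) := by gcongr
      _ = 2 ^ q * (x ^ ρ * (y ^ (-s) * y) * z ^ ρ) := by ring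
      _ = 2 ^ q * (x ^ ρ * y ^ (1 - s) * z ^ ρ) := by rw [e5]
      _ ≤ _ := by
        refine mul_le_mul_of_nonneg_left ?_ (by positivity)
        have h1 : 0 < x ^ ρ * y ^ ρ * z ^ (1 - s) := by positivity
        have h2 : 0 < x ^ (1 - s) * y ^ ρ * z ^ ρ := by positivity
        linarith

/-! ### Wave vectors and the interaction of two modes -/

/-- Complex vectors, with the Hermitian norm. -/
abbrev C3 : Type := EuclideanSpace ℂ (Fin 3)

/-- The wave number `|k|` of the mode `k = 2πn`. -/
noncomputable def wnum (n : Fin 3 → ℤ) : ℝ := ‖wave n‖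

/-- The wave vector, regarded as a complex vector. -/
noncomputable def cwave (n : Fin 3 → ℤ) : C3 := WithLp.toLp 2 fun i => (wave n i : ℂ)

lemma wave_apply (n : Fin 3 → ℤ) (i : Fin 3) : wave n i = 2 * Real.pi * (n i : ℝ) := rfl

@[simp] lemma cwave_apply (n : Fin 3 → ℤ) (i : Fin 3) : cwave n i = (wave n i : ℂ) := rfl

lemma wave_neg (n : Fin 3 → ℤ) : wave (-n) = -wave n := by
  ext i; simp [wave_apply]

lemma wave_sub (n m : Fin 3 → ℤ) : wave (n - m) = wave n - wave m := by
  ext i; simp [wave_apply, mul_sub]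

lemma wave_zero : wave 0 = 0 := by
  ext i; simp [wave_apply]

lemma wnum_nonneg (n : Fin 3 → ℤ) : 0 ≤ wnum n := norm_nonneg _

lemma wnum_zero : wnum 0 = 0 := by rw [wnum, wave_zero, norm_zero]

lemma wnum_neg (n : Fin 3 → ℤ) : wnum (-n) = wnum n := by rw [wnum, wave_neg, norm_neg, wnum]

lemma wnum_sub_comm (n m : Fin 3 → ℤ) : wnum (n - m) = wnum (m - n) := by
  rw [← wnum_neg, neg_sub]

lemma wnum_le_add (n m : Fin 3 → ℤ) : wnum n ≤ wnum m + wnum (n - m) := by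
  unfold wnum; rw [wave_sub]; exact norm_le_norm_add_norm_sub' (wave n) (wave m)

lemma wnum_eq (n : Fin 3 → ℤ) : wnum n = 2 * Real.pi * ‖(WithLp.toLp 2 fun i => (n i : ℝ) :
    EuclideanSpace ℝ (Fin 3))‖ := by
  have : wave n = (2 * Real.pi) • (WithLp.toLp 2 fun i => (n i : ℝ) :
    EuclideanSpace ℝ (Fin 3)) := by ext i; simp [wave_apply]
  rw [wnum, this, norm_smul, Real.norm_of_nonneg (by positivity)]

lemma abs_le_wnum (n : Fin 3 → ℤ) (i : Fin 3) : ((|n i| : ℤ) : ℝ) ≤ wnum n := by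
  have h := PiLp.norm_apply_le (wave n) i
  rw [wave_apply, norm_mul, Real.norm_of_nonneg (by positivity), Real.norm_eq_abs] at h
  refine le_trans ?_ h
  rw [Int.cast_abs]
  have := Real.pi_gt_three
  nlinarith [abs_nonneg (n i : ℝ)]

lemma one_le_wnum {n : Fin 3 → ℤ} (hn : n ≠ 0) : 1 ≤ wnum n := by
  obtain ⟨i, hi⟩ := Function.ne_iff.1 hn
  have h1 : (1 : ℝ) ≤ (|n i| : ℤ) := by exact_mod_cast Int.one_le_abs hi
  exact h1.trans (abs_le_wnum n i)

lemma wnum_pos {n : Fin 3 → ℤ} (hn : n ≠ 0) : 0 < wnum n := zero_lt_one.trans_le (one_le_wnum hn)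

lemma norm_cwave (n : Fin 3 → ℤ) : ‖cwave n‖ = wnum n := by
  simp [wnum, EuclideanSpace.norm_eq]

/-- The complex bilinear cross product. -/
def cross (u v : C3) : C3 := WithLp.toLp 2 (crossProduct u.ofLp v.ofLp)

@[simp] lemma cross_apply_zero (u v : C3) : cross u v 0 = u 1 * v 2 - u 2 * v 1 := rfl
@[simp] lemma cross_apply_one (u v : C3) : cross u v 1 = u 2 * v 0 - u 0 * v 2 := rfl
@[simp] lemma cross_apply_two (u v : C3) : cross u v 2 = u 0 * v 1 - u 1 * v 0 := rfl

lemma cross_add_left (u u' v : C3) : cross (u + u') v = cross u v + cross u' v := by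
  ext i; fin_cases i <;> simp <;> ring
lemma cross_add_right (u v v' : C3) : cross u (v + v') = cross u v + cross u v' := by
  ext i; fin_cases i <;> simp <;> ring
lemma cross_smul_left (c : ℝ) (u v : C3) : cross (c • u) v = c • cross u v := by
  ext i; fin_cases i <;> simp <;> ring
lemma cross_smul_right (c : ℝ) (u v : C3) : cross u (c • v) = c • cross u v := by
  ext i; fin_cases i <;> simp <;> ring

lemma norm_cross_le (u v : C3) : ‖cross u v‖ ≤ 2 * (‖u‖ * ‖v‖) := by
  have aux : ∀ a b c d : ℂ, ‖a * b - c * d‖ ^ 2 ≤ 2 * (‖a‖ ^ 2 * ‖b‖ ^ 2 + ‖c‖ ^ 2 * ‖d‖ ^ 2) := by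
    intro a b c d
    have h := norm_sub_le (a * b) (c * d)
    rw [norm_mul, norm_mul] at h
    nlinarith [norm_nonneg (a * b - c * d), sq_nonneg (‖a‖ * ‖b‖ - ‖c‖ * ‖d‖)]
  refine le_of_sq_le_sq ?_ (by positivity)
  rw [mul_pow, mul_pow, EuclideanSpace.norm_sq_eq, EuclideanSpace.norm_sq_eq,
    EuclideanSpace.norm_sq_eq]
  simp only [Fin.sum_univ_three, cross_apply_zero, cross_apply_one, cross_apply_two]
  have h0 := aux (u 1) (v 2) (u 2) (v 1)
  have h1 := aux (u 2) (v 0) (u 0) (v 2)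
  have h2 := aux (u 0) (v 1) (u 1) (v 0)
  nlinarith [mul_nonneg (sq_nonneg ‖u 0‖) (sq_nonneg ‖v 0‖),
    mul_nonneg (sq_nonneg ‖u 1‖) (sq_nonneg ‖v 1‖), mul_nonneg (sq_nonneg ‖u 2‖) (sq_nonneg ‖v 2‖),
    mul_nonneg (sq_nonneg ‖u 1‖) (sq_nonneg ‖v 2‖), mul_nonneg (sq_nonneg ‖u 2‖) (sq_nonneg ‖v 1‖),
    mul_nonneg (sq_nonneg ‖u 0‖) (sq_nonneg ‖v 2‖), mul_nonneg (sq_nonneg ‖u 2‖) (sq_nonneg ‖v 0‖),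
    mul_nonneg (sq_nonneg ‖u 0‖) (sq_nonneg ‖v 1‖), mul_nonneg (sq_nonneg ‖u 1‖) (sq_nonneg ‖v 0‖)]

/-- The contribution to the mode `n` of `curl (curl U × B)` that comes from the mode `m` of `U`,
with amplitude `v`, and the mode `n - m` of `B`, with amplitude `u`.  (The two factors `i` of the
two curls combine to the sign.) -/
noncomputable def interaction (n m : Fin 3 → ℤ) (u v : C3) : C3 :=
  -cross (cwave n) (cross (cross (cwave m) v) u)

lemma interaction_add_left (n m : Fin 3 → ℤ) (u u' v : C3) :
    interaction n m (u + u') v = interaction n m u v + interaction n m u' v := by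
  simp only [interaction, cross_add_right, neg_add]

lemma interaction_add_right (n m : Fin 3 → ℤ) (u v v' : C3) :
    interaction n m u (v + v') = interaction n m u v + interaction n m u v' := by
  simp only [interaction, cross_add_right, cross_add_left, neg_add]

lemma interaction_smul_left (n m : Fin 3 → ℤ) (c : ℝ) (u v : C3) :
    interaction n m (c • u) v = c • interaction n m u v := by
  simp only [interaction, cross_smul_right, smul_neg]

lemma interaction_smul_right (n m : Fin 3 → ℤ) (c : ℝ) (u v : C3) :
    interaction n m u (c • v) = c • interaction n m u v := by
  simp only [interaction, cross_smul_right, cross_smul_left, smul_neg]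

lemma interaction_zero_left (n m : Fin 3 → ℤ) (v : C3) : interaction n m 0 v = 0 := by
  simpa using interaction_smul_left n m 0 0 v

lemma interaction_zero_right (n m : Fin 3 → ℤ) (u : C3) : interaction n m u 0 = 0 := by
  simpa using interaction_smul_right n m 0 u 0

lemma norm_interaction_le (n m : Fin 3 → ℤ) (u v : C3) :
    ‖interaction n m u v‖ ≤ 8 * (wnum n * wnum m * ‖u‖ * ‖v‖) := by
  rw [interaction, norm_neg]
  have h1 := norm_cross_le (cwave n) (cross (cross (cwave m) v) u)
  have h2 := norm_cross_le (cross (cwave m) v) u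
  have h3 := norm_cross_le (cwave m) v
  rw [norm_cwave] at h1 h3
  have hn := wnum_nonneg n
  calc _ ≤ 2 * (wnum n * ‖cross (cross (cwave m) v) u‖) := h1
    _ ≤ 2 * (wnum n * (2 * ((2 * (wnum m * ‖v‖)) * ‖u‖))) := by
      gcongr; exact h2.trans (by gcongr)
    _ = _ := by ring

/-- The componentwise complex conjugate. -/
noncomputable def conj3 (u : C3) : C3 := WithLp.toLp 2 fun i => starRingEnd ℂ (u i)

@[simp] lemma conj3_apply (u : C3) (i : Fin 3) : conj3 u i = starRingEnd ℂ (u i) := rfl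

lemma conj3_conj3 (u : C3) : conj3 (conj3 u) = u := by ext i; simp

lemma conj3_add (u v : C3) : conj3 (u + v) = conj3 u + conj3 v := by ext i; simp

lemma conj3_sub (u v : C3) : conj3 (u - v) = conj3 u - conj3 v := by ext i; simp

lemma conj3_smul (c : ℝ) (u : C3) : conj3 (c • u) = c • conj3 u := by ext i; simp

lemma conj3_zero : conj3 0 = 0 := by ext i; simp

lemma continuous_conj3 : Continuous conj3 := by
  unfold conj3
  exact (PiLp.continuous_toLp 2 _).comp (by fun_prop)

lemma interaction_neg_conj3 (n m : Fin 3 → ℤ) (u v : C3) :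
    interaction (-n) (-m) (conj3 u) (conj3 v) = conj3 (interaction n m u v) := by
  ext i; fin_cases i <;> simp [interaction, wave_neg] <;> ring

/-- The Fourier image `k × w` of a curl is orthogonal to `k`. -/
lemma sum_wave_mul_interaction (n m : Fin 3 → ℤ) (u v : C3) :
    ∑ i, (wave n i : ℂ) * interaction n m u v i = 0 := by
  simp [Fin.sum_univ_three, interaction]; ring

lemma inner_C3 (u v : C3) : inner ℝ u v = ∑ i, ((u i).re * (v i).re + (u i).im * (v i).im) := by
  rw [PiLp.inner_apply]
  refine Finset.sum_congr rfl fun i _ => ?_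
  rw [Complex.inner]; simp [Complex.mul_re]; ring

/-- The scalar triple product `curl w · (curl v × u)` is antisymmetric in `v` and `w`: the
cancellation behind the energy estimates. -/
lemma inner_interaction_antisymm (n m : Fin 3 → ℤ) (u v w : C3) :
    inner ℝ (interaction n m u v) w = -inner ℝ (interaction m n (conj3 u) w) v := by
  simp only [inner_C3, Fin.sum_univ_three, interaction, PiLp.neg_apply, cross_apply_zero,
    cross_apply_one, cross_apply_two, cwave_apply, conj3_apply, Complex.neg_re, Complex.neg_im,
    Complex.sub_re, Complex.sub_im, Complex.mul_re, Complex.mul_im, Complex.ofReal_re,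
    Complex.ofReal_im, Complex.conj_re, Complex.conj_im, zero_mul, sub_zero, add_zero]
  ring

/-! ### Trilinear estimates for the nonlinearity on finitely many modes -/

/-- The Fourier coefficients of `Γ (curl (curl Γ⁻¹U × Γ⁻¹B))`, `Γ = e^{-A Λˢ}`, in terms of the
coefficients `a` of `B` and `b` of `U`. -/
noncomputable def quad (A s : ℝ) (a b : (Fin 3 → ℤ) → C3) (n : Fin 3 → ℤ) : C3 :=
  ∑' m, Real.exp (A * (wnum (n - m) ^ s + wnum m ^ s - wnum n ^ s)) •
    interaction n m (a (n - m)) (b m)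

/-- The weight `|k|^p e^{2ψ|k|ˢ}` of a Gevrey norm. -/
noncomputable def gw (s p ψ : ℝ) (n : Fin 3 → ℤ) : ℝ :=
  wnum n ^ p * Real.exp (2 * ψ * wnum n ^ s)

/-- The sum `∑ |k|^p e^{2ψ|k|ˢ} |a(k)|²` over finitely many modes. -/
noncomputable def energy (S : Finset (Fin 3 → ℤ)) (s p ψ : ℝ) (a : (Fin 3 → ℤ) → C3) : ℝ :=
  ∑ n ∈ S, gw s p ψ n * ‖a n‖ ^ 2

/-- The sum `∑ |k|^p e^{ψ|k|ˢ} |a(k)|` over finitely many modes. -/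
noncomputable def wiener (S : Finset (Fin 3 → ℤ)) (s p ψ : ℝ) (a : (Fin 3 → ℤ) → C3) : ℝ :=
  ∑ n ∈ S, wnum n ^ p * (Real.exp (ψ * wnum n ^ s) * ‖a n‖)

lemma gw_nonneg (s p ψ : ℝ) (n : Fin 3 → ℤ) : 0 ≤ gw s p ψ n := by
  have := wnum_nonneg n
  unfold gw; positivity

lemma energy_nonneg (S : Finset (Fin 3 → ℤ)) (s p ψ : ℝ) (a : (Fin 3 → ℤ) → C3) :
    0 ≤ energy S s p ψ a :=
  Finset.sum_nonneg fun n _ => mul_nonneg (gw_nonneg s p ψ n) (sq_nonneg _)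

lemma quad_eq_sum {S : Finset (Fin 3 → ℤ)} (A s : ℝ) (a : (Fin 3 → ℤ) → C3)
    {b : (Fin 3 → ℤ) → C3} (hb : ∀ n ∉ S, b n = 0) (n : Fin 3 → ℤ) :
    quad A s a b n = ∑ m ∈ S, Real.exp (A * (wnum (n - m) ^ s + wnum m ^ s - wnum n ^ s)) •
      interaction n m (a (n - m)) (b m) :=
  tsum_eq_sum fun m hm => by rw [hb m hm, interaction_zero_right, smul_zero]

lemma sum_comp_le_sum {ι κ : Type*} [DecidableEq ι] {S : Finset ι} {h : ι → ℝ} (h0 : ∀ n, 0 ≤ h n)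
    (hS : ∀ n ∉ S, h n = 0) {e : κ → ι} (he : Function.Injective e) (T : Finset κ) :
    ∑ n ∈ T, h (e n) ≤ ∑ n ∈ S, h n := by
  rw [← Finset.sum_image (f := h) (s := T) (g := e) (fun x _ y _ hxy => he hxy)]
  rw [← Finset.sum_filter_add_sum_filter_not (T.image e) (· ∈ S) h,
    Finset.sum_eq_zero (s := (T.image e).filter (· ∉ S)) (fun x hx => hS x (Finset.mem_filter.1 hx).2),
    add_zero]
  exact Finset.sum_le_sum_of_subset_of_nonneg (fun x hx => (Finset.mem_filter.1 hx).2)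
    fun x _ _ => h0 x

section Young

variable {S : Finset (Fin 3 → ℤ)} {f h : (Fin 3 → ℤ) → ℝ}

lemma sum_sum_mul_le_low_sub (h0 : ∀ n, 0 ≤ h n) (hS : ∀ n ∉ S, h n = 0) :
    ∑ n ∈ S, ∑ m ∈ S, f n * f m * h (n - m) ≤ (∑ n ∈ S, h n) * ∑ n ∈ S, f n ^ 2 := by
  have e1 : ∑ n ∈ S, ∑ m ∈ S, f n ^ 2 * h (n - m) ≤ (∑ n ∈ S, h n) * ∑ n ∈ S, f n ^ 2 := by
    rw [Finset.mul_sum]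
    refine Finset.sum_le_sum fun n _ => ?_
    rw [← Finset.mul_sum, mul_comm]
    exact mul_le_mul_of_nonneg_right
      (sum_comp_le_sum h0 hS (e := fun m => n - m) sub_right_injective S) (sq_nonneg _)
  have e2 : ∑ n ∈ S, ∑ m ∈ S, f m ^ 2 * h (n - m) ≤ (∑ n ∈ S, h n) * ∑ n ∈ S, f n ^ 2 := by
    rw [Finset.sum_comm, Finset.mul_sum]
    refine Finset.sum_le_sum fun n _ => ?_
    rw [← Finset.mul_sum, mul_comm]
    exact mul_le_mul_of_nonneg_right
      (sum_comp_le_sum h0 hS (e := fun m => m - n) sub_left_injective S) (sq_nonneg _)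
  have e3 : ∑ n ∈ S, ∑ m ∈ S, f n * f m * h (n - m) ≤
      ∑ n ∈ S, ∑ m ∈ S, (1 / 2 * (f n ^ 2 * h (n - m)) + 1 / 2 * (f m ^ 2 * h (n - m))) :=
    Finset.sum_le_sum fun n _ => Finset.sum_le_sum fun m _ => by
      nlinarith [h0 (n - m), mul_nonneg (h0 (n - m)) (sq_nonneg (f n - f m))]
  simp only [Finset.sum_add_distrib, ← Finset.mul_sum] at e1 e3
  linarith

lemma sum_sum_mul_le_low_fst (h0 : ∀ n, 0 ≤ h n) (hS : ∀ n ∉ S, f n = 0) :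
    ∑ n ∈ S, ∑ m ∈ S, h n * f m * f (n - m) ≤ (∑ n ∈ S, h n) * ∑ n ∈ S, f n ^ 2 := by
  rw [Finset.sum_mul]
  refine Finset.sum_le_sum fun n _ => ?_
  have e1 := sum_comp_le_sum (S := S) (h := fun m => f m ^ 2) (fun m => sq_nonneg _)
    (fun m hm => by simp [hS m hm]) (e := fun m => n - m) sub_right_injective S
  have e3 : ∑ m ∈ S, f m * f (n - m) ≤ ∑ m ∈ S, (1 / 2 * f m ^ 2 + 1 / 2 * f (n - m) ^ 2) :=
    Finset.sum_le_sum fun m _ => by nlinarith [sq_nonneg (f m - f (n - m))]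
  simp only [Finset.sum_add_distrib, ← Finset.mul_sum] at e3
  simp only [mul_assoc, ← Finset.mul_sum]
  exact mul_le_mul_of_nonneg_left (by linarith) (h0 n)

lemma sum_sum_mul_le_low_snd (h0 : ∀ n, 0 ≤ h n) (hS : ∀ n ∉ S, f n = 0) :
    ∑ n ∈ S, ∑ m ∈ S, f n * h m * f (n - m) ≤ (∑ n ∈ S, h n) * ∑ n ∈ S, f n ^ 2 := by
  rw [Finset.sum_comm, Finset.sum_mul]
  refine Finset.sum_le_sum fun m _ => ?_
  have e1 := sum_comp_le_sum (S := S) (h := fun m => f m ^ 2) (fun m => sq_nonneg _)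
    (fun m hm => by simp [hS m hm]) (e := fun n => n - m) sub_left_injective S
  have e3 : ∑ n ∈ S, f n * f (n - m) ≤ ∑ n ∈ S, (1 / 2 * f n ^ 2 + 1 / 2 * f (n - m) ^ 2) :=
    Finset.sum_le_sum fun n _ => by nlinarith [sq_nonneg (f n - f (n - m))]
  simp only [Finset.sum_add_distrib, ← Finset.mul_sum] at e3
  simp only [mul_comm (f _) (h _), mul_assoc, ← Finset.mul_sum]
  exact mul_le_mul_of_nonneg_left (by linarith) (h0 m)

end Young

lemma rpow_mul_exp_mul_sq {x : ℝ} (hx : 0 < x) (p ψ s v : ℝ) :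
    (x ^ p * (Real.exp (ψ * x ^ s) * v)) ^ 2 = x ^ (2 * p) * Real.exp (2 * ψ * x ^ s) * v ^ 2 := by
  rw [mul_pow, mul_pow, ← Real.rpow_natCast, ← Real.rpow_mul hx.le, ← Real.exp_nat_mul]
  push_cast; ring_nf

lemma sum_sq_eq_energy {S : Finset (Fin 3 → ℤ)} (hS : 0 ∉ S) (s p ψ : ℝ)
    (a : (Fin 3 → ℤ) → C3) :
    ∑ n ∈ S, (wnum n ^ p * (Real.exp (ψ * wnum n ^ s) * ‖a n‖)) ^ 2 = energy S s (2 * p) ψ a := by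
  refine Finset.sum_congr rfl fun n hn => ?_
  have hn0 : n ≠ 0 := fun h => hS (h ▸ hn)
  rw [rpow_mul_exp_mul_sq (wnum_pos hn0), gw]

section Trilinear

variable {S : Finset (Fin 3 → ℤ)} {a b d : (Fin 3 → ℤ) → C3} {s A ψ r : ℝ}

lemma abs_inner_interaction_le (n m : Fin 3 → ℤ) (u v w : C3) :
    |inner ℝ (interaction n m u v) w| ≤ 8 * (wnum n * wnum m * ‖u‖ * ‖v‖ * ‖w‖) := by
  have h1 := abs_real_inner_le_norm (interaction n m u v) w
  have h2 := mul_le_mul_of_nonneg_right (norm_interaction_le n m u v) (norm_nonneg w)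
  linarith

/-- The trilinear form of the energy estimate: by antisymmetry of the interaction only the
change of the weight under exchange of `n` and `m` remains. -/
lemma sum_gw_inner_quad_eq (hb : ∀ n ∉ S, b n = 0) (ha : ∀ n, a (-n) = conj3 (a n)) (p : ℝ) :
    ∑ n ∈ S, gw s p ψ n * inner ℝ (quad A s a b n) (b n) =
      1 / 2 * ∑ n ∈ S, ∑ m ∈ S,
        weightDiff p s (ψ - A) (wnum n) (wnum m) (wnum (n - m)) *
        Real.exp (ψ * (wnum n ^ s + wnum m ^ s + wnum (n - m) ^ s)) *
        inner ℝ (interaction n m (a (n - m)) (b m)) (b n) := by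
  set g : (Fin 3 → ℤ) → (Fin 3 → ℤ) → ℝ := fun n m =>
    wnum n ^ p * Real.exp ((ψ - A) * (wnum n ^ s - wnum (n - m) ^ s - wnum m ^ s)) *
      Real.exp (ψ * (wnum n ^ s + wnum m ^ s + wnum (n - m) ^ s)) with hg
  set τ : (Fin 3 → ℤ) → (Fin 3 → ℤ) → ℝ := fun n m =>
    inner ℝ (interaction n m (a (n - m)) (b m)) (b n) with hτ
  have e1 : ∑ n ∈ S, gw s p ψ n * inner ℝ (quad A s a b n) (b n) =
      ∑ n ∈ S, ∑ m ∈ S, g n m * τ n m := by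
    refine Finset.sum_congr rfl fun n _ => ?_
    rw [quad_eq_sum A s a hb, sum_inner, Finset.mul_sum]
    refine Finset.sum_congr rfl fun m _ => ?_
    rw [real_inner_smul_left, gw, hg, hτ]
    have : Real.exp (2 * ψ * wnum n ^ s) *
        Real.exp (A * (wnum (n - m) ^ s + wnum m ^ s - wnum n ^ s)) =
        Real.exp ((ψ - A) * (wnum n ^ s - wnum (n - m) ^ s - wnum m ^ s)) *
        Real.exp (ψ * (wnum n ^ s + wnum m ^ s + wnum (n - m) ^ s)) := by
      rw [← Real.exp_add, ← Real.exp_add]; ring_nf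
    linear_combination (wnum n ^ p * inner ℝ (interaction n m (a (n - m)) (b m)) (b n)) * this
  have hanti : ∀ n m, τ m n = -τ n m := by
    intro n m
    simp only [hτ]
    rw [inner_interaction_antisymm n m, ← ha, neg_sub, neg_neg]
  have e2 : ∑ n ∈ S, ∑ m ∈ S, g n m * τ n m = -∑ n ∈ S, ∑ m ∈ S, g m n * τ n m := by
    rw [Finset.sum_comm, ← Finset.sum_neg_distrib]
    refine Finset.sum_congr rfl fun n _ => ?_
    rw [← Finset.sum_neg_distrib]
    refine Finset.sum_congr rfl fun m _ => ?_
    rw [hanti n m, mul_neg]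
  have e3 : ∑ n ∈ S, ∑ m ∈ S,
        weightDiff p s (ψ - A) (wnum n) (wnum m) (wnum (n - m)) *
        Real.exp (ψ * (wnum n ^ s + wnum m ^ s + wnum (n - m) ^ s)) *
        inner ℝ (interaction n m (a (n - m)) (b m)) (b n) =
      ∑ n ∈ S, ∑ m ∈ S, g n m * τ n m - ∑ n ∈ S, ∑ m ∈ S, g m n * τ n m := by
    rw [← Finset.sum_sub_distrib]
    refine Finset.sum_congr rfl fun n _ => ?_
    rw [← Finset.sum_sub_distrib]
    refine Finset.sum_congr rfl fun m _ => ?_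
    simp only [hg, hτ, weightDiff, wnum_sub_comm m n]
    rw [add_comm (wnum m ^ s) (wnum n ^ s)]
    ring
  rw [e3, e1]
  linarith

lemma abs_sum_gw_inner_quad_le (hb : ∀ n ∉ S, b n = 0) (ha : ∀ n, a (-n) = conj3 (a n)) (p : ℝ) :
    |∑ n ∈ S, gw s p ψ n * inner ℝ (quad A s a b n) (b n)| ≤
      4 * ∑ n ∈ S, ∑ m ∈ S,
        wnum n * wnum m * |weightDiff p s (ψ - A) (wnum n) (wnum m) (wnum (n - m))| *
        ((Real.exp (ψ * wnum n ^ s) * ‖b n‖) * (Real.exp (ψ * wnum m ^ s) * ‖b m‖) *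
          (Real.exp (ψ * wnum (n - m) ^ s) * ‖a (n - m)‖)) := by
  rw [sum_gw_inner_quad_eq hb ha, abs_mul, abs_of_pos (by norm_num : (0 : ℝ) < 1 / 2)]
  have : (4 : ℝ) = 1 / 2 * 8 := by norm_num
  rw [this, mul_assoc]
  refine mul_le_mul_of_nonneg_left ?_ (by norm_num)
  rw [Finset.mul_sum]
  refine (Finset.abs_sum_le_sum_abs _ _).trans (Finset.sum_le_sum fun n _ => ?_)
  rw [Finset.mul_sum]
  refine (Finset.abs_sum_le_sum_abs _ _).trans (Finset.sum_le_sum fun m _ => ?_)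
  rw [abs_mul, abs_mul, abs_of_pos (Real.exp_pos _), mul_add, mul_add, Real.exp_add, Real.exp_add]
  refine (mul_le_mul_of_nonneg_left (abs_inner_interaction_le _ _ _ _ _) (by positivity)).trans
    (le_of_eq (by ring))

/-- The energy estimate: the trilinear form is controlled by a Wiener norm and the
dissipation. -/
lemma abs_sum_gw_inner_quad_self_le (hS : 0 ∉ S) (hr : 1 ≤ 2 * r) (hs : 0 < s) (hs1 : s ≤ 1)
    (hA : A ≤ ψ) (haS : ∀ n ∉ S, a n = 0) (ha : ∀ n, a (-n) = conj3 (a n)) :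
    |∑ n ∈ S, gw s (2 * r) ψ n * inner ℝ (quad A s a a n) (a n)| ≤
      12 * ((2 + 2 * r) * 2 ^ (r + (s - 1) / 2)) *
        (wiener S s (1 - s) ψ a * energy S s (2 * r + s + 1) ψ a) := by
  refine (abs_sum_gw_inner_quad_le haS ha _).trans ?_
  set C := (2 + 2 * r) * 2 ^ (r + (s - 1) / 2) with hC
  have hC0 : 0 ≤ C := by
    have : 0 ≤ 2 + 2 * r := by linarith
    positivity
  set ρ := r + (s + 1) / 2 with hρ
  set X : (Fin 3 → ℤ) → ℝ := fun n => Real.exp (ψ * wnum n ^ s) * ‖a n‖ with hX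
  have hX0 : ∀ n, 0 ≤ X n := fun n => by positivity
  have hXS : ∀ n ∉ S, X n = 0 := fun n hn => by simp [hX, haS n hn]
  set f : (Fin 3 → ℤ) → ℝ := fun n => wnum n ^ ρ * X n with hf
  set h : (Fin 3 → ℤ) → ℝ := fun n => wnum n ^ (1 - s) * X n with hh
  have hh0 : ∀ n, 0 ≤ h n := fun n => by
    have := wnum_nonneg n
    have := hX0 n
    positivity
  have hfS : ∀ n ∉ S, f n = 0 := fun n hn => by simp [hf, hXS n hn]
  have hhS : ∀ n ∉ S, h n = 0 := fun n hn => by simp [hh, hXS n hn]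
  have hpt : ∀ n ∈ S, ∀ m ∈ S,
      wnum n * wnum m * |weightDiff (2 * r) s (ψ - A) (wnum n) (wnum m) (wnum (n - m))| *
        (X n * X m * X (n - m)) ≤
      C * (f n * f m * h (n - m) + f n * h m * f (n - m) + h n * f m * f (n - m)) := by
    intro n hn m hm
    have hn0 : n ≠ 0 := fun h => hS (h ▸ hn)
    have hm0 : m ≠ 0 := fun h => hS (h ▸ hm)
    rcases eq_or_ne (n - m) 0 with h0 | h0
    · have : X (n - m) = 0 := hXS _ (h0 ▸ hS)
      simp [hf, hh, this]
    have key := mul_abs_weightDiff_le (x := wnum n) (y := wnum m) (z := wnum (n - m)) hr hs hs1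
      (sub_nonneg.2 hA) (wnum_pos hn0) (wnum_pos hm0) (wnum_pos h0) (wnum_le_add n m)
      (by rw [wnum_sub_comm]; exact wnum_le_add m n)
    refine (mul_le_mul_of_nonneg_right key (by have := hX0 n; have := hX0 m
                                               have := hX0 (n - m); positivity)).trans (le_of_eq ?_)
    simp only [hf, hh]; ring
  have h2ρ : 2 * ρ = 2 * r + s + 1 := by rw [hρ]; ring
  have hE : ∑ n ∈ S, f n ^ 2 = energy S s (2 * r + s + 1) ψ a := by
    rw [← h2ρ, ← sum_sq_eq_energy hS]
  have hW : ∑ n ∈ S, h n = wiener S s (1 - s) ψ a := rfl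
  have hsum := Finset.sum_le_sum fun n hn => Finset.sum_le_sum fun m hm => hpt n hn m hm
  simp only [← Finset.mul_sum, Finset.sum_add_distrib] at hsum
  have t1 := sum_sum_mul_le_low_sub (f := f) hh0 hhS
  have t2 := sum_sum_mul_le_low_snd hh0 hfS
  have t3 := sum_sum_mul_le_low_fst hh0 hfS
  rw [hE, hW] at t1 t2 t3
  have t4 := mul_le_mul_of_nonneg_left (add_le_add (add_le_add t1 t2) t3) hC0
  linarith

/-- The corresponding estimate of order zero, for the part of the difference of two solutions
that contains two derivatives of the difference `d`. -/
lemma abs_sum_gw_zero_inner_quad_le (hS : 0 ∉ S) (hs : 0 < s) (hs1 : s ≤ 1)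
    (hA : A ≤ ψ) (haS : ∀ n ∉ S, a n = 0) (ha : ∀ n, a (-n) = conj3 (a n))
    (hd : ∀ n ∉ S, d n = 0) :
    |∑ n ∈ S, gw s 0 ψ n * inner ℝ (quad A s a d n) (d n)| ≤
      8 * (wiener S s (1 - s) ψ a * energy S s (s + 1) ψ d) := by
  refine (abs_sum_gw_inner_quad_le hd ha _).trans ?_
  set X : (Fin 3 → ℤ) → ℝ := fun n => Real.exp (ψ * wnum n ^ s) * ‖a n‖ with hX
  set Z : (Fin 3 → ℤ) → ℝ := fun n => Real.exp (ψ * wnum n ^ s) * ‖d n‖ with hZ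
  have hX0 : ∀ n, 0 ≤ X n := fun n => by positivity
  have hZ0 : ∀ n, 0 ≤ Z n := fun n => by positivity
  have hXS : ∀ n ∉ S, X n = 0 := fun n hn => by simp [hX, haS n hn]
  set f : (Fin 3 → ℤ) → ℝ := fun n => wnum n ^ ((s + 1) / 2) * Z n with hf
  set h : (Fin 3 → ℤ) → ℝ := fun n => wnum n ^ (1 - s) * X n with hh
  have hh0 : ∀ n, 0 ≤ h n := fun n => by
    have := wnum_nonneg n
    have := hX0 n
    positivity
  have hhS : ∀ n ∉ S, h n = 0 := fun n hn => by simp [hh, hXS n hn]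
  have hpt : ∀ n ∈ S, ∀ m ∈ S,
      wnum n * wnum m * |weightDiff 0 s (ψ - A) (wnum n) (wnum m) (wnum (n - m))| *
        (Z n * Z m * X (n - m)) ≤ 2 * (f n * f m * h (n - m)) := by
    intro n hn m hm
    have hn0 : n ≠ 0 := fun h => hS (h ▸ hn)
    have hm0 : m ≠ 0 := fun h => hS (h ▸ hm)
    rcases eq_or_ne (n - m) 0 with h0 | h0
    · have : X (n - m) = 0 := hXS _ (h0 ▸ hS)
      simp [hh, this]
    have key := mul_abs_weightDiff_zero_le (x := wnum n) (y := wnum m) (z := wnum (n - m)) hs hs1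
      (sub_nonneg.2 hA) (wnum_pos hn0) (wnum_pos hm0) (wnum_pos h0) (wnum_le_add n m)
      (by rw [wnum_sub_comm]; exact wnum_le_add m n)
    refine (mul_le_mul_of_nonneg_right key (by have := hZ0 n; have := hZ0 m
                                               have := hX0 (n - m); positivity)).trans (le_of_eq ?_)
    simp only [hf, hh]; ring
  have hE : ∑ n ∈ S, f n ^ 2 = energy S s (s + 1) ψ d := by
    have := sum_sq_eq_energy hS s ((s + 1) / 2) ψ d
    rwa [mul_div_cancel₀ (s + 1) (two_ne_zero' ℝ)] at this
  have hW : ∑ n ∈ S, h n = wiener S s (1 - s) ψ a := rfl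
  have hsum := Finset.sum_le_sum fun n hn => Finset.sum_le_sum fun m hm => hpt n hn m hm
  simp only [← Finset.mul_sum] at hsum
  have t1 := sum_sum_mul_le_low_sub (f := f) hh0 hhS
  rw [hE, hW] at t1
  linarith

/-- The part of the difference of two solutions that contains one derivative of the difference
`d`: no cancellation is needed. -/
lemma abs_sum_gw_zero_inner_quad_le' (hS : 0 ∉ S) (hs : 0 < s) (hs1 : s ≤ 1)
    (hA : A ≤ ψ) (hb : ∀ n ∉ S, b n = 0) (hd : ∀ n ∉ S, d n = 0) :
    |∑ n ∈ S, gw s 0 ψ n * inner ℝ (quad A s d b n) (d n)| ≤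
      16 * (wiener S s (3 / 2) ψ b * energy S s 1 ψ d) := by
  set X : (Fin 3 → ℤ) → ℝ := fun n => Real.exp (ψ * wnum n ^ s) * ‖b n‖ with hX
  set Z : (Fin 3 → ℤ) → ℝ := fun n => Real.exp (ψ * wnum n ^ s) * ‖d n‖ with hZ
  have hX0 : ∀ n, 0 ≤ X n := fun n => by positivity
  have hZ0 : ∀ n, 0 ≤ Z n := fun n => by positivity
  have hZS : ∀ n ∉ S, Z n = 0 := fun n hn => by simp [hZ, hd n hn]
  set f : (Fin 3 → ℤ) → ℝ := fun n => wnum n ^ ((1 : ℝ) / 2) * Z n with hf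
  set h : (Fin 3 → ℤ) → ℝ := fun n => wnum n ^ ((3 : ℝ) / 2) * X n with hh
  have hh0 : ∀ n, 0 ≤ h n := fun n => by
    have := wnum_nonneg n
    have := hX0 n
    positivity
  have hfS : ∀ n ∉ S, f n = 0 := fun n hn => by simp [hf, hZS n hn]
  have hpt : ∀ n ∈ S, ∀ m ∈ S,
      |gw s 0 ψ n * (Real.exp (A * (wnum (n - m) ^ s + wnum m ^ s - wnum n ^ s)) *
        inner ℝ (interaction n m (d (n - m)) (b m)) (d n))| ≤
      16 * (f n * h m * f (n - m)) := by
    intro n hn m hm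
    have hn0 : n ≠ 0 := fun h => hS (h ▸ hn)
    have hm0 : m ≠ 0 := fun h => hS (h ▸ hm)
    rcases eq_or_ne (n - m) 0 with h0 | h0
    · have : d (n - m) = 0 := hd _ (h0 ▸ hS)
      have h2 : f (n - m) = 0 := hfS _ (h0 ▸ hS)
      simp [this, h2, interaction_zero_left]
    have x1 := one_le_wnum hn0
    have y1 := one_le_wnum hm0
    have z1 := one_le_wnum h0
    have htri := wnum_le_add n m
    set x := wnum n
    set y := wnum m
    set z := wnum (n - m)
    have hx : 0 < x := by linarith
    have hy : 0 < y := by linarith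
    have hz : 0 < z := by linarith
    have hexp : Real.exp (2 * ψ * x ^ s) * Real.exp (A * (z ^ s + y ^ s - x ^ s)) ≤
        Real.exp (ψ * x ^ s) * Real.exp (ψ * y ^ s) * Real.exp (ψ * z ^ s) := by
      rw [← Real.exp_add, ← Real.exp_add, ← Real.exp_add]
      apply Real.exp_le_exp.2
      have hsub : x ^ s ≤ y ^ s + z ^ s :=
        (Real.rpow_le_rpow hx.le htri hs.le).trans (Real.rpow_add_le_add_rpow hy.le hz.le hs.le hs1)
      nlinarith [mul_nonneg (sub_nonneg.2 hA) (sub_nonneg.2 hsub)]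
    have hxy : x * y ≤ 2 * (x ^ ((1 : ℝ) / 2) * y ^ ((3 : ℝ) / 2) * z ^ ((1 : ℝ) / 2)) := by
      have h1 : x ≤ 4 * (y * z) := by nlinarith
      have h2 : x ^ ((1 : ℝ) / 2) ≤ 2 * (y ^ ((1 : ℝ) / 2) * z ^ ((1 : ℝ) / 2)) := by
        rw [← Real.mul_rpow hy.le hz.le, ← Real.sqrt_eq_rpow, ← Real.sqrt_eq_rpow]
        calc √x ≤ √(4 * (y * z)) := Real.sqrt_le_sqrt h1
          _ = 2 * √(y * z) := by
            rw [Real.sqrt_mul (by norm_num), show (4 : ℝ) = 2 ^ 2 by norm_num,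
              Real.sqrt_sq (by norm_num)]
      have h3 : x = x ^ ((1 : ℝ) / 2) * x ^ ((1 : ℝ) / 2) := by
        rw [← Real.rpow_add hx]; norm_num
      have h4 : y ^ ((3 : ℝ) / 2) = y ^ ((1 : ℝ) / 2) * y := by
        rw [← Real.rpow_add_one hy.ne']; norm_num
      calc x * y = x ^ ((1 : ℝ) / 2) * x ^ ((1 : ℝ) / 2) * y := by rw [← h3]
        _ ≤ x ^ ((1 : ℝ) / 2) * (2 * (y ^ ((1 : ℝ) / 2) * z ^ ((1 : ℝ) / 2))) * y := by gcongr
        _ = _ := by rw [h4]; ring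
    have hgw : gw s 0 ψ n = Real.exp (2 * ψ * x ^ s) := by rw [gw, Real.rpow_zero, one_mul]
    rw [abs_mul, abs_mul, hgw, abs_of_pos (Real.exp_pos _), abs_of_pos (Real.exp_pos _)]
    calc Real.exp (2 * ψ * x ^ s) * (Real.exp (A * (z ^ s + y ^ s - x ^ s)) *
          |inner ℝ (interaction n m (d (n - m)) (b m)) (d n)|)
        ≤ Real.exp (2 * ψ * x ^ s) * (Real.exp (A * (z ^ s + y ^ s - x ^ s)) *
          (8 * (x * y * ‖d (n - m)‖ * ‖b m‖ * ‖d n‖))) := by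
          gcongr; exact abs_inner_interaction_le _ _ _ _ _
      _ = (Real.exp (2 * ψ * x ^ s) * Real.exp (A * (z ^ s + y ^ s - x ^ s))) *
          (8 * ((x * y) * ‖d (n - m)‖ * ‖b m‖ * ‖d n‖)) := by ring
      _ ≤ (Real.exp (ψ * x ^ s) * Real.exp (ψ * y ^ s) * Real.exp (ψ * z ^ s)) *
          (8 * ((2 * (x ^ ((1 : ℝ) / 2) * y ^ ((3 : ℝ) / 2) * z ^ ((1 : ℝ) / 2))) *
            ‖d (n - m)‖ * ‖b m‖ * ‖d n‖)) := by gcongr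
      _ = _ := by simp only [hf, hh, hX, hZ, x, y, z]; ring
  have hE : ∑ n ∈ S, f n ^ 2 = energy S s 1 ψ d := by
    have := sum_sq_eq_energy hS s (1 / 2) ψ d
    rw [mul_one_div, div_self two_ne_zero] at this
    exact this
  have hW : ∑ n ∈ S, h n = wiener S s (3 / 2) ψ b := rfl
  have t1 := sum_sum_mul_le_low_snd hh0 hfS
  rw [hE, hW] at t1
  calc |∑ n ∈ S, gw s 0 ψ n * inner ℝ (quad A s d b n) (d n)|
      = |∑ n ∈ S, ∑ m ∈ S, gw s 0 ψ n *
          (Real.exp (A * (wnum (n - m) ^ s + wnum m ^ s - wnum n ^ s)) *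
          inner ℝ (interaction n m (d (n - m)) (b m)) (d n))| := by
        congr 1
        refine Finset.sum_congr rfl fun n _ => ?_
        rw [quad_eq_sum A s d hb, sum_inner, Finset.mul_sum]
        refine Finset.sum_congr rfl fun m _ => ?_
        rw [real_inner_smul_left]
    _ ≤ ∑ n ∈ S, ∑ m ∈ S, 16 * (f n * h m * f (n - m)) :=
        (Finset.abs_sum_le_sum_abs _ _).trans (Finset.sum_le_sum fun n hn =>
          (Finset.abs_sum_le_sum_abs _ _).trans (Finset.sum_le_sum fun m hm => hpt n hn m hm))
    _ = 16 * ∑ n ∈ S, ∑ m ∈ S, f n * h m * f (n - m) := by simp only [← Finset.mul_sum]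
    _ ≤ _ := by linarith

end Trilinear

/-! ### Summability over the lattice and bounds for the nonlinearity on all modes -/

lemma summable_wnum_rpow {p : ℝ} (hp : p < -3) : Summable fun n : Fin 3 → ℤ => wnum n ^ p := by
  set b : Module.Basis (Fin 3) ℝ (EuclideanSpace ℝ (Fin 3)) :=
    (EuclideanSpace.basisFun (Fin 3) ℝ).toBasis with hb
  set L := Submodule.span ℤ (Set.range b) with hL
  set bZ : Module.Basis (Fin 3) ℤ L := b.restrictScalars ℤ
  have hrank : Module.finrank ℤ L = 3 := by
    rw [Module.finrank_eq_card_basis bZ, Fintype.card_fin]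
  have h := ZLattice.summable_norm_rpow L p (by rw [hrank]; exact_mod_cast hp)
  have h2 := (bZ.equivFun.symm.toEquiv.summable_iff (f := fun z : L => ‖z‖ ^ p)).2 h
  have h3 := h2.mul_left ((2 * Real.pi) ^ p)
  refine h3.congr fun n => ?_
  rw [wnum_eq, Real.mul_rpow (by positivity) (norm_nonneg _)]
  have : ((bZ.equivFun.symm n : L) : EuclideanSpace ℝ (Fin 3)) = WithLp.toLp 2 fun i => (n i : ℝ) := by
    rw [Module.Basis.equivFun_symm_apply]
    ext i
    have hbZ : ∀ x, ((bZ x : L) : EuclideanSpace ℝ (Fin 3)) = b x :=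
      Module.Basis.restrictScalars_apply ℤ b
    simp [hbZ, hb, Pi.single_apply]
  rw [← this]; rfl

/-- Exponential decay beats every power. -/
lemma exists_rpow_mul_exp_le {s δ : ℝ} (hs : 0 < s) (hδ : 0 < δ) (p q : ℝ) :
    ∃ C, 0 < C ∧ ∀ x : ℝ, 1 ≤ x → x ^ p * Real.exp (-(δ * x ^ s)) ≤ C * x ^ q := by
  obtain ⟨k, hk⟩ := exists_nat_ge ((p - q) / s)
  refine ⟨k.factorial / δ ^ k, by positivity, fun x hx => ?_⟩
  have hx0 : 0 < x := by linarith
  have h1 := Real.pow_div_factorial_le_exp (δ * x ^ s) (by positivity) k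
  have h2 : x ^ (p - q) ≤ (x ^ s) ^ k := by
    rw [← Real.rpow_natCast, ← Real.rpow_mul hx0.le]
    apply Real.rpow_le_rpow_of_exponent_le hx
    rw [div_le_iff₀ hs] at hk; linarith
  rw [Real.exp_neg, ← div_eq_mul_inv, div_le_iff₀ (Real.exp_pos _)]
  rw [mul_pow, div_le_iff₀ (by positivity)] at h1
  have h3 : x ^ p = x ^ (p - q) * x ^ q := by rw [← Real.rpow_add hx0]; ring_nf
  rw [h3]
  have h4 : x ^ (p - q) ≤ Real.exp (δ * x ^ s) * k.factorial / δ ^ k := by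
    rw [le_div_iff₀ (by positivity)]
    nlinarith [mul_le_mul_of_nonneg_right h2 (by positivity : 0 ≤ δ ^ k)]
  calc x ^ (p - q) * x ^ q ≤ (Real.exp (δ * x ^ s) * k.factorial / δ ^ k) * x ^ q := by gcongr
    _ = _ := by ring

lemma summable_wnum_rpow_mul_exp {s δ : ℝ} (hs : 0 < s) (hδ : 0 < δ) (p : ℝ) :
    Summable fun n : Fin 3 → ℤ => wnum n ^ p * Real.exp (-(δ * wnum n ^ s)) := by
  obtain ⟨C, hC, h⟩ := exists_rpow_mul_exp_le hs hδ p (-4)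
  have h1 := (summable_wnum_rpow (p := -4) (by norm_num)).mul_left C
  refine Summable.of_norm_bounded_eventually h1 ?_
  rw [Filter.eventually_cofinite]
  refine (Set.finite_singleton (0 : Fin 3 → ℤ)).subset fun n hn => ?_
  by_contra h0
  refine hn ?_
  rw [Real.norm_of_nonneg (by have := wnum_nonneg n; positivity)]
  exact h _ (one_le_wnum h0)

lemma wiener_le_sqrt_mul_sqrt {S : Finset (Fin 3 → ℤ)} (hS : 0 ∉ S) (s p r ψ δ : ℝ)
    (a : (Fin 3 → ℤ) → C3) :
    wiener S s p ψ a ≤ √(∑ n ∈ S, wnum n ^ (2 * (p - r)) * Real.exp (-(2 * δ * wnum n ^ s))) *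
      √(energy S s (2 * r) (ψ + δ) a) := by
  have h := Real.sum_mul_le_sqrt_mul_sqrt S
    (fun n => wnum n ^ (p - r) * Real.exp (-(δ * wnum n ^ s)))
    (fun n => wnum n ^ r * (Real.exp ((ψ + δ) * wnum n ^ s) * ‖a n‖))
  rw [sum_sq_eq_energy hS] at h
  refine le_trans (le_of_eq ?_) (h.trans (le_of_eq ?_))
  · refine Finset.sum_congr rfl fun n hn => ?_
    have hn0 : n ≠ 0 := fun h => hS (h ▸ hn)
    have e1 : wnum n ^ p = wnum n ^ (p - r) * wnum n ^ r := by
      rw [← Real.rpow_add (wnum_pos hn0), sub_add_cancel]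
    have e2 : Real.exp (ψ * wnum n ^ s) =
        Real.exp (-(δ * wnum n ^ s)) * Real.exp ((ψ + δ) * wnum n ^ s) := by
      rw [← Real.exp_add]; ring_nf
    rw [e1, e2]; ring
  · congr 2
    refine Finset.sum_congr rfl fun n hn => ?_
    have hn0 : n ≠ 0 := fun h => hS (h ▸ hn)
    rw [mul_pow, ← Real.rpow_natCast, ← Real.rpow_mul (wnum_pos hn0).le, ← Real.exp_nat_mul]
    push_cast; ring_nf

/-- The embedding `Ḣ^r ⊂ Λ^{s-1} A`, `A` the Wiener algebra, which holds because
`r + s > 5/2`. -/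
lemma exists_wiener_le {s r : ℝ} (h : 5 / 2 < r + s) :
    ∃ C, 0 < C ∧ ∀ (S : Finset (Fin 3 → ℤ)) (ψ : ℝ) (a : (Fin 3 → ℤ) → C3), 0 ∉ S →
      wiener S s (1 - s) ψ a ≤ C * √(energy S s (2 * r) ψ a) := by
  have hsum := summable_wnum_rpow (p := 2 * (1 - s - r)) (by linarith)
  have h0 : ∀ n : Fin 3 → ℤ, 0 ≤ wnum n ^ (2 * (1 - s - r)) := fun n => by
    have := wnum_nonneg n
    positivity
  refine ⟨√(∑' n : Fin 3 → ℤ, wnum n ^ (2 * (1 - s - r)) + 1), Real.sqrt_pos.2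
    (add_pos_of_nonneg_of_pos (tsum_nonneg h0) one_pos), fun S ψ a hS => ?_⟩
  have := wiener_le_sqrt_mul_sqrt hS s (1 - s) r ψ 0 a
  simp only [mul_zero, zero_mul, neg_zero, Real.exp_zero, mul_one, add_zero] at this
  refine this.trans ?_
  gcongr
  have := hsum.sum_le_tsum S fun n _ => h0 n
  linarith

/-- Analyticity: a positive amount `δ` of extra Gevrey radius controls every Wiener norm. -/
lemma exists_wiener_le_of_pos {s δ : ℝ} (hs : 0 < s) (hδ : 0 < δ) (r p : ℝ) :
    ∃ C, 0 < C ∧ ∀ (S : Finset (Fin 3 → ℤ)) (ψ : ℝ) (a : (Fin 3 → ℤ) → C3), 0 ∉ S →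
      wiener S s p ψ a ≤ C * √(energy S s (2 * r) (ψ + δ) a) := by
  have hsum := summable_wnum_rpow_mul_exp hs (by positivity : 0 < 2 * δ) (2 * (p - r))
  have h0 : ∀ n : Fin 3 → ℤ, 0 ≤ wnum n ^ (2 * (p - r)) * Real.exp (-(2 * δ * wnum n ^ s)) :=
    fun n => by
      have := wnum_nonneg n
      positivity
  refine ⟨√(∑' n : Fin 3 → ℤ, wnum n ^ (2 * (p - r)) * Real.exp (-(2 * δ * wnum n ^ s)) + 1),
    Real.sqrt_pos.2 (add_pos_of_nonneg_of_pos (tsum_nonneg h0) one_pos), fun S ψ a hS => ?_⟩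
  refine (wiener_le_sqrt_mul_sqrt hS s p r ψ δ a).trans ?_
  gcongr
  have := hsum.sum_le_tsum S fun n _ => h0 n
  linarith

/-- The coefficient family `a` has mean zero and Gevrey norm at most `R`. -/
def GevBound (s p ψ R : ℝ) (a : (Fin 3 → ℤ) → C3) : Prop :=
  a 0 = 0 ∧ ∀ S : Finset (Fin 3 → ℤ), energy S s p ψ a ≤ R ^ 2

lemma gw_mono {s p q ψ ψ' : ℝ} (hpq : p ≤ q) (hψ : ψ ≤ ψ') {n : Fin 3 → ℤ} (hn : n ≠ 0) :
    gw s p ψ n ≤ gw s q ψ' n := by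
  have h1 := one_le_wnum hn
  have h0 := wnum_nonneg n
  unfold gw
  gcongr

lemma energy_mono {S : Finset (Fin 3 → ℤ)} {s p q ψ ψ' : ℝ} (hpq : p ≤ q) (hψ : ψ ≤ ψ')
    {a : (Fin 3 → ℤ) → C3} (ha : a 0 = 0) : energy S s p ψ a ≤ energy S s q ψ' a := by
  refine Finset.sum_le_sum fun n _ => ?_
  rcases eq_or_ne n 0 with rfl | hn
  · simp [ha]
  · exact mul_le_mul_of_nonneg_right (gw_mono hpq hψ hn) (sq_nonneg _)

lemma GevBound.mono {s p q ψ ψ' R : ℝ} {a : (Fin 3 → ℤ) → C3} (h : GevBound s q ψ' R a)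
    (hpq : p ≤ q) (hψ : ψ ≤ ψ') : GevBound s p ψ R a :=
  ⟨h.1, fun S => (energy_mono hpq hψ h.1).trans (h.2 S)⟩

lemma GevBound.norm_le {s p ψ R : ℝ} {a : (Fin 3 → ℤ) → C3} (h : GevBound s p ψ R a) (hp : 0 ≤ p)
    (hR : 0 ≤ R) (n : Fin 3 → ℤ) : ‖a n‖ ≤ R * Real.exp (-(ψ * wnum n ^ s)) := by
  have h1 := (h.mono hp le_rfl).2 {n}
  rw [energy, Finset.sum_singleton, gw, Real.rpow_zero, one_mul] at h1
  have h2 : (Real.exp (ψ * wnum n ^ s) * ‖a n‖) ^ 2 ≤ R ^ 2 := by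
    rw [mul_pow, ← Real.exp_nat_mul]
    push_cast
    rwa [← mul_assoc]
  have h3 := le_of_sq_le_sq h2 hR
  rw [Real.exp_neg, ← div_eq_mul_inv, le_div_iff₀ (Real.exp_pos _)]
  linarith

section Quad

variable {s A ψ δ R R' : ℝ} {a b : (Fin 3 → ℤ) → C3}

lemma exp_mul_le_of_subadd (hs : 0 < s) (hs1 : s ≤ 1) (hA : A ≤ ψ) (n m : Fin 3 → ℤ) :
    Real.exp (A * (wnum (n - m) ^ s + wnum m ^ s - wnum n ^ s)) ≤
      Real.exp (-(ψ * wnum n ^ s)) * (Real.exp (ψ * wnum (n - m) ^ s) *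
        Real.exp (ψ * wnum m ^ s)) := by
  have hsub : wnum n ^ s ≤ wnum m ^ s + wnum (n - m) ^ s :=
    (Real.rpow_le_rpow (wnum_nonneg n) (wnum_le_add n m) hs.le).trans
      (Real.rpow_add_le_add_rpow (wnum_nonneg _) (wnum_nonneg _) hs.le hs1)
  rw [← Real.exp_add, ← Real.exp_add]
  apply Real.exp_le_exp.2
  nlinarith [mul_nonneg (sub_nonneg.2 hA) (sub_nonneg.2 hsub)]

lemma sum_norm_quad_term_le (hs : 0 < s) (hs1 : s ≤ 1) (hA : A ≤ ψ) (hR : 0 ≤ R) (hR' : 0 ≤ R')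
    (ha : GevBound s 2 ψ R a) (hb : GevBound s 2 ψ R' b) (n : Fin 3 → ℤ)
    (F : Finset (Fin 3 → ℤ)) :
    ∑ m ∈ F, ‖Real.exp (A * (wnum (n - m) ^ s + wnum m ^ s - wnum n ^ s)) •
      interaction n m (a (n - m)) (b m)‖ ≤
      8 * (R * R') * (wnum n * Real.exp (-(ψ * wnum n ^ s))) := by
  have hn := wnum_nonneg n
  set X : (Fin 3 → ℤ) → ℝ := fun m => Real.exp (ψ * wnum m ^ s) * ‖a m‖ with hX
  set Y : (Fin 3 → ℤ) → ℝ := fun m => wnum m ^ (1 : ℝ) * (Real.exp (ψ * wnum m ^ s) * ‖b m‖) with hY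
  have hpt : ∀ m ∈ F, ‖Real.exp (A * (wnum (n - m) ^ s + wnum m ^ s - wnum n ^ s)) •
      interaction n m (a (n - m)) (b m)‖ ≤
      8 * (wnum n * Real.exp (-(ψ * wnum n ^ s))) * (X (n - m) * Y m) := by
    intro m _
    have hm := wnum_nonneg m
    rw [norm_smul, Real.norm_of_nonneg (Real.exp_pos _).le]
    refine (mul_le_mul (exp_mul_le_of_subadd hs hs1 hA n m) (norm_interaction_le n m _ _)
      (norm_nonneg _) (by positivity)).trans (le_of_eq ?_)
    simp only [hX, hY, Real.rpow_one]; ring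
  refine (Finset.sum_le_sum hpt).trans ?_
  rw [← Finset.mul_sum]
  have hcs := Real.sum_mul_le_sqrt_mul_sqrt F (fun m => X (n - m)) Y
  have hYF : ∑ m ∈ F, Y m ^ 2 ≤ R' ^ 2 := by
    refine le_trans (le_of_eq ?_) (hb.2 F)
    refine Finset.sum_congr rfl fun m _ => ?_
    rcases eq_or_ne m 0 with rfl | hm0
    · simp [hY, hb.1]
    · simp only [hY]
      rw [rpow_mul_exp_mul_sq (wnum_pos hm0), mul_one, gw]
  have hXF : ∑ m ∈ F, X (n - m) ^ 2 ≤ R ^ 2 := by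
    have h1 := (ha.mono (p := 0) (by norm_num) le_rfl).2 (F.image fun m => n - m)
    rw [energy, Finset.sum_image fun x _ y _ h => sub_right_injective h] at h1
    refine le_trans (le_of_eq ?_) h1
    refine Finset.sum_congr rfl fun m _ => ?_
    simp only [hX, gw]
    rw [mul_pow, ← Real.exp_nat_mul, Real.rpow_zero, one_mul]
    push_cast; ring_nf
  have h1 : ∑ m ∈ F, X (n - m) * Y m ≤ R * R' := by
    exact hcs.trans (mul_le_mul (Real.sqrt_le_iff.2 ⟨hR, hXF⟩) (Real.sqrt_le_iff.2 ⟨hR', hYF⟩)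
      (Real.sqrt_nonneg _) hR)
  refine (mul_le_mul_of_nonneg_left h1 (by positivity)).trans (le_of_eq (by ring))

lemma summable_quad (hs : 0 < s) (hs1 : s ≤ 1) (hA : A ≤ ψ) (hR : 0 ≤ R) (hR' : 0 ≤ R')
    (ha : GevBound s 2 ψ R a) (hb : GevBound s 2 ψ R' b) (n : Fin 3 → ℤ) :
    Summable fun m => Real.exp (A * (wnum (n - m) ^ s + wnum m ^ s - wnum n ^ s)) •
      interaction n m (a (n - m)) (b m) :=
  Summable.of_norm (summable_of_sum_le (fun _ => norm_nonneg _)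
    (sum_norm_quad_term_le hs hs1 hA hR hR' ha hb n))

lemma norm_quad_le (hs : 0 < s) (hs1 : s ≤ 1) (hA : A ≤ ψ) (hR : 0 ≤ R) (hR' : 0 ≤ R')
    (ha : GevBound s 2 ψ R a) (hb : GevBound s 2 ψ R' b) (n : Fin 3 → ℤ) :
    ‖quad A s a b n‖ ≤ 8 * (R * R') * (wnum n * Real.exp (-(ψ * wnum n ^ s))) := by
  have h1 := summable_of_sum_le (fun _ => norm_nonneg _)
    (sum_norm_quad_term_le hs hs1 hA hR hR' ha hb n)
  exact (norm_tsum_le_tsum_norm h1).trans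
    (h1.tsum_le_of_sum_le (sum_norm_quad_term_le hs hs1 hA hR hR' ha hb n))

lemma continuous_cross {X : Type*} [TopologicalSpace X] {f g : X → C3} (hf : Continuous f)
    (hg : Continuous g) : Continuous fun x => cross (f x) (g x) := by
  have hf' : ∀ i, Continuous fun x => f x i := fun i => (PiLp.continuous_apply 2 _ i).comp hf
  have hg' : ∀ i, Continuous fun x => g x i := fun i => (PiLp.continuous_apply 2 _ i).comp hg
  refine (PiLp.continuous_toLp 2 _).comp (continuous_pi fun i => ?_)
  fin_cases i
  · exact ((hf' 1).mul (hg' 2)).sub ((hf' 2).mul (hg' 1))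
  · exact ((hf' 2).mul (hg' 0)).sub ((hf' 0).mul (hg' 2))
  · exact ((hf' 0).mul (hg' 1)).sub ((hf' 1).mul (hg' 0))

lemma continuous_interaction (n m : Fin 3 → ℤ) :
    Continuous fun q : C3 × C3 => interaction n m q.1 q.2 :=
  (continuous_cross continuous_const (continuous_cross
    (continuous_cross continuous_const continuous_snd) continuous_fst)).neg

lemma quad_term_bound {E p q t I x y U V R q' t' w : ℝ} (hp : 0 ≤ p)
    (hq : 0 ≤ q) (ht : 0 ≤ t) (hU : 0 ≤ U) (hV : 0 ≤ V) (hR : 0 ≤ R) (hx : 0 ≤ x) (hy : 0 ≤ y)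
    (hI : 0 ≤ I) (h1 : E ≤ p * (q * t)) (h2 : I ≤ 8 * (x * y * U * V)) (hU' : U ≤ R * q')
    (hV' : V ≤ R * t') (hp1 : p ≤ 1) (hq1 : q * q' ≤ 1) (htw : t * t' = w) :
    E * I ≤ 8 * R ^ 2 * x * (y * w) := by
  have a1 : q * U ≤ R := by nlinarith [mul_le_mul_of_nonneg_left hU' hq]
  have a2 : t * V ≤ R * w := by
    rw [← htw]; linarith [mul_le_mul_of_nonneg_left hV' ht]
  have a0 : 0 ≤ t * V := mul_nonneg ht hV
  have a3 : (q * U) * (t * V) ≤ R * (R * w) := mul_le_mul a1 a2 a0 hR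
  have a4 : p * ((q * U) * (t * V)) ≤ 1 * (R * (R * w)) :=
    mul_le_mul hp1 a3 (mul_nonneg (mul_nonneg hq hU) a0) zero_le_one
  calc E * I ≤ p * (q * t) * I := mul_le_mul_of_nonneg_right h1 hI
    _ ≤ p * (q * t) * (8 * (x * y * U * V)) := mul_le_mul_of_nonneg_left h2 (by positivity)
    _ = 8 * x * y * (p * ((q * U) * (t * V))) := by ring
    _ ≤ 8 * x * y * (1 * (R * (R * w))) := mul_le_mul_of_nonneg_left a4 (by positivity)
    _ = _ := by ring

/-- Continuity of the nonlinearity under convergence of all coefficients, given a uniform bound in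
a Gevrey class. -/
lemma tendsto_quad {ι : Type*} {l : Filter ι} {A ψ : ι → ℝ} {A₀ : ℝ}
    {a : ι → (Fin 3 → ℤ) → C3} {a₀ : (Fin 3 → ℤ) → C3} (hs : 0 < s) (hs1 : s ≤ 1) (hδ : 0 < δ)
    (hR : 0 ≤ R) (hψA : ∀ᶠ i in l, δ ≤ ψ i ∧ A i ≤ ψ i - δ ∧
      ∀ n, ‖a i n‖ ≤ R * Real.exp (-(ψ i * wnum n ^ s)))
    (hAl : Filter.Tendsto A l (𝓝 A₀)) (hal : ∀ n, Filter.Tendsto (fun i => a i n) l (𝓝 (a₀ n)))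
    (n : Fin 3 → ℤ) :
    Filter.Tendsto (fun i => quad (A i) s (a i) (a i) n) l (𝓝 (quad A₀ s a₀ a₀ n)) := by
  refine tendsto_tsum_of_dominated_convergence
    (bound := fun m => 8 * R ^ 2 * wnum n * (wnum m ^ (1 : ℝ) * Real.exp (-(δ * wnum m ^ s))))
    ((summable_wnum_rpow_mul_exp hs hδ 1).mul_left _) (fun m => ?_)
    (hψA.mono fun i ⟨hψ, hA, ha⟩ m => ?_)
  · have t1 : Filter.Tendsto (fun i => Real.exp (A i *
        (wnum (n - m) ^ s + wnum m ^ s - wnum n ^ s))) l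
        (𝓝 (Real.exp (A₀ * (wnum (n - m) ^ s + wnum m ^ s - wnum n ^ s)))) :=
      (hAl.mul_const (wnum (n - m) ^ s + wnum m ^ s - wnum n ^ s)).rexp
    have t3 : Filter.Tendsto (fun i => (a i (n - m), a i m)) l (𝓝 (a₀ (n - m), a₀ m)) :=
      (hal (n - m)).prodMk_nhds (hal m)
    have t2 := ((continuous_interaction n m).tendsto (a₀ (n - m), a₀ m)).comp t3
    exact t1.smul t2
  · have hm := wnum_nonneg m
    have hn := wnum_nonneg n
    rw [norm_smul, Real.norm_of_nonneg (Real.exp_pos _).le, Real.rpow_one]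
    have h1 := exp_mul_le_of_subadd hs hs1 hA n m
    have h2 := norm_interaction_le n m (a i (n - m)) (a i m)
    have e1 : Real.exp (-((ψ i - δ) * wnum n ^ s)) ≤ 1 := by
      apply Real.exp_le_one_iff.2
      have := mul_nonneg (sub_nonneg.2 hψ) (Real.rpow_nonneg hn s)
      linarith
    have e2 : Real.exp ((ψ i - δ) * wnum (n - m) ^ s) *
        Real.exp (-(ψ i * wnum (n - m) ^ s)) ≤ 1 := by
      rw [← Real.exp_add]
      apply Real.exp_le_one_iff.2
      have := mul_nonneg hδ.le (Real.rpow_nonneg (wnum_nonneg (n - m)) s)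
      linarith
    have e3 : Real.exp ((ψ i - δ) * wnum m ^ s) * Real.exp (-(ψ i * wnum m ^ s)) =
        Real.exp (-(δ * wnum m ^ s)) := by
      rw [← Real.exp_add]; ring_nf
    exact quad_term_bound (Real.exp_pos _).le (Real.exp_pos _).le (Real.exp_pos _).le
      (norm_nonneg _) (norm_nonneg _) hR hn hm (norm_nonneg _) h1 h2 (ha _) (ha _) e1 e2 e3

end Quad

/-! ### Global solutions of dissipative ordinary differential equations -/

section Retraction

variable {E : Type*} [NormedAddCommGroup E]

/-- The radial retraction of a normed space onto the closed ball of radius `R`. -/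
noncomputable def radialRetract [NormedSpace ℝ E] (R : ℝ) (x : E) : E := (R / max R ‖x‖) • x

lemma norm_radialRetract_le [NormedSpace ℝ E] {R : ℝ} (hR : 0 < R) (x : E) :
    ‖radialRetract R x‖ ≤ R := by
  have h : 0 < max R ‖x‖ := lt_max_of_lt_left hR
  rw [radialRetract, norm_smul, Real.norm_of_nonneg (by positivity), div_mul_eq_mul_div,
    div_le_iff₀ h]
  exact mul_le_mul_of_nonneg_left (le_max_right _ _) hR.le

lemma radialRetract_of_norm_le [NormedSpace ℝ E] {R : ℝ} (hR : 0 < R) {x : E} (hx : ‖x‖ ≤ R) :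
    radialRetract R x = x := by
  rw [radialRetract, max_eq_left hx, div_self hR.ne', one_smul]

lemma norm_radialRetract_sub_le [NormedSpace ℝ E] {R : ℝ} (hR : 0 < R) (x y : E) :
    ‖radialRetract R x - radialRetract R y‖ ≤ 2 * ‖x - y‖ := by
  unfold radialRetract
  set p := max R ‖x‖ with hp
  set q := max R ‖y‖ with hq
  have hp0 : 0 < p := lt_max_of_lt_left hR
  have hq0 : 0 < q := lt_max_of_lt_left hR
  have hpq : |q - p| ≤ ‖x - y‖ := by
    have h1 := abs_max_sub_max_le_max R ‖y‖ R ‖x‖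
    rw [sub_self, abs_zero, max_eq_right (abs_nonneg (‖y‖ - ‖x‖))] at h1
    refine h1.trans ?_
    rw [norm_sub_rev]
    exact abs_norm_sub_norm_le y x
  have e : (R / p) • x - (R / q) • y = (R / p) • (x - y) + (R / p * ((q - p) / q)) • y := by
    have : R / q = R / p - R / p * ((q - p) / q) := by field_simp; ring
    rw [this]; module
  have h1 : R / p ≤ 1 := (div_le_one hp0).2 (le_max_left _ _)
  have h0 : 0 ≤ R / p := by positivity
  rw [e]
  refine (norm_add_le _ _).trans ?_
  rw [norm_smul, norm_smul, norm_mul, Real.norm_of_nonneg h0, norm_div, Real.norm_eq_abs,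
    Real.norm_of_nonneg hq0.le]
  have h2 : |q - p| / q * ‖y‖ ≤ ‖x - y‖ := by
    rw [div_mul_eq_mul_div, div_le_iff₀ hq0]
    exact mul_le_mul hpq (le_max_right _ _) (norm_nonneg _) (norm_nonneg _)
  have h3 := mul_le_mul h1 h2 (by positivity) zero_le_one
  have h4 := mul_le_mul_of_nonneg_right h1 (norm_nonneg (x - y))
  nlinarith

end Retraction

/-- A vector field that is Lipschitz and dissipative on a ball has global solutions in that ball.
The field is frozen outside the ball by composition with the radial retraction, which keeps its
sign against the position vector. -/
theorem exists_solution_of_dissipative {E : Type*} [NormedAddCommGroup E] [InnerProductSpace ℝ E]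
    [CompleteSpace E] (F : ℝ → E → E) {T R K : ℝ} (hT : 0 ≤ T) (hR : 0 < R) (hK : 0 ≤ K)
    (hcont : ∀ x, Continuous fun t => F t x)
    (hlip : ∀ t ∈ Set.Icc 0 T, ∀ x y, ‖x‖ ≤ R → ‖y‖ ≤ R → ‖F t x - F t y‖ ≤ K * ‖x - y‖)
    (hF0 : ∀ t, F t 0 = 0)
    (hdiss : ∀ t ∈ Set.Icc 0 T, ∀ x, ‖x‖ ≤ R → inner ℝ (F t x) x ≤ 0) {x₀ : E} (hx₀ : ‖x₀‖ ≤ R) :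
    ∃ α : ℝ → E, α 0 = x₀ ∧ ∀ t ∈ Set.Icc 0 T, ‖α t‖ ≤ R ∧
      HasDerivWithinAt α (F t (α t)) (Set.Icc 0 T) t := by
  set f : ℝ → E → E := fun t x => F t (radialRetract R x) with hf
  have hPL : IsPicardLindelof f (tmin := 0) (tmax := T) ⟨0, le_rfl, hT⟩ x₀
      (K * R * T).toNNReal 0 (K * R).toNNReal (2 * K).toNNReal := by
    constructor
    · intro t ht
      refine (LipschitzWith.of_dist_le_mul fun x y => ?_).lipschitzOnWith
      rw [dist_eq_norm, dist_eq_norm, Real.coe_toNNReal _ (by positivity)]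
      refine (hlip t ht _ _ (norm_radialRetract_le hR x) (norm_radialRetract_le hR y)).trans ?_
      nlinarith [mul_le_mul_of_nonneg_left (norm_radialRetract_sub_le hR x y) hK]
    · intro x _
      exact (hcont _).continuousOn
    · intro t ht x _
      rw [Real.coe_toNNReal _ (by positivity)]
      have := hlip t ht _ 0 (norm_radialRetract_le hR x) (by simpa using hR.le)
      rw [hF0, sub_zero, sub_zero] at this
      exact this.trans (mul_le_mul_of_nonneg_left (norm_radialRetract_le hR x) hK)
    · rw [Real.coe_toNNReal _ (by positivity), Real.coe_toNNReal _ (by positivity)]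
      simp [hT]
  obtain ⟨α, hα0, hα⟩ := hPL.exists_eq_forall_mem_Icc_hasDerivWithinAt₀
  have hanti : AntitoneOn (fun t => ‖α t‖ ^ 2) (Set.Icc 0 T) := by
    refine antitoneOn_of_hasDerivWithinAt_nonpos (convex_Icc 0 T)
      (f' := fun t => 2 * inner ℝ (α t) (f t (α t)))
      (fun t ht => ((hα t ht).norm_sq).continuousWithinAt)
      (fun t ht => ((hα t (interior_subset ht)).norm_sq).mono interior_subset) ?_
    intro t ht
    have h1 := hdiss t (interior_subset ht) _ (norm_radialRetract_le hR (α t))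
    have h2 : 0 < R / max R ‖α t‖ := div_pos hR (lt_max_of_lt_left hR)
    have h3 : inner ℝ (f t (α t)) (radialRetract R (α t)) =
        R / max R ‖α t‖ * inner ℝ (f t (α t)) (α t) := by
      rw [radialRetract, real_inner_smul_right]
    have h4 : inner ℝ (f t (α t)) (α t) ≤ 0 := by
      by_contra hcon
      push Not at hcon
      have := mul_pos h2 hcon
      rw [← h3] at this
      exact absurd h1 (not_le.2 this)
    rw [real_inner_comm]
    linarith
  have hα0' : α 0 = x₀ := hα0
  refine ⟨α, hα0', fun t ht => ?_⟩
  have hle : ‖α t‖ ≤ R := by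
    have := hanti ⟨le_rfl, hT⟩ ht ht.1
    simp only [hα0'] at this
    exact (le_of_sq_le_sq this (norm_nonneg _)).trans hx₀
  refine ⟨hle, ?_⟩
  have := hα t ht
  simp only [hf, radialRetract_of_norm_le hR hle] at this
  exact this

/-! ### The energy balance on finitely many modes -/

/-- The real linear isomorphism underlying componentwise conjugation. -/
noncomputable def conj3L : C3 ≃L[ℝ] C3 :=
  ContinuousLinearEquiv.equivOfInverse
    ⟨{ toFun := conj3, map_add' := conj3_add, map_smul' := fun c u => conj3_smul c u },
      continuous_conj3⟩
    ⟨{ toFun := conj3, map_add' := conj3_add, map_smul' := fun c u => conj3_smul c u },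
      continuous_conj3⟩ conj3_conj3 conj3_conj3

lemma quad_neg {a b : (Fin 3 → ℤ) → C3} (ha : ∀ n, a (-n) = conj3 (a n))
    (hb : ∀ n, b (-n) = conj3 (b n)) (A s : ℝ) (n : Fin 3 → ℤ) :
    quad A s a b (-n) = conj3 (quad A s a b n) := by
  have h : conj3 (quad A s a b n) = conj3L (quad A s a b n) := rfl
  rw [h, quad, quad, conj3L.map_tsum, ← (Equiv.neg (Fin 3 → ℤ)).tsum_eq]
  refine tsum_congr fun m => ?_
  have e : -n - -m = -(n - m) := by abel
  change _ = conj3 _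
  rw [Equiv.neg_apply, conj3_smul, e, ha, hb, interaction_neg_conj3, wnum_neg, wnum_neg, wnum_neg]

lemma sum_wave_mul_quad {S : Finset (Fin 3 → ℤ)} {a b : (Fin 3 → ℤ) → C3}
    (hb : ∀ n ∉ S, b n = 0) (A s : ℝ) (n : Fin 3 → ℤ) :
    ∑ i, (wave n i : ℂ) * quad A s a b n i = 0 := by
  rw [quad_eq_sum A s a hb]
  have : ∀ i, (wave n i : ℂ) * (∑ m ∈ S,
      Real.exp (A * (wnum (n - m) ^ s + wnum m ^ s - wnum n ^ s)) •
        interaction n m (a (n - m)) (b m)).ofLp i =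
      ∑ m ∈ S, (Real.exp (A * (wnum (n - m) ^ s + wnum m ^ s - wnum n ^ s)) : ℂ) *
        ((wave n i : ℂ) * interaction n m (a (n - m)) (b m) i) := by
    intro i
    rw [WithLp.ofLp_sum, Finset.sum_apply, Finset.mul_sum]
    refine Finset.sum_congr rfl fun m _ => ?_
    rw [PiLp.smul_apply, Complex.real_smul]; ring
  simp only [this]
  rw [Finset.sum_comm]
  refine Finset.sum_eq_zero fun m _ => ?_
  rw [← Finset.mul_sum, sum_wave_mul_interaction, mul_zero]

lemma quad_sub_quad {s A ψ R : ℝ} {a b : (Fin 3 → ℤ) → C3} (hs : 0 < s) (hs1 : s ≤ 1) (hA : A ≤ ψ)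
    (hR : 0 ≤ R) (ha : GevBound s 2 ψ R a) (hb : GevBound s 2 ψ R b)
    (hab : GevBound s 2 ψ R (a - b)) (n : Fin 3 → ℤ) :
    quad A s a a n - quad A s b b n = quad A s (a - b) a n + quad A s b (a - b) n := by
  unfold quad
  rw [← (summable_quad hs hs1 hA hR hR ha ha n).tsum_sub (summable_quad hs hs1 hA hR hR hb hb n),
    ← (summable_quad hs hs1 hA hR hR hab ha n).tsum_add (summable_quad hs hs1 hA hR hR hb hab n)]
  refine tsum_congr fun m => ?_
  rw [← smul_sub, ← smul_add]
  congr 1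
  have e1 : a (n - m) = (a - b) (n - m) + b (n - m) := by simp
  have e2 : interaction n m (a (n - m)) (a m) =
      interaction n m ((a - b) (n - m)) (a m) + interaction n m (b (n - m)) (a m) := by
    rw [← interaction_add_left, ← e1]
  have e3 : interaction n m (b (n - m)) (a m) =
      interaction n m (b (n - m)) ((a - b) m) + interaction n m (b (n - m)) (b m) := by
    rw [← interaction_add_right]; simp
  rw [e2, e3]; abel

/-- The rate of change of `energy S s p ψ a` when `ψ` grows at the rate `β` and `a` at the
rate `v`. -/
noncomputable def energyRate (S : Finset (Fin 3 → ℤ)) (s p ψ β : ℝ) (a v : (Fin 3 → ℤ) → C3) : ℝ :=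
  ∑ n ∈ S, gw s p ψ n * (2 * β * wnum n ^ s * ‖a n‖ ^ 2 + 2 * inner ℝ (v n) (a n))

lemma hasDerivWithinAt_energy {S : Finset (Fin 3 → ℤ)} {s p β c : ℝ} {a : ℝ → (Fin 3 → ℤ) → C3}
    {v : (Fin 3 → ℤ) → C3} {I : Set ℝ} {t : ℝ}
    (h : ∀ n ∈ S, HasDerivWithinAt (fun τ => a τ n) (v n) I t) :
    HasDerivWithinAt (fun τ => energy S s p (c + β * τ) (a τ))
      (energyRate S s p (c + β * t) β (a t) v) I t := by
  unfold energy energyRate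
  refine HasDerivWithinAt.fun_sum fun n hn => ?_
  have h1 : HasDerivWithinAt (fun τ => gw s p (c + β * τ) n)
      (wnum n ^ p * (Real.exp (2 * (c + β * t) * wnum n ^ s) * (2 * β * wnum n ^ s))) I t := by
    unfold gw
    refine (HasDerivAt.exp ?_).const_mul _ |>.hasDerivWithinAt
    have : HasDerivAt (fun τ : ℝ => 2 * (c + β * τ) * wnum n ^ s) (2 * (β * 1) * wnum n ^ s) t :=
      ((((hasDerivAt_id t).const_mul β).const_add c).const_mul 2).mul_const _
    simpa [mul_assoc] using this
  have h2 := (h n hn).norm_sq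
  refine (h1.mul h2).congr_deriv ?_
  rw [gw, real_inner_comm]; ring

section Rate

variable {S : Finset (Fin 3 → ℤ)} {a : (Fin 3 → ℤ) → C3} {s A ψ r μ β : ℝ}

/-- The right-hand side of the equation, on the Fourier side. -/
noncomputable def rhs (μ A s : ℝ) (a : (Fin 3 → ℤ) → C3) (n : Fin 3 → ℤ) : C3 :=
  -quad A s a a n - (1 / 2 * μ ^ 2 * wnum n ^ (s + 1)) • a n

lemma gw_mul_rpow {s p ψ : ℝ} (q : ℝ) {n : Fin 3 → ℤ} (hn : n ≠ 0) :
    gw s p ψ n * wnum n ^ q = gw s (p + q) ψ n := by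
  unfold gw
  rw [Real.rpow_add (wnum_pos hn)]; ring

/-- The energy inequalities: with small data the dissipation wins over the nonlinearity. -/
lemma exists_energyRate_bounds (hr : 1 ≤ 2 * r) (hs : 0 < s) (hs1 : s ≤ 1)
    (hrs : 5 / 2 < r + s) :
    ∃ c, 0 < c ∧ ∀ (S : Finset (Fin 3 → ℤ)) (a : (Fin 3 → ℤ) → C3) (A ψ μ β : ℝ), 0 ∉ S → A ≤ ψ →
      0 ≤ β → (∀ n ∉ S, a n = 0) → (∀ n, a (-n) = conj3 (a n)) →
      energyRate S s (2 * r) ψ β a (rhs μ A s a) ≤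
        -(μ ^ 2 - 2 * β - c * √(energy S s (2 * r) ψ a)) * energy S s (2 * r + s + 1) ψ a ∧
      -(μ ^ 2 + c * √(energy S s (2 * r) ψ a)) * energy S s (2 * r + s + 1) ψ a ≤
        energyRate S s (2 * r) ψ β a (rhs μ A s a) := by
  obtain ⟨C, hC, hW⟩ := exists_wiener_le hrs
  set C' := 12 * ((2 + 2 * r) * 2 ^ (r + (s - 1) / 2)) with hC'
  have hC'0 : 0 < C' := by
    have : 0 < 2 + 2 * r := by linarith
    positivity
  refine ⟨2 * C' * C, by positivity, fun S a A ψ μ β hS hA hβ haS ha => ?_⟩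
  have h1 := abs_sum_gw_inner_quad_self_le hS hr hs hs1 hA haS ha
  have h2 := hW S ψ a hS
  have hD := energy_nonneg S s (2 * r + s + 1) ψ a
  set D := energy S s (2 * r + s + 1) ψ a
  set N := ∑ n ∈ S, gw s (2 * r) ψ n * inner ℝ (quad A s a a n) (a n)
  have h3 : |N| ≤ C' * (C * √(energy S s (2 * r) ψ a) * D) :=
    h1.trans (mul_le_mul_of_nonneg_left (mul_le_mul_of_nonneg_right h2 hD) hC'0.le)
  have hrate : energyRate S s (2 * r) ψ β a (rhs μ A s a) =
      2 * β * energy S s (2 * r + s) ψ a - 2 * N - μ ^ 2 * D := by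
    simp only [energyRate, energy, N, D, Finset.mul_sum, ← Finset.sum_sub_distrib]
    refine Finset.sum_congr rfl fun n hn => ?_
    have hn0 : n ≠ 0 := fun h => hS (h ▸ hn)
    rw [add_assoc (2 * r), ← gw_mul_rpow s hn0, ← gw_mul_rpow (s + 1) hn0, rhs, inner_sub_left,
      inner_neg_left, real_inner_smul_left, real_inner_self_eq_norm_sq]
    ring
  have haz : a 0 = 0 := haS 0 hS
  have h4 : energy S s (2 * r + s) ψ a ≤ D := energy_mono (by linarith) le_rfl haz
  have h5 := energy_nonneg S s (2 * r + s) ψ a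
  have h6 := abs_le.1 h3
  rw [hrate]
  constructor
  · nlinarith [mul_le_mul_of_nonneg_left h4 hβ]
  · nlinarith [mul_nonneg hβ h5]

end Rate

/-! ### Galerkin approximations -/

/-- `a` solves the equation truncated to the modes in `S`, up to the error `e`, for `t ∈ [0, T]`;
here `A t = μ W_t`. -/
structure IsApprox (S : Finset (Fin 3 → ℤ)) (T μ s : ℝ) (A : ℝ → ℝ)
    (e a : ℝ → (Fin 3 → ℤ) → C3) : Prop where
  support : ∀ t ∈ Set.Icc 0 T, ∀ n ∉ S, a t n = 0
  real : ∀ t ∈ Set.Icc 0 T, ∀ n, a t (-n) = conj3 (a t n)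
  deriv : ∀ t ∈ Set.Icc 0 T, ∀ n ∈ S,
    HasDerivWithinAt (fun τ => a τ n) (rhs μ (A t) s (a t) n + e t n) (Set.Icc 0 T) t

lemma gevBound_of_support {S : Finset (Fin 3 → ℤ)} (hS : 0 ∉ S) {s p ψ R : ℝ}
    {a : (Fin 3 → ℤ) → C3} (ha : ∀ n ∉ S, a n = 0) (h : energy S s p ψ a ≤ R ^ 2) :
    GevBound s p ψ R a :=
  ⟨ha 0 hS, fun F => (sum_comp_le_sum (S := S) (h := fun n => gw s p ψ n * ‖a n‖ ^ 2)
    (fun n => mul_nonneg (gw_nonneg s p ψ n) (sq_nonneg _)) (fun n hn => by simp [ha n hn])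
    (e := id) Function.injective_id F).trans h⟩

section Galerkin

variable {S : Finset (Fin 3 → ℤ)}

/-- The factor between a Fourier coefficient and its contribution to the Gevrey norm. -/
noncomputable def scale (r s ψ : ℝ) (n : Fin 3 → ℤ) : ℝ := wnum n ^ r * Real.exp (ψ * wnum n ^ s)

lemma scale_pos (r s ψ : ℝ) {n : Fin 3 → ℤ} (hn : n ≠ 0) : 0 < scale r s ψ n := by
  have := wnum_pos hn
  unfold scale; positivity

lemma scale_sq (r s ψ : ℝ) {n : Fin 3 → ℤ} (hn : n ≠ 0) : scale r s ψ n ^ 2 = gw s (2 * r) ψ n := by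
  have := rpow_mul_exp_mul_sq (wnum_pos hn) r ψ s 1
  rw [mul_one, one_pow, mul_one] at this
  exact this

/-- The coefficient family with the Gevrey-normalised coordinates `y`. -/
noncomputable def unscale (r s ψ : ℝ) (y : PiLp 2 fun _ : S => C3) (n : Fin 3 → ℤ) : C3 :=
  if h : n ∈ S then (scale r s ψ n)⁻¹ • y ⟨n, h⟩ else 0

lemma unscale_of_mem (r s ψ : ℝ) (y : PiLp 2 fun _ : S => C3) (n : S) :
    unscale r s ψ y n = (scale r s ψ n)⁻¹ • y n := by
  rw [unscale, dif_pos n.2]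

lemma unscale_of_notMem (r s ψ : ℝ) (y : PiLp 2 fun _ : S => C3) {n : Fin 3 → ℤ} (hn : n ∉ S) :
    unscale r s ψ y n = 0 := by
  rw [unscale, dif_neg hn]

lemma unscale_sub (r s ψ : ℝ) (x y : PiLp 2 fun _ : S => C3) :
    unscale r s ψ x - unscale r s ψ y = unscale r s ψ (x - y) := by
  funext n
  rw [Pi.sub_apply]
  by_cases hn : n ∈ S
  · lift n to S using hn
    simp only [unscale_of_mem, PiLp.sub_apply, smul_sub]
  · simp only [unscale_of_notMem _ _ _ _ hn, sub_zero]

lemma energy_unscale (hS : 0 ∉ S) (r s ψ : ℝ) (y : PiLp 2 fun _ : S => C3) :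
    energy S s (2 * r) ψ (unscale r s ψ y) = ‖y‖ ^ 2 := by
  rw [PiLp.norm_sq_eq_of_L2, energy, ← Finset.sum_coe_sort]
  refine Finset.sum_congr rfl fun n _ => ?_
  have hn0 : (n : Fin 3 → ℤ) ≠ 0 := fun h => hS (h ▸ n.2)
  have := scale_pos r s ψ hn0
  rw [unscale_of_mem, norm_smul, norm_inv, Real.norm_of_nonneg this.le, mul_pow,
    ← scale_sq r s ψ hn0]
  field_simp

lemma gevBound_unscale (hS : 0 ∉ S) {r : ℝ} (hr : 1 ≤ r) (s ψ : ℝ) {y : PiLp 2 fun _ : S => C3}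
    {R : ℝ} (hy : ‖y‖ ≤ R) : GevBound s 2 ψ R (unscale r s ψ y) :=
  (gevBound_of_support hS (fun _ hn => unscale_of_notMem r s ψ y hn)
    ((energy_unscale hS r s ψ y).le.trans (pow_le_pow_left₀ (norm_nonneg _) hy 2))).mono
    (by linarith) le_rfl

/-- The Galerkin vector field in Gevrey-normalised coordinates, for radius `ψ` growing at the
rate `β`. -/
noncomputable def galerkinField (r s μ β A ψ : ℝ) (y : PiLp 2 fun _ : S => C3) :
    PiLp 2 fun _ : S => C3 :=
  WithLp.toLp 2 fun n => scale r s ψ n • rhs μ A s (unscale r s ψ y) n + (β * wnum n ^ s) • y n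

lemma galerkinField_apply (r s μ β A ψ : ℝ) (y : PiLp 2 fun _ : S => C3) (n : S) :
    galerkinField r s μ β A ψ y n =
      scale r s ψ n • rhs μ A s (unscale r s ψ y) n + (β * wnum n ^ s) • y n := rfl

lemma inner_galerkinField (hS : 0 ∉ S) (r s μ β A ψ : ℝ) (y : PiLp 2 fun _ : S => C3) :
    2 * inner ℝ (galerkinField r s μ β A ψ y) y =
      energyRate S s (2 * r) ψ β (unscale r s ψ y) (rhs μ A s (unscale r s ψ y)) := by
  rw [energyRate, ← Finset.sum_coe_sort S, PiLp.inner_apply, Finset.mul_sum]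
  refine Finset.sum_congr rfl fun n _ => ?_
  have hn0 : (n : Fin 3 → ℤ) ≠ 0 := fun h => hS (h ▸ n.2)
  have hw := scale_pos r s ψ hn0
  have hy : y n = scale r s ψ n • unscale r s ψ y n := by
    rw [unscale_of_mem, smul_inv_smul₀ hw.ne']
  rw [galerkinField_apply, inner_add_left, real_inner_smul_left, real_inner_smul_left,
    real_inner_self_eq_norm_sq, ← scale_sq r s ψ hn0]
  rw [hy, real_inner_smul_right, norm_smul, Real.norm_of_nonneg hw.le]
  ring

lemma norm_le_sum_norm {ι : Type*} [Fintype ι] {V : Type*} [NormedAddCommGroup V]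
    (x : PiLp 2 fun _ : ι => V) : ‖x‖ ≤ ∑ i, ‖x i‖ := by
  rw [PiLp.norm_eq_of_L2]
  exact Real.sqrt_le_iff.2 ⟨Finset.sum_nonneg fun _ _ => norm_nonneg _,
    Finset.sum_sq_le_sq_sum_of_nonneg fun _ _ => norm_nonneg _⟩

lemma norm_galerkinField_sub_le (hS : 0 ∉ S) {r s μ β A ψ R : ℝ} (hr : 1 ≤ r) (hs : 0 < s)
    (hs1 : s ≤ 1) (hβ : 0 ≤ β) (hA : A ≤ ψ) {x y : PiLp 2 fun _ : S => C3} (hx : ‖x‖ ≤ R)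
    (hy : ‖y‖ ≤ R) :
    ‖galerkinField r s μ β A ψ x - galerkinField r s μ β A ψ y‖ ≤
      (∑ n : S, (16 * R * (wnum n ^ r * wnum n) + 1 / 2 * μ ^ 2 * wnum n ^ (s + 1) +
        β * wnum n ^ s)) * ‖x - y‖ := by
  have hR : 0 ≤ R := (norm_nonneg x).trans hx
  refine (norm_le_sum_norm _).trans ?_
  rw [Finset.sum_mul]
  refine Finset.sum_le_sum fun n _ => ?_
  have hn0 : (n : Fin 3 → ℤ) ≠ 0 := fun h => hS (h ▸ n.2)
  have hw := scale_pos r s ψ hn0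
  have hk := wnum_pos hn0
  have hxy2 : ‖x - y‖ ≤ 2 * R := (norm_sub_le x y).trans (by linarith)
  have bx := gevBound_unscale hS hr s ψ hx
  have by' := gevBound_unscale hS hr s ψ hy
  have bxy := gevBound_unscale hS hr s ψ (le_refl ‖x - y‖)
  have hq := quad_sub_quad hs hs1 hA (by positivity : 0 ≤ 2 * R)
    (gevBound_unscale hS hr s ψ (hx.trans (by linarith : R ≤ 2 * R)))
    (gevBound_unscale hS hr s ψ (hy.trans (by linarith : R ≤ 2 * R)))
    (by rw [unscale_sub]; exact gevBound_unscale hS hr s ψ hxy2) (n : Fin 3 → ℤ)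
  rw [unscale_sub] at hq
  have q1 := norm_quad_le hs hs1 hA (norm_nonneg (x - y)) hR bxy bx n
  have q2 := norm_quad_le hs hs1 hA hR (norm_nonneg (x - y)) by' bxy n
  have hw2 : scale r s ψ n * (wnum n * Real.exp (-(ψ * wnum n ^ s))) = wnum n ^ r * wnum n := by
    rw [scale, Real.exp_neg]
    field_simp
  have key : (galerkinField r s μ β A ψ x - galerkinField r s μ β A ψ y) n =
      -(scale r s ψ n • (quad A s (unscale r s ψ (x - y)) (unscale r s ψ x) n +
        quad A s (unscale r s ψ y) (unscale r s ψ (x - y)) n)) -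
      (1 / 2 * μ ^ 2 * wnum n ^ (s + 1)) • (x - y) n + (β * wnum n ^ s) • (x - y) n := by
    rw [PiLp.sub_apply, galerkinField_apply, galerkinField_apply, ← hq, rhs, rhs, unscale_of_mem,
      unscale_of_mem, PiLp.sub_apply]
    simp only [smul_sub, smul_neg, smul_comm (scale r s ψ n) _ (_ • _), smul_inv_smul₀ hw.ne']
    abel
  have hc := PiLp.norm_apply_le (x - y) n
  rw [key]
  refine (norm_add_le _ _).trans ?_
  rw [add_mul]
  refine add_le_add ((norm_sub_le _ _).trans ?_) ?_
  · rw [add_mul]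
    refine add_le_add ?_ ?_
    · rw [norm_neg, norm_smul, Real.norm_of_nonneg hw.le]
      calc scale r s ψ n * ‖quad A s (unscale r s ψ (x - y)) (unscale r s ψ x) n +
            quad A s (unscale r s ψ y) (unscale r s ψ (x - y)) n‖
          ≤ scale r s ψ n * (8 * (‖x - y‖ * R) * (wnum n * Real.exp (-(ψ * wnum n ^ s))) +
            8 * (R * ‖x - y‖) * (wnum n * Real.exp (-(ψ * wnum n ^ s)))) :=
            mul_le_mul_of_nonneg_left ((norm_add_le _ _).trans (add_le_add q1 q2)) hw.le
        _ = 16 * R * (scale r s ψ n * (wnum n * Real.exp (-(ψ * wnum n ^ s)))) * ‖x - y‖ := by ring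
        _ = _ := by rw [hw2]
    · rw [norm_smul, Real.norm_of_nonneg (by positivity)]
      exact mul_le_mul_of_nonneg_left hc (by positivity)
  · rw [norm_smul, Real.norm_of_nonneg (by positivity)]
    exact mul_le_mul_of_nonneg_left hc (by positivity)

lemma continuous_galerkinField (hS : 0 ∉ S) (r s μ β : ℝ) {A ψ : ℝ → ℝ} (hA : Continuous A)
    (hψ : Continuous ψ) (y : PiLp 2 fun _ : S => C3) :
    Continuous fun t => galerkinField r s μ β (A t) (ψ t) y := by
  refine (PiLp.continuous_toLp 2 _).comp (continuous_pi fun n => ?_)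
  have hsc : ∀ m : Fin 3 → ℤ, Continuous fun t => scale r s (ψ t) m := fun m => by
    unfold scale; fun_prop
  have hun : ∀ m : Fin 3 → ℤ, Continuous fun t => unscale r s (ψ t) y m := by
    intro m
    by_cases hm : m ∈ S
    · have hm0 : m ≠ 0 := fun h => hS (h ▸ hm)
      simp only [unscale, dif_pos hm]
      exact ((hsc m).inv₀ fun t => (scale_pos r s _ hm0).ne').smul continuous_const
    · simp only [unscale_of_notMem _ _ _ _ hm]
      exact continuous_const
  refine ((hsc n).smul ?_).add continuous_const
  unfold rhs
  have hlin : Continuous fun t => (1 / 2 * μ ^ 2 * wnum n ^ (s + 1)) • unscale r s (ψ t) y n :=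
    (continuous_const_smul _).comp (hun n)
  refine Continuous.sub (Continuous.neg ?_) hlin
  simp only [quad_eq_sum _ _ _ fun _ hm => unscale_of_notMem r s _ y hm]
  refine continuous_finsetSum _ fun m _ => ?_
  have h1 : Continuous fun t => Real.exp (A t * (wnum (n - m) ^ s + wnum m ^ s - wnum n ^ s)) := by
    fun_prop
  have h2 := (continuous_interaction n m).comp ((hun (n - m)).prodMk (hun m))
  exact h1.smul h2

/-- The coordinates of real solenoidal coefficient families. -/
def solenoidalCoords (S : Finset (Fin 3 → ℤ)) : Submodule ℝ (PiLp 2 fun _ : S => C3) where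
  carrier := {y | (∀ n m : S, (m : Fin 3 → ℤ) = -n → y m = conj3 (y n)) ∧
    ∀ n : S, ∑ i, (wave n i : ℂ) * y n i = 0}
  add_mem' := by
    rintro x y ⟨hx, hx'⟩ ⟨hy, hy'⟩
    refine ⟨fun n m h => ?_, fun n => ?_⟩
    · rw [PiLp.add_apply, PiLp.add_apply, hx n m h, hy n m h, conj3_add]
    · simp only [PiLp.add_apply, mul_add, Finset.sum_add_distrib, hx', hy', add_zero]
  zero_mem' := ⟨fun n m _ => by simp [conj3_zero], fun n => by simp⟩
  smul_mem' := by
    rintro c x ⟨hx, hx'⟩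
    refine ⟨fun n m h => ?_, fun n => ?_⟩
    · rw [PiLp.smul_apply, PiLp.smul_apply, hx n m h, conj3_smul]
    · simp only [PiLp.smul_apply, Complex.real_smul, mul_left_comm _ (c : ℂ), ← Finset.mul_sum, hx',
        mul_zero]

lemma unscale_neg (hSneg : ∀ n ∈ S, -n ∈ S) (r s ψ : ℝ) {y : PiLp 2 fun _ : S => C3}
    (hy : y ∈ solenoidalCoords S) (n : Fin 3 → ℤ) :
    unscale r s ψ y (-n) = conj3 (unscale r s ψ y n) := by
  by_cases hn : n ∈ S
  · have h1 := hy.1 ⟨n, hn⟩ ⟨-n, hSneg n hn⟩ rfl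
    rw [unscale, unscale, dif_pos (hSneg n hn), dif_pos hn, h1, conj3_smul, scale, scale, wnum_neg]
  · have hn' : -n ∉ S := fun h => hn (by simpa using hSneg _ h)
    rw [unscale_of_notMem _ _ _ _ hn, unscale_of_notMem _ _ _ _ hn', conj3_zero]

lemma galerkinField_mem (hSneg : ∀ n ∈ S, -n ∈ S) (r s μ β A ψ : ℝ)
    {y : PiLp 2 fun _ : S => C3} (hy : y ∈ solenoidalCoords S) :
    galerkinField r s μ β A ψ y ∈ solenoidalCoords S := by
  have hu := unscale_neg hSneg r s ψ hy
  have hsup : ∀ n ∉ S, unscale r s ψ y n = 0 := fun n hn => unscale_of_notMem r s ψ y hn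
  refine ⟨fun n m h => ?_, fun n => ?_⟩
  · rw [galerkinField_apply, galerkinField_apply, hy.1 n m h, h, rhs, rhs, quad_neg hu hu, hu,
      scale, scale, wnum_neg, conj3_add, conj3_smul, conj3_smul, conj3_sub, conj3_smul,
      ← neg_one_smul ℝ (quad A s _ _ (n : Fin 3 → ℤ)), conj3_smul, neg_one_smul]
  · have e1 := sum_wave_mul_quad (a := unscale r s ψ y) hsup A s n
    have e2 : ∑ i, (wave n i : ℂ) * unscale r s ψ y n i = 0 := by
      simp only [unscale_of_mem, PiLp.smul_apply, Complex.real_smul,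
        mul_left_comm (wave n _ : ℂ) _ _, ← Finset.mul_sum, hy.2 n, mul_zero]
    have e3 := hy.2 n
    simp only [galerkinField_apply, rhs, PiLp.add_apply, PiLp.smul_apply, PiLp.sub_apply,
      PiLp.neg_apply, Complex.real_smul]
    rw [Fin.sum_univ_three] at e1 e2 e3 ⊢
    linear_combination (-(scale r s ψ n : ℂ)) * e1 -
      (scale r s ψ n : ℂ) * ((1 / 2 * μ ^ 2 * wnum n ^ (s + 1) : ℝ) : ℂ) * e2 +
      ((β * wnum n ^ s : ℝ) : ℂ) * e3

/-- Global Galerkin approximations for small data, with norm bounded by `R`. -/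
theorem exists_galerkin (hS : 0 ∉ S) (hSneg : ∀ n ∈ S, -n ∈ S) {r s μ β ψ₀ c R T : ℝ}
    (hr : 1 ≤ r) (hs : 0 < s) (hs1 : s ≤ 1) (hβ : 0 ≤ β) (hR : 0 < R) (hT : 0 ≤ T) (hc : 0 ≤ c)
    (hcR : c * R ≤ μ ^ 2 - 2 * β)
    (hrate : ∀ (S : Finset (Fin 3 → ℤ)) (a : (Fin 3 → ℤ) → C3) (A ψ μ β : ℝ), 0 ∉ S → A ≤ ψ →
      0 ≤ β → (∀ n ∉ S, a n = 0) → (∀ n, a (-n) = conj3 (a n)) →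
      energyRate S s (2 * r) ψ β a (rhs μ A s a) ≤
        -(μ ^ 2 - 2 * β - c * √(energy S s (2 * r) ψ a)) * energy S s (2 * r + s + 1) ψ a)
    {A : ℝ → ℝ} (hA : Continuous A) (hAψ : ∀ t ∈ Set.Icc 0 T, A t ≤ ψ₀ + β * t)
    {a₀ : (Fin 3 → ℤ) → C3} (ha₀ : ∀ n, a₀ (-n) = conj3 (a₀ n))
    (ha₀' : ∀ n, ∑ i, (wave n i : ℂ) * a₀ n i = 0) (hE : energy S s (2 * r) ψ₀ a₀ ≤ R ^ 2) :
    ∃ a : ℝ → (Fin 3 → ℤ) → C3, IsApprox S T μ s A 0 a ∧ (∀ n ∈ S, a 0 n = a₀ n) ∧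
      ∀ t ∈ Set.Icc 0 T, (∀ n, ∑ i, (wave n i : ℂ) * a t n i = 0) ∧
        energy S s (2 * r) (ψ₀ + β * t) (a t) ≤ R ^ 2 := by
  have hSpos : ∀ n : S, (n : Fin 3 → ℤ) ≠ 0 := fun n h => hS (h ▸ n.2)
  set V := solenoidalCoords S
  set F : ℝ → V → V := fun t y =>
    ⟨galerkinField r s μ β (A t) (ψ₀ + β * t) y, galerkinField_mem hSneg r s μ β _ _ y.2⟩ with hF
  set y₀ : PiLp 2 fun _ : S => C3 := WithLp.toLp 2 fun n => scale r s ψ₀ n • a₀ n with hy₀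
  have hy₀V : y₀ ∈ V := by
    refine ⟨fun n m h => ?_, fun n => ?_⟩
    · simp only [hy₀, PiLp.toLp_apply]
      rw [conj3_smul, h, ha₀, scale, scale, wnum_neg]
    · simp only [hy₀, PiLp.toLp_apply, PiLp.smul_apply, Complex.real_smul,
        mul_left_comm (wave n _ : ℂ) _ _, ← Finset.mul_sum, ha₀', mul_zero]
  have hy₀a : ∀ n ∈ S, unscale r s ψ₀ y₀ n = a₀ n := by
    intro n hn
    lift n to S using hn
    rw [unscale_of_mem]
    exact inv_smul_smul₀ (scale_pos r s ψ₀ (hSpos n)).ne' _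
  have hy₀R : ‖(⟨y₀, hy₀V⟩ : V)‖ ≤ R := by
    refine le_of_sq_le_sq ?_ hR.le
    refine le_trans (le_of_eq ?_) hE
    rw [Submodule.coe_norm, ← energy_unscale hS r s ψ₀]
    exact Finset.sum_congr rfl fun n hn => by rw [hy₀a n hn]
  have hdiss : ∀ t ∈ Set.Icc 0 T, ∀ x : V, ‖x‖ ≤ R → inner ℝ (F t x) x ≤ 0 := by
    intro t ht x hx
    have h1 := hrate S (unscale r s (ψ₀ + β * t) (x : PiLp 2 fun _ : S => C3)) (A t)
      (ψ₀ + β * t) μ β hS (hAψ t ht) hβ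
      (fun n hn => unscale_of_notMem _ _ _ _ hn) (unscale_neg hSneg _ _ _ x.2)
    rw [← inner_galerkinField hS, energy_unscale hS, Real.sqrt_sq (norm_nonneg _)] at h1
    have h2 := energy_nonneg S s (2 * r + s + 1) (ψ₀ + β * t)
      (unscale r s (ψ₀ + β * t) (x : PiLp 2 fun _ : S => C3))
    have h3 : 0 ≤ μ ^ 2 - 2 * β - c * ‖(x : PiLp 2 fun _ : S => C3)‖ := by
      have := mul_le_mul_of_nonneg_left hx hc
      rw [Submodule.coe_norm] at this
      linarith
    have h4 := mul_nonneg h3 h2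
    rw [Submodule.coe_inner]
    linarith
  have hF0 : ∀ t, F t 0 = 0 := by
    intro t
    refine Subtype.ext ?_
    simp only [hF, ZeroMemClass.coe_zero]
    have hz : ∀ ψ, unscale r s ψ (0 : PiLp 2 fun _ : S => C3) = 0 := fun ψ => by
      rw [← sub_zero (0 : PiLp 2 fun _ : S => C3), ← unscale_sub, sub_self]
    ext1 n
    have hq : quad (A t) s 0 0 n = 0 := by simp [quad, interaction_zero_right]
    rw [galerkinField_apply, hz, rhs, hq]
    simp
  have : CompleteSpace V := FiniteDimensional.complete ℝ V
  obtain ⟨α, hα0, hα⟩ := exists_solution_of_dissipative F hT hR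
    (K := ∑ n : S, (16 * R * (wnum n ^ r * wnum n) + 1 / 2 * μ ^ 2 * wnum n ^ (s + 1) +
        β * wnum n ^ s))
    (Finset.sum_nonneg fun n _ => by have := wnum_nonneg n; positivity)
    (fun x => (continuous_galerkinField hS r s μ β hA (by fun_prop) x).subtype_mk _)
    (fun t ht x y hx hy => norm_galerkinField_sub_le hS hr hs hs1 hβ (hAψ t ht) hx hy)
    hF0 hdiss hy₀R
  · refine ⟨fun t => unscale r s (ψ₀ + β * t) (α t : PiLp 2 fun _ : S => C3),
      ⟨fun t _ n hn => unscale_of_notMem _ _ _ _ hn,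
        fun t _ n => unscale_neg hSneg _ _ _ (α t).2 n, fun t ht n hn => ?_⟩, fun n hn => ?_,
      fun t ht => ⟨fun n => ?_, ?_⟩⟩
    · have h0 := V.subtypeL.hasFDerivAt.comp_hasDerivWithinAt t (hα t ht).2
      lift n to S using hn
      have h1 : HasDerivWithinAt (fun τ => (α τ : PiLp 2 fun _ : S => C3) n)
          (galerkinField r s μ β (A t) (ψ₀ + β * t) (α t) n) (Set.Icc 0 T) t :=
        (PiLp.proj 2 (𝕜 := ℝ) (fun _ : S => C3) n).hasFDerivAt.comp_hasDerivWithinAt t h0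
      have hk := wnum_pos (hSpos n)
      have h2 : HasDerivWithinAt (fun τ => (scale r s (ψ₀ + β * τ) n)⁻¹)
          (-(β * wnum n ^ s) * (scale r s (ψ₀ + β * t) n)⁻¹) (Set.Icc 0 T) t := by
        have h3 : HasDerivAt (fun τ => scale r s (ψ₀ + β * τ) n)
            (scale r s (ψ₀ + β * t) n * (β * wnum n ^ s)) t := by
          have h4 : HasDerivAt (fun τ : ℝ => (ψ₀ + β * τ) * wnum n ^ s) (β * 1 * wnum n ^ s) t :=
            (((hasDerivAt_id t).const_mul β).const_add ψ₀).mul_const _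
          refine (h4.exp.const_mul (wnum n ^ r)).congr_deriv ?_
          rw [scale]; ring
        refine (h3.fun_inv (scale_pos r s _ (hSpos n)).ne').hasDerivWithinAt.congr_deriv ?_
        have := (scale_pos r s (ψ₀ + β * t) (hSpos n)).ne'
        field_simp
      have h5 := h2.smul h1
      simp only [unscale_of_mem]
      refine h5.congr_deriv ?_
      rw [galerkinField_apply, smul_add, inv_smul_smul₀ (scale_pos r s _ (hSpos n)).ne']
      simp only [Pi.zero_apply]
      module
    · simp only [mul_zero, add_zero, hα0]
      exact hy₀a n hn
    · by_cases hn : n ∈ S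
      · lift n to S using hn
        simp only [unscale_of_mem, PiLp.smul_apply, Complex.real_smul,
          mul_left_comm (wave n _ : ℂ) _ _, ← Finset.mul_sum, (α t).2.2 n, mul_zero]
      · simp [unscale_of_notMem _ _ _ _ hn]
    · simp only [energy_unscale hS]
      exact pow_le_pow_left₀ (norm_nonneg _) (hα t ht).1 2

end Galerkin

/-! ### Stability of approximate solutions -/

lemma le_mul_rpow_add {s θ x : ℝ} (hs : 0 < s) (hθ : 0 < θ) (hx : 0 < x) :
    x ≤ θ * x ^ (s + 1) + (1 / θ) ^ (1 / s) := by
  have h1 : 0 < (1 / θ) ^ (1 / s) := by positivity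
  have h2 : 0 < θ * x ^ (s + 1) := by positivity
  rcases le_or_gt (1 / θ) (x ^ s) with h | h
  · have h3 : x ^ (s + 1) = x ^ s * x := Real.rpow_add_one hx.ne' s
    have h4 : 1 ≤ θ * x ^ s := by
      rw [div_le_iff₀ hθ] at h; linarith
    rw [h3]
    nlinarith [mul_le_mul_of_nonneg_right h4 hx.le]
  · have h3 : x = (x ^ s) ^ (1 / s) := by
      rw [← Real.rpow_mul hx.le, mul_one_div, div_self hs.ne', Real.rpow_one]
    have h4 : (x ^ s) ^ (1 / s) ≤ (1 / θ) ^ (1 / s) :=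
      Real.rpow_le_rpow (by positivity) h.le (by positivity)
    linarith

lemma energy_one_le {S : Finset (Fin 3 → ℤ)} (hS : 0 ∉ S) {s θ : ℝ} (hs : 0 < s) (hθ : 0 < θ)
    (ψ : ℝ) (a : (Fin 3 → ℤ) → C3) :
    energy S s 1 ψ a ≤ θ * energy S s (s + 1) ψ a + (1 / θ) ^ (1 / s) * energy S s 0 ψ a := by
  simp only [energy, Finset.mul_sum, ← Finset.sum_add_distrib]
  refine Finset.sum_le_sum fun n hn => ?_
  have hn0 : n ≠ 0 := fun h => hS (h ▸ hn)
  have h := le_mul_rpow_add hs hθ (wnum_pos hn0)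
  have e1 : gw s 1 ψ n = gw s 0 ψ n * wnum n := by
    have := gw_mul_rpow (s := s) (p := 0) (ψ := ψ) 1 hn0
    rw [Real.rpow_one, zero_add] at this; exact this.symm
  have e2 : gw s (s + 1) ψ n = gw s 0 ψ n * wnum n ^ (s + 1) := by
    have := gw_mul_rpow (s := s) (p := 0) (ψ := ψ) (s + 1) hn0
    rw [zero_add] at this; exact this.symm
  rw [e1, e2]
  have h0 : 0 ≤ gw s 0 ψ n * ‖a n‖ ^ 2 := mul_nonneg (gw_nonneg s 0 ψ n) (sq_nonneg _)
  nlinarith [mul_le_mul_of_nonneg_left h h0]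

lemma gevBound_of_support_max {S : Finset (Fin 3 → ℤ)} (hS : 0 ∉ S) {s p ψ R : ℝ}
    {a : (Fin 3 → ℤ) → C3} (ha : ∀ n ∉ S, a n = 0) (hR : √(energy S s p ψ a) ≤ R) :
    GevBound s p ψ R a :=
  gevBound_of_support hS ha (Real.sqrt_le_left ((Real.sqrt_nonneg _).trans hR) |>.1 hR)

lemma quad_sub_quad_of_support {S : Finset (Fin 3 → ℤ)} (hS : 0 ∉ S) {s A : ℝ}
    {a b : (Fin 3 → ℤ) → C3} (hs : 0 < s) (hs1 : s ≤ 1) (ha : ∀ n ∉ S, a n = 0)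
    (hb : ∀ n ∉ S, b n = 0) (n : Fin 3 → ℤ) :
    quad A s a a n - quad A s b b n = quad A s (a - b) a n + quad A s b (a - b) n := by
  have h1 := Real.sqrt_nonneg (energy S s 2 A a)
  have h2 := Real.sqrt_nonneg (energy S s 2 A b)
  have h3 := Real.sqrt_nonneg (energy S s 2 A (a - b))
  refine quad_sub_quad (R := √(energy S s 2 A a) + √(energy S s 2 A b) +
    √(energy S s 2 A (a - b))) hs hs1 le_rfl (by positivity)
    (gevBound_of_support_max hS ha (by linarith)) (gevBound_of_support_max hS hb (by linarith))
    (gevBound_of_support_max hS (fun m hm => ?_) (by linarith)) n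
  rw [Pi.sub_apply, ha m hm, hb m hm, sub_zero]

section Stability

variable {s r C μ β η Kb : ℝ}

/-- The difference of two approximate solutions is estimated in a Gevrey norm of order zero whose
radius is smaller by the analyticity margin; one of the two has to be small, so that the
dissipation absorbs the part of the nonlinearity with two derivatives of the difference. -/
lemma energyRate_sub_le (hs : 0 < s) (hs1 : s ≤ 1) (hβ : 0 ≤ β) (hη : 0 < η)
    (hKb : 0 ≤ Kb)
    (hW : ∀ (S : Finset (Fin 3 → ℤ)) (ψ : ℝ) (a : (Fin 3 → ℤ) → C3), 0 ∉ S →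
      wiener S s (1 - s) ψ a ≤ C * √(energy S s (2 * r) ψ a))
    {S : Finset (Fin 3 → ℤ)} (hS : 0 ∉ S) {A φ ε : ℝ} (hA : A ≤ φ) {a b e e' : (Fin 3 → ℤ) → C3}
    (haS : ∀ n ∉ S, a n = 0) (ha : ∀ n, a (-n) = conj3 (a n)) (hbS : ∀ n ∉ S, b n = 0)
    (hsmall : 16 * C * √(energy S s (2 * r) φ a) ≤ μ ^ 2 - 2 * β - η)
    (hb : wiener S s (3 / 2) φ b ≤ Kb) (he : energy S s 0 φ (e' - e) ≤ ε ^ 2) :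
    energyRate S s 0 φ β (b - a) ((rhs μ A s b + e') - (rhs μ A s a + e)) ≤
      (32 * Kb * (1 / (η / (32 * Kb + 1))) ^ (1 / s) + 1) * energy S s 0 φ (b - a) + ε ^ 2 := by
  set d := b - a with hd
  have hdS : ∀ n ∉ S, d n = 0 := fun n hn => by rw [hd, Pi.sub_apply, haS n hn, hbS n hn, sub_zero]
  set θ := η / (32 * Kb + 1) with hθ
  have hθ0 : 0 < θ := by positivity
  set T1 := ∑ n ∈ S, gw s 0 φ n * inner ℝ (quad A s d b n) (d n) with hT1
  set T2 := ∑ n ∈ S, gw s 0 φ n * inner ℝ (quad A s a d n) (d n) with hT2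
  set T3 := ∑ n ∈ S, gw s 0 φ n * inner ℝ ((e' - e) n) (d n) with hT3
  have hrate : energyRate S s 0 φ β d ((rhs μ A s b + e') - (rhs μ A s a + e)) =
      2 * β * energy S s s φ d - μ ^ 2 * energy S s (s + 1) φ d - 2 * T1 - 2 * T2 + 2 * T3 := by
    simp only [energyRate, energy, hT1, hT2, hT3, Finset.mul_sum, ← Finset.sum_sub_distrib,
      ← Finset.sum_add_distrib]
    refine Finset.sum_congr rfl fun n hn => ?_
    have hn0 : n ≠ 0 := fun h => hS (h ▸ hn)
    have hq := quad_sub_quad_of_support (A := A) hS hs hs1 hbS haS n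
    rw [← hd] at hq
    have hv : ((rhs μ A s b + e') - (rhs μ A s a + e)) n = -quad A s d b n - quad A s a d n -
        (1 / 2 * μ ^ 2 * wnum n ^ (s + 1)) • d n + (e' - e) n := by
      have hq' : quad A s b b n = quad A s d b n + quad A s a d n + quad A s a a n := by
        rw [← hq]; abel
      simp only [Pi.sub_apply, Pi.add_apply, rhs, hd]
      rw [hq', hd, smul_sub]; abel
    have e1 : gw s s φ n = gw s 0 φ n * wnum n ^ s := by
      have := gw_mul_rpow (s := s) (p := 0) (ψ := φ) s hn0
      rw [zero_add] at this; exact this.symm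
    have e2 : gw s (s + 1) φ n = gw s 0 φ n * wnum n ^ (s + 1) := by
      have := gw_mul_rpow (s := s) (p := 0) (ψ := φ) (s + 1) hn0
      rw [zero_add] at this; exact this.symm
    rw [hv, inner_add_left, inner_sub_left, inner_sub_left, inner_neg_left, real_inner_smul_left,
      real_inner_self_eq_norm_sq, e1, e2]
    ring
  have b1 := (abs_le.1 (abs_sum_gw_zero_inner_quad_le' (d := d) hS hs hs1 hA hbS hdS)).1
  have b2 := (abs_le.1 (abs_sum_gw_zero_inner_quad_le (d := d) hS hs hs1 hA haS ha hdS)).1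
  have b3 : 2 * T3 ≤ energy S s 0 φ d + energy S s 0 φ (e' - e) := by
    rw [hT3, energy, energy, Finset.mul_sum, ← Finset.sum_add_distrib]
    refine Finset.sum_le_sum fun n _ => ?_
    have h1 := real_inner_le_norm ((e' - e) n) (d n)
    have h2 : 2 * inner ℝ ((e' - e) n) (d n) ≤ ‖d n‖ ^ 2 + ‖(e' - e) n‖ ^ 2 := by
      nlinarith [sq_nonneg (‖d n‖ - ‖(e' - e) n‖)]
    have := mul_le_mul_of_nonneg_left h2 (gw_nonneg s 0 φ n)
    linarith
  -- interpolation: one derivative costs a small part `θ` of the dissipation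
  have b4 := energy_one_le hS hs hθ0 φ d
  have b5 : energy S s s φ d ≤ energy S s (s + 1) φ d :=
    energy_mono (by linarith) le_rfl (hdS 0 hS)
  have p1 := energy_nonneg S s 1 φ d
  have p2 := energy_nonneg S s (s + 1) φ d
  have p0 := energy_nonneg S s 0 φ d
  have b6 : wiener S s (3 / 2) φ b * energy S s 1 φ d ≤
      Kb * (θ * energy S s (s + 1) φ d + (1 / θ) ^ (1 / s) * energy S s 0 φ d) :=
    mul_le_mul hb b4 p1 hKb
  have b7 := mul_le_mul_of_nonneg_right (hW S φ a hS) p2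
  have b8 := mul_le_mul_of_nonneg_right hsmall p2
  have b9 := mul_le_mul_of_nonneg_left b5 hβ
  have b10 : 32 * (Kb * θ) ≤ η := by
    rw [hθ, ← mul_assoc, mul_div_assoc', div_le_iff₀ (by positivity)]
    nlinarith
  have b11 := mul_le_mul_of_nonneg_right b10 p2
  rw [hrate]
  linarith

/-- A differential inequality `F' ≤ M F + ε²` on `[0, T]` bounds `F`. -/
lemma le_exp_mul_of_deriv_le {F F' : ℝ → ℝ} {T M ε : ℝ} (hT : 0 ≤ T) (hM : 0 ≤ M)
    (hF : ∀ t ∈ Set.Icc 0 T, HasDerivWithinAt F (F' t) (Set.Icc 0 T) t)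
    (hF' : ∀ t ∈ Set.Icc 0 T, F' t ≤ M * F t + ε ^ 2) (hF0 : 0 ≤ F 0) {t : ℝ}
    (ht : t ∈ Set.Icc 0 T) : F t ≤ Real.exp (M * T) * (F 0 + ε ^ 2 * T) := by
  have hder : ∀ t ∈ Set.Icc 0 T, HasDerivWithinAt (fun t => Real.exp (-(M * t)) * F t - ε ^ 2 * t)
      (Real.exp (-(M * t)) * (F' t - M * F t) - ε ^ 2) (Set.Icc 0 T) t := by
    intro t ht
    have h1 : HasDerivAt (fun t => Real.exp (-(M * t))) (Real.exp (-(M * t)) * -(M * 1)) t :=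
      (((hasDerivAt_id t).const_mul M).fun_neg).exp
    have h2 : HasDerivAt (fun t => ε ^ 2 * t) (ε ^ 2 * 1) t := (hasDerivAt_id t).const_mul _
    exact ((h1.hasDerivWithinAt.mul (hF t ht)).sub h2.hasDerivWithinAt).congr_deriv (by ring)
  have hanti : AntitoneOn (fun t => Real.exp (-(M * t)) * F t - ε ^ 2 * t) (Set.Icc 0 T) := by
    refine antitoneOn_of_hasDerivWithinAt_nonpos (convex_Icc 0 T)
      (fun t ht => (hder t ht).continuousWithinAt)
      (fun t ht => (hder t (interior_subset ht)).mono interior_subset) fun t ht => ?_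
    have ht' := interior_subset ht
    have h1 := hF' t ht'
    have h2 : Real.exp (-(M * t)) ≤ 1 :=
      Real.exp_le_one_iff.2 (by have := mul_nonneg hM ht'.1; linarith)
    have h3 : Real.exp (-(M * t)) * (F' t - M * F t) ≤ Real.exp (-(M * t)) * ε ^ 2 :=
      mul_le_mul_of_nonneg_left (by linarith) (Real.exp_pos _).le
    nlinarith [sq_nonneg ε]
  have h1 := hanti ⟨le_rfl, hT⟩ ht ht.1
  simp only [mul_zero, neg_zero, Real.exp_zero, one_mul, sub_zero] at h1
  have h2 : Real.exp (-(M * t)) * F t ≤ F 0 + ε ^ 2 * T := by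
    have := mul_le_mul_of_nonneg_left ht.2 (sq_nonneg ε)
    linarith
  have h3 : Real.exp (M * t) ≤ Real.exp (M * T) :=
    Real.exp_le_exp.2 (mul_le_mul_of_nonneg_left ht.2 hM)
  have h4 : F t = Real.exp (M * t) * (Real.exp (-(M * t)) * F t) := by
    rw [← mul_assoc, ← Real.exp_add, add_neg_cancel, Real.exp_zero, one_mul]
  rw [h4]
  refine (mul_le_mul_of_nonneg_left h2 (Real.exp_pos _).le).trans
    (mul_le_mul_of_nonneg_right h3 ?_)
  have := mul_nonneg (sq_nonneg ε) hT
  linarith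

/-- Two approximate solutions, one small and one bounded, stay close if their data and errors
are close. -/
theorem exists_stability (hs : 0 < s) (hs1 : s ≤ 1) (hβ : 0 ≤ β) (hη : 0 < η)
    (hKb : 0 ≤ Kb)
    (hW : ∀ (S : Finset (Fin 3 → ℤ)) (ψ : ℝ) (a : (Fin 3 → ℤ) → C3), 0 ∉ S →
      wiener S s (1 - s) ψ a ≤ C * √(energy S s (2 * r) ψ a)) :
    ∃ M, ∀ (S : Finset (Fin 3 → ℤ)) (T φ₀ ε : ℝ) (A : ℝ → ℝ) (a b e e' : ℝ → (Fin 3 → ℤ) → C3),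
      0 ∉ S → 0 ≤ T → (∀ t ∈ Set.Icc 0 T, A t ≤ φ₀ + β * t) →
      IsApprox S T μ s A e a → IsApprox S T μ s A e' b →
      (∀ t ∈ Set.Icc 0 T,
        16 * C * √(energy S s (2 * r) (φ₀ + β * t) (a t)) ≤ μ ^ 2 - 2 * β - η) →
      (∀ t ∈ Set.Icc 0 T, wiener S s (3 / 2) (φ₀ + β * t) (b t) ≤ Kb) →
      (∀ t ∈ Set.Icc 0 T, energy S s 0 (φ₀ + β * t) (e' t - e t) ≤ ε ^ 2) →
      ∀ t ∈ Set.Icc 0 T, energy S s 0 (φ₀ + β * t) (b t - a t) ≤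
        Real.exp (M * T) * (energy S s 0 φ₀ (b 0 - a 0) + ε ^ 2 * T) := by
  refine ⟨32 * Kb * (1 / (η / (32 * Kb + 1))) ^ (1 / s) + 1,
    fun S T φ₀ ε A a b e e' hS hT hA ha hb hsmall hbK he t ht => ?_⟩
  have := le_exp_mul_of_deriv_le (F := fun t => energy S s 0 (φ₀ + β * t) (b t - a t))
    (F' := fun t => energyRate S s 0 (φ₀ + β * t) β (b t - a t)
      ((rhs μ (A t) s (b t) + e' t) - (rhs μ (A t) s (a t) + e t))) (T := T) (ε := ε) hT
    (M := 32 * Kb * (1 / (η / (32 * Kb + 1))) ^ (1 / s) + 1) (by positivity)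
    (fun t ht => hasDerivWithinAt_energy (a := fun t => b t - a t) fun n hn =>
      (hb.deriv t ht n hn).sub (ha.deriv t ht n hn))
    (fun t ht => energyRate_sub_le hs hs1 hβ hη hKb hW hS (hA t ht) (ha.support t ht)
      (ha.real t ht) (hb.support t ht) (hsmall t ht) (hbK t ht) (he t ht))
    (energy_nonneg _ _ _ _ _) ht
  simpa only [mul_zero, add_zero] using this

end Stability

/-! ### Convergence of the Galerkin approximations -/

/-- The nonzero modes with all indices at most `N` in absolute value. -/
noncomputable def box (N : ℕ) : Finset (Fin 3 → ℤ) :=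
  (Fintype.piFinset fun _ => Finset.Icc (-N : ℤ) N).erase 0

lemma mem_box {N : ℕ} {n : Fin 3 → ℤ} : n ∈ box N ↔ n ≠ 0 ∧ ∀ i, |n i| ≤ N := by
  simp [box, abs_le]

lemma zero_notMem_box (N : ℕ) : 0 ∉ box N := by simp [mem_box]

lemma neg_mem_box {N : ℕ} {n : Fin 3 → ℤ} (hn : n ∈ box N) : -n ∈ box N := by
  rw [mem_box] at hn ⊢
  simpa using hn

lemma box_mono {N M : ℕ} (h : N ≤ M) : box N ⊆ box M := fun n hn => by
  rw [mem_box] at hn ⊢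
  exact ⟨hn.1, fun i => (hn.2 i).trans (by exact_mod_cast h)⟩

lemma le_wnum_of_notMem_box {N : ℕ} {n : Fin 3 → ℤ} (hn0 : n ≠ 0) (hn : n ∉ box N) :
    (N : ℝ) ≤ wnum n := by
  rw [mem_box] at hn
  push Not at hn
  obtain ⟨i, hi⟩ := hn hn0
  refine le_trans ?_ (abs_le_wnum n i)
  exact_mod_cast hi.le

lemma eventually_mem_box {n : Fin 3 → ℤ} (hn : n ≠ 0) : ∀ᶠ N in Filter.atTop, n ∈ box N := by
  filter_upwards [Filter.eventually_ge_atTop (∑ i, (n i).natAbs)] with N hN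
  refine mem_box.2 ⟨hn, fun i => ?_⟩
  have := Finset.single_le_sum (f := fun i => (n i).natAbs) (fun _ _ => Nat.zero_le _)
    (Finset.mem_univ i)
  rw [Int.abs_eq_natAbs]
  exact_mod_cast this.trans hN

/-- Beyond the box `N` one gains a factor `1 / N` from one power of the wave number. -/
lemma mul_gw_le_of_notMem_box {N : ℕ} {s p q ψ : ℝ} (hpq : p + 1 ≤ q) {n : Fin 3 → ℤ}
    (hn0 : n ≠ 0) (hn : n ∉ box N) : N * gw s p ψ n ≤ gw s q ψ n := by
  calc N * gw s p ψ n ≤ wnum n * gw s p ψ n :=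
        mul_le_mul_of_nonneg_right (le_wnum_of_notMem_box hn0 hn) (gw_nonneg s p ψ n)
    _ = gw s (p + 1) ψ n := by rw [← gw_mul_rpow 1 hn0, Real.rpow_one, mul_comm]
    _ ≤ gw s q ψ n := gw_mono hpq le_rfl hn0

/-- The standing assumptions: `R` bounds the data, and the dissipation exceeds the nonlinearity
by `η` on the ball of radius `R`; `c` and `C` are the constants of the energy and of the Wiener
algebra estimates. -/
structure Setting (s r μ α β δ η R c C : ℝ) (A : ℝ → ℝ) : Prop where
  hs : 0 < s
  hs1 : s ≤ 1
  hr : 3 / 2 ≤ r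
  hα : 0 ≤ α
  hβ : 0 ≤ β
  hδ : 0 < δ
  hη : 0 < η
  hR : 0 < R
  hc : 0 ≤ c
  hcR : c * R ≤ μ ^ 2 - 2 * β - η
  hC : 0 ≤ C
  hCR : 16 * C * R ≤ μ ^ 2 - 2 * β - η
  rate : ∀ (S : Finset (Fin 3 → ℤ)) (a : (Fin 3 → ℤ) → C3) (A ψ μ β : ℝ), 0 ∉ S → A ≤ ψ →
      0 ≤ β → (∀ n ∉ S, a n = 0) → (∀ n, a (-n) = conj3 (a n)) →
      energyRate S s (2 * r) ψ β a (rhs μ A s a) ≤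
        -(μ ^ 2 - 2 * β - c * √(energy S s (2 * r) ψ a)) * energy S s (2 * r + s + 1) ψ a ∧
      -(μ ^ 2 + c * √(energy S s (2 * r) ψ a)) * energy S s (2 * r + s + 1) ψ a ≤
        energyRate S s (2 * r) ψ β a (rhs μ A s a)
  wiener_le : ∀ (S : Finset (Fin 3 → ℤ)) (ψ : ℝ) (a : (Fin 3 → ℤ) → C3), 0 ∉ S →
      wiener S s (1 - s) ψ a ≤ C * √(energy S s (2 * r) ψ a)
  contA : Continuous A
  hA : ∀ t, 0 ≤ t → A t ≤ α + β * t

/-- `a₀` is the coefficient family of a real solenoidal field, of Gevrey norm at most `R`. -/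
structure InitialData (s r α δ R : ℝ) (a₀ : (Fin 3 → ℤ) → C3) : Prop where
  real : ∀ n, a₀ (-n) = conj3 (a₀ n)
  solenoidal : ∀ n, ∑ i, (wave n i : ℂ) * a₀ n i = 0
  bound : GevBound s (2 * r) (α + δ) R a₀

/-- `u N` is a Galerkin approximation with the modes in `box N`, for the times in `[0, N]`. -/
structure IsGalerkinFamily (s r μ α β δ R : ℝ) (A : ℝ → ℝ) (a₀ : (Fin 3 → ℤ) → C3)
    (u : ℕ → ℝ → (Fin 3 → ℤ) → C3) : Prop where
  approx : ∀ N, IsApprox (box N) N μ s A 0 (u N)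
  initial : ∀ N, ∀ n ∈ box N, u N 0 n = a₀ n
  solenoidal : ∀ N : ℕ, ∀ t ∈ Set.Icc (0 : ℝ) N, ∀ n, ∑ i, (wave n i : ℂ) * u N t n i = 0
  bound : ∀ N : ℕ, ∀ t ∈ Set.Icc (0 : ℝ) N, GevBound s (2 * r) (α + β * t + δ) R (u N t)

lemma energy_le_of_gevBound {S : Finset (Fin 3 → ℤ)} {s p q ψ ψ' R : ℝ} {a : (Fin 3 → ℤ) → C3}
    (h : GevBound s q ψ' R a) (hpq : p ≤ q) (hψ : ψ ≤ ψ') : energy S s p ψ a ≤ R ^ 2 :=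
  (h.mono hpq hψ).2 S

lemma sqrt_energy_le {S : Finset (Fin 3 → ℤ)} {s p q ψ ψ' R : ℝ} {a : (Fin 3 → ℤ) → C3}
    (h : GevBound s q ψ' R a) (hR : 0 ≤ R) (hpq : p ≤ q) (hψ : ψ ≤ ψ') :
    √(energy S s p ψ a) ≤ R :=
  Real.sqrt_le_iff.2 ⟨hR, energy_le_of_gevBound h hpq hψ⟩

lemma IsApprox.mono {S : Finset (Fin 3 → ℤ)} {T T' μ s : ℝ} {A : ℝ → ℝ}
    {e a : ℝ → (Fin 3 → ℤ) → C3} (h : IsApprox S T μ s A e a) (hT : T' ≤ T) :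
    IsApprox S T' μ s A e a := by
  have hsub : Set.Icc (0 : ℝ) T' ⊆ Set.Icc 0 T := Set.Icc_subset_Icc_right hT
  exact ⟨fun t ht => h.support t (hsub ht), fun t ht => h.real t (hsub ht),
    fun t ht n hn => (h.deriv t (hsub ht) n hn).mono hsub⟩

section Convergence

variable {s r μ α β δ η R c C : ℝ} {A : ℝ → ℝ} {a₀ : (Fin 3 → ℤ) → C3}
  {u : ℕ → ℝ → (Fin 3 → ℤ) → C3}

theorem Setting.exists_galerkinFamily (P : Setting s r μ α β δ η R c C A)
    (h₀ : InitialData s r α δ R a₀) : ∃ u, IsGalerkinFamily s r μ α β δ R A a₀ u := by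
  have h : ∀ N : ℕ, ∃ a : ℝ → (Fin 3 → ℤ) → C3, IsApprox (box N) N μ s A 0 a ∧
      (∀ n ∈ box N, a 0 n = a₀ n) ∧
      ∀ t ∈ Set.Icc (0 : ℝ) N, (∀ n, ∑ i, (wave n i : ℂ) * a t n i = 0) ∧
        energy (box N) s (2 * r) ((α + δ) + β * t) (a t) ≤ R ^ 2 := fun N =>
    exists_galerkin (zero_notMem_box N) (fun _ => neg_mem_box) (by have := P.hr; linarith) P.hs
      P.hs1 P.hβ P.hR (Nat.cast_nonneg N) P.hc (P.hcR.trans (by linarith [P.hη]))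
      (fun S a A ψ μ β hS hA hβ haS ha => (P.rate S a A ψ μ β hS hA hβ haS ha).1) P.contA
      (fun t ht => (P.hA t ht.1).trans (by linarith [P.hδ])) h₀.real h₀.solenoidal (h₀.bound.2 _)
  choose u hu using h
  refine ⟨u, fun N => (hu N).1, fun N => (hu N).2.1, fun N t ht => ((hu N).2.2 t ht).1,
    fun N t ht => ?_⟩
  have := ((hu N).2.2 t ht).2
  rw [show α + δ + β * t = α + β * t + δ by ring] at this
  exact gevBound_of_support (zero_notMem_box N) ((hu N).1.support t ht) this

lemma sum_rpow_exp_le_tsum {s δ : ℝ} (hs : 0 < s) (hδ : 0 < δ) (p : ℝ)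
    (F : Finset (Fin 3 → ℤ)) :
    ∑ n ∈ F, wnum n ^ p * Real.exp (-(δ * wnum n ^ s)) ≤
      ∑' n, wnum n ^ p * Real.exp (-(δ * wnum n ^ s)) :=
  (summable_wnum_rpow_mul_exp hs hδ p).sum_le_tsum F fun n _ => by
    have := wnum_nonneg n
    positivity

lemma norm_sq_le_energy {S : Finset (Fin 3 → ℤ)} {s φ : ℝ} (hφ : 0 ≤ φ)
    (a : (Fin 3 → ℤ) → C3) {n : Fin 3 → ℤ} (hn : n ∈ S) : ‖a n‖ ^ 2 ≤ energy S s 0 φ a := by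
  have h1 : 1 ≤ gw s 0 φ n := by
    rw [gw, Real.rpow_zero, one_mul]
    exact Real.one_le_exp (by have := wnum_nonneg n; positivity)
  have h2 := Finset.single_le_sum (f := fun n => gw s 0 φ n * ‖a n‖ ^ 2)
    (fun n _ => mul_nonneg (gw_nonneg s 0 φ n) (sq_nonneg _)) hn
  exact le_trans (by nlinarith [sq_nonneg ‖a n‖]) h2

/-- The error bound used for both truncations: an error of the size of the nonlinearity, at radius
`φ + δ`, is square summable at radius `φ`. -/
lemma energy_zero_le_of_norm_le {S : Finset (Fin 3 → ℤ)} (hS : 0 ∉ S) {s δ φ L : ℝ} (hs : 0 < s)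
    (hδ : 0 < δ) (p : ℝ) {e : (Fin 3 → ℤ) → C3}
    (he : ∀ n ∈ S, ‖e n‖ ≤ L * (wnum n ^ p * Real.exp (-((φ + δ) * wnum n ^ s)))) :
    energy S s 0 φ e ≤
      L ^ 2 * ∑' n, wnum n ^ (2 * p) * Real.exp (-(2 * δ * wnum n ^ s)) := by
  refine le_trans ?_ (mul_le_mul_of_nonneg_left
    (sum_rpow_exp_le_tsum hs (by positivity) (2 * p) S) (sq_nonneg L))
  rw [energy, Finset.mul_sum]
  refine Finset.sum_le_sum fun n hn => ?_
  have hk := wnum_pos (fun h => hS (h ▸ hn) : n ≠ 0)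
  have h1 := pow_le_pow_left₀ (norm_nonneg _) (he n hn) 2
  refine (mul_le_mul_of_nonneg_left h1 (gw_nonneg s 0 φ n)).trans (le_of_eq ?_)
  have h2 : (wnum n ^ p) ^ 2 = wnum n ^ (2 * p) := by
    rw [← Real.rpow_natCast, ← Real.rpow_mul hk.le, mul_comm, Nat.cast_two]
  have h3 : Real.exp (2 * φ * wnum n ^ s) * Real.exp (-((φ + δ) * wnum n ^ s)) ^ 2 =
      Real.exp (-(2 * δ * wnum n ^ s)) := by
    rw [← Real.exp_nat_mul, ← Real.exp_add]; push_cast; ring_nf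
  rw [gw, Real.rpow_zero, one_mul, mul_pow, mul_pow, h2, ← h3]
  ring

/-- The Galerkin approximations form a Cauchy sequence. -/
theorem IsGalerkinFamily.exists_norm_sub_sq_le (P : Setting s r μ α β δ η R c C A)
    (h₀ : InitialData s r α δ R a₀) (G : IsGalerkinFamily s r μ α β δ R A a₀ u) {T : ℝ}
    (hT : 0 ≤ T) : ∃ L, ∀ N M : ℕ, 1 ≤ N → T ≤ N → N ≤ M → ∀ t ∈ Set.Icc 0 T, ∀ n,
      ‖u M t n - u N t n‖ ^ 2 ≤ L / N := by
  have hs := P.hs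
  have hr := P.hr
  have hδ := P.hδ
  obtain ⟨Cw, hCw, hw⟩ := exists_wiener_le_of_pos hs hδ r (3 / 2)
  obtain ⟨M₀, hM₀⟩ := exists_stability (Kb := Cw * R) (r := r) (C := C) (μ := μ) hs P.hs1 P.hβ P.hη
    (mul_nonneg hCw.le P.hR.le) P.wiener_le
  set Z := ∑' n : Fin 3 → ℤ, wnum n ^ (2 * (2 : ℝ)) * Real.exp (-(2 * δ * wnum n ^ s)) with hZ
  have hZ0 : 0 ≤ Z := tsum_nonneg fun n =>
    mul_nonneg (Real.rpow_nonneg (wnum_nonneg n) _) (Real.exp_pos _).le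
  refine ⟨Real.exp (M₀ * T) * (R ^ 2 + 64 * R ^ 4 * Z * T), fun N M hN hTN hNM t ht n => ?_⟩
  have hN1 : (1 : ℝ) ≤ N := by exact_mod_cast hN
  have hNpos : (0 : ℝ) < N := by linarith
  have hTM : T ≤ M := hTN.trans (by exact_mod_cast hNM)
  have subN : ∀ {t}, t ∈ Set.Icc 0 T → t ∈ Set.Icc (0 : ℝ) N := fun ht => ⟨ht.1, ht.2.trans hTN⟩
  have subM : ∀ {t}, t ∈ Set.Icc 0 T → t ∈ Set.Icc (0 : ℝ) M := fun ht => ⟨ht.1, ht.2.trans hTM⟩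
  have hAψ : ∀ t ∈ Set.Icc 0 T, A t ≤ α + β * t + δ := fun t ht => (P.hA t ht.1).trans (by linarith)
  -- the coarser approximation solves the finer system up to the neglected part of `quad`
  set e : ℝ → (Fin 3 → ℤ) → C3 := fun t n => if n ∈ box N then 0 else quad (A t) s (u N t) (u N t) n
    with he
  have hapN : IsApprox (box M) T μ s A e (u N) := by
    have h1 := (G.approx N).mono hTN
    refine ⟨fun t ht n hn => h1.support t ht n fun h => hn (box_mono hNM h), h1.real,
      fun t ht n hn => ?_⟩
    by_cases hnN : n ∈ box N
    · simpa [he, hnN] using h1.deriv t ht n hnN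
    · have hz : rhs μ (A t) s (u N t) n + e t n = 0 := by
        simp only [he, hnN, if_false, rhs, h1.support t ht n hnN]
        simp
      rw [hz]
      exact (hasDerivWithinAt_const t _ (0 : C3)).congr (fun τ hτ => h1.support τ hτ n hnN)
        (h1.support t ht n hnN)
  have hquad : ∀ t ∈ Set.Icc 0 T, ∀ n, ‖quad (A t) s (u N t) (u N t) n‖ ≤
      8 * (R * R) * (wnum n * Real.exp (-((α + β * t + δ) * wnum n ^ s))) := fun t ht n =>
    norm_quad_le hs P.hs1 (hAψ t ht) P.hR.le P.hR.le
      ((G.bound N t (subN ht)).mono (by linarith) le_rfl)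
      ((G.bound N t (subN ht)).mono (by linarith) le_rfl) n
  have herr : ∀ t ∈ Set.Icc 0 T, energy (box M) s 0 (α + β * t) (0 - e t) ≤
      √(64 * R ^ 4 * Z / N) ^ 2 := by
    intro t ht
    have h1 : ∀ n ∈ box M, ‖(0 - e t) n‖ ≤ 8 * (R * R) / N * (wnum n ^ (2 : ℝ) *
        Real.exp (-((α + β * t + δ) * wnum n ^ s))) := by
      intro n hn
      have hn0 := (mem_box.1 hn).1
      have hk := wnum_pos hn0
      rw [Pi.sub_apply, Pi.zero_apply, zero_sub, norm_neg]
      by_cases hnN : n ∈ box N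
      · simp only [he, hnN, if_true, norm_zero]
        have := P.hR
        positivity
      · simp only [he, hnN, if_false]
        refine (hquad t ht n).trans ?_
        have h2 := le_wnum_of_notMem_box hn0 hnN
        have h3 : wnum n ≤ wnum n ^ (2 : ℝ) / N := by
          rw [le_div_iff₀ hNpos, Real.rpow_two]
          nlinarith
        calc 8 * (R * R) * (wnum n * Real.exp (-((α + β * t + δ) * wnum n ^ s)))
            ≤ 8 * (R * R) * (wnum n ^ (2 : ℝ) / N *
              Real.exp (-((α + β * t + δ) * wnum n ^ s))) := by
              have := P.hR
              gcongr
          _ = _ := by ring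
    have h2 := energy_zero_le_of_norm_le (zero_notMem_box M) hs hδ 2 h1
    rw [Real.sq_sqrt (by have := P.hR; positivity)]
    refine h2.trans ?_
    rw [div_pow, div_mul_eq_mul_div, div_le_div_iff₀ (by positivity) hNpos]
    have h3 : (8 * (R * R)) ^ 2 * Z * N ≤ (8 * (R * R)) ^ 2 * Z * N ^ 2 := by
      have h4 : (N : ℝ) ≤ N ^ 2 := by nlinarith
      exact mul_le_mul_of_nonneg_left h4 (by positivity)
    calc (8 * (R * R)) ^ 2 * Z * N ≤ (8 * (R * R)) ^ 2 * Z * N ^ 2 := h3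
      _ = _ := by ring
  have hinit : energy (box M) s 0 α (u M 0 - u N 0) ≤ R ^ 2 / N := by
    rw [le_div_iff₀ hNpos]
    refine le_trans ?_ (h₀.bound.2 (box M))
    rw [energy, energy, Finset.sum_mul]
    refine Finset.sum_le_sum fun n hn => ?_
    have hn0 := (mem_box.1 hn).1
    by_cases hnN : n ∈ box N
    · rw [Pi.sub_apply, G.initial M n hn, G.initial N n hnN, sub_self, norm_zero]
      simpa using mul_nonneg (gw_nonneg s (2 * r) (α + δ) n) (sq_nonneg _)
    · rw [Pi.sub_apply, G.initial M n hn, (G.approx N).support 0 ⟨le_rfl, hNpos.le⟩ n hnN, sub_zero]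
      have h1 := mul_gw_le_of_notMem_box (s := s) (p := 0) (q := 2 * r) (ψ := α)
        (by linarith) hn0 hnN
      have h2 : gw s (2 * r) α n ≤ gw s (2 * r) (α + δ) n := gw_mono le_rfl (by linarith) hn0
      nlinarith [mul_le_mul_of_nonneg_right (h1.trans h2) (sq_nonneg ‖a₀ n‖)]
  have key := hM₀ (box M) T α √(64 * R ^ 4 * Z / N) A (u N) (u M) e 0 (zero_notMem_box M) hT
    (fun t ht => P.hA t ht.1) hapN ((G.approx M).mono hTM)
    (fun t ht => (mul_le_mul_of_nonneg_left (sqrt_energy_le (G.bound N t (subN ht)) P.hR.le le_rfl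
      (by linarith)) (by have := P.hC; positivity)).trans P.hCR)
    (fun t ht => (hw (box M) (α + β * t) (u M t) (zero_notMem_box M)).trans
      (mul_le_mul_of_nonneg_left (sqrt_energy_le (G.bound M t (subM ht)) P.hR.le le_rfl
        le_rfl) hCw.le)) (fun t ht => herr t ht) t ht
  rw [Real.sq_sqrt (by have := P.hR; positivity)] at key
  have hfin : Real.exp (M₀ * T) * (energy (box M) s 0 α (u M 0 - u N 0) +
      64 * R ^ 4 * Z / N * T) ≤ Real.exp (M₀ * T) * (R ^ 2 + 64 * R ^ 4 * Z * T) / N := by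
    calc _ ≤ Real.exp (M₀ * T) * (R ^ 2 / N + 64 * R ^ 4 * Z / N * T) := by gcongr
      _ = _ := by ring
  by_cases hn : n ∈ box M
  · have h1 := norm_sq_le_energy (s := s) (φ := α + β * t)
      (by have := P.hα; have := mul_nonneg P.hβ ht.1; linarith) (u M t - u N t) hn
    exact h1.trans (key.trans hfin)
  · rw [(G.approx M).support t (subM ht) n hn,
      (G.approx N).support t (subN ht) n fun h => hn (box_mono hNM h), sub_zero, norm_zero]
    have := P.hR
    rw [zero_pow two_ne_zero]
    positivity

/-- The equation on the Fourier side, for real coefficient families of mean zero that are locally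
bounded in time in the Gevrey class. -/
structure IsCoeffSolution (s r μ α β δ : ℝ) (A : ℝ → ℝ) (a₀ : (Fin 3 → ℤ) → C3)
    (a : ℝ → (Fin 3 → ℤ) → C3) : Prop where
  initial : a 0 = a₀
  real : ∀ t, 0 ≤ t → ∀ n, a t (-n) = conj3 (a t n)
  bound : ∀ T, 0 ≤ T → ∃ R, 0 ≤ R ∧ ∀ t ∈ Set.Icc 0 T, GevBound s (2 * r) (α + β * t + δ) R (a t)
  deriv : ∀ t, 0 ≤ t → ∀ n,
    HasDerivWithinAt (fun τ => a τ n) (rhs μ (A t) s (a t) n) (Set.Ici 0) t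

/-- The truncation of a coefficient family to the modes in `box N`. -/
noncomputable def truncate (N : ℕ) (a : (Fin 3 → ℤ) → C3) (n : Fin 3 → ℤ) : C3 :=
  if n ∈ box N then a n else 0

lemma truncate_of_mem {N : ℕ} (a : (Fin 3 → ℤ) → C3) {n : Fin 3 → ℤ} (hn : n ∈ box N) :
    truncate N a n = a n := if_pos hn

lemma truncate_of_notMem {N : ℕ} (a : (Fin 3 → ℤ) → C3) {n : Fin 3 → ℤ} (hn : n ∉ box N) :
    truncate N a n = 0 := if_neg hn

lemma GevBound.truncate {s p ψ R : ℝ} {a : (Fin 3 → ℤ) → C3} (h : GevBound s p ψ R a) (N : ℕ) :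
    GevBound s p ψ R (truncate N a) := by
  refine ⟨truncate_of_notMem a (zero_notMem_box N), fun F => le_trans ?_ (h.2 F)⟩
  refine Finset.sum_le_sum fun n _ => mul_le_mul_of_nonneg_left ?_ (gw_nonneg s p ψ n)
  by_cases hn : n ∈ box N
  · rw [truncate_of_mem a hn]
  · rw [truncate_of_notMem a hn, norm_zero, zero_pow two_ne_zero]; positivity

lemma GevBound.sub_truncate {s p q ψ R : ℝ} {a : (Fin 3 → ℤ) → C3} (h : GevBound s q ψ R a)
    (hpq : p + 1 ≤ q) {N : ℕ} (hN : 1 ≤ N) :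
    GevBound s p ψ (R / √N) (a - EMHD.truncate N a) := by
  have hNpos : (0 : ℝ) < N := by exact_mod_cast hN
  refine ⟨?_, fun F => ?_⟩
  · rw [Pi.sub_apply, truncate_of_notMem a (zero_notMem_box N), h.1, sub_zero]
  · rw [div_pow, Real.sq_sqrt hNpos.le, le_div_iff₀ hNpos]
    refine le_trans ?_ (h.2 F)
    rw [energy, energy, Finset.sum_mul]
    refine Finset.sum_le_sum fun n _ => ?_
    rcases eq_or_ne n 0 with rfl | hn0
    · rw [Pi.sub_apply, truncate_of_notMem a (zero_notMem_box N), h.1]; simp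
    by_cases hnN : n ∈ box N
    · rw [Pi.sub_apply, truncate_of_mem a hnN]
      simpa using mul_nonneg (gw_nonneg s q ψ n) (sq_nonneg ‖a n‖)
    · rw [Pi.sub_apply, truncate_of_notMem a hnN, sub_zero]
      nlinarith [mul_le_mul_of_nonneg_right (mul_gw_le_of_notMem_box (s := s) (ψ := ψ) hpq hn0 hnN)
        (sq_nonneg ‖a n‖)]

/-- Every solution is the limit of the Galerkin approximations; in particular it is unique. -/
theorem IsCoeffSolution.tendsto (P : Setting s r μ α β δ η R c C A)
    (G : IsGalerkinFamily s r μ α β δ R A a₀ u) {a : ℝ → (Fin 3 → ℤ) → C3}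
    (h : IsCoeffSolution s r μ α β δ A a₀ a) {t : ℝ} (ht : 0 ≤ t) (n : Fin 3 → ℤ) :
    Filter.Tendsto (fun N => u N t n) Filter.atTop (𝓝 (a t n)) := by
  have hs := P.hs
  have hr := P.hr
  have hδ := P.hδ
  obtain ⟨Ra, hRa, hba⟩ := h.bound t ht
  rcases eq_or_ne n 0 with rfl | hn0
  · have h1 : a t 0 = 0 := (hba t ⟨ht, le_rfl⟩).1
    rw [h1]
    refine tendsto_const_nhds.congr' ?_
    filter_upwards [Filter.eventually_ge_atTop ⌈t⌉₊] with N hN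
    exact ((G.approx N).support t ⟨ht, (Nat.le_ceil t).trans (by exact_mod_cast hN)⟩ 0
      (zero_notMem_box N)).symm
  obtain ⟨Cw, hCw, hw⟩ := exists_wiener_le_of_pos hs hδ r (3 / 2)
  obtain ⟨M₀, hM₀⟩ := exists_stability (Kb := Cw * Ra) (r := r) (C := C) (μ := μ) hs P.hs1 P.hβ P.hη
    (mul_nonneg hCw.le hRa) P.wiener_le
  set Z := ∑' n : Fin 3 → ℤ, wnum n ^ (2 * (1 : ℝ)) * Real.exp (-(2 * δ * wnum n ^ s)) with hZ
  have hZ0 : 0 ≤ Z := tsum_nonneg fun n =>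
    mul_nonneg (Real.rpow_nonneg (wnum_nonneg n) _) (Real.exp_pos _).le
  have key : ∀ᶠ N : ℕ in Filter.atTop, ‖a t n - u N t n‖ ^ 2 ≤
      Real.exp (M₀ * t) * (256 * Ra ^ 4 * Z * t) / N := by
    filter_upwards [Filter.eventually_ge_atTop ⌈t⌉₊, Filter.eventually_ge_atTop 1,
      eventually_mem_box hn0] with N hN hN1 hnN
    have hNpos : (0 : ℝ) < N := by exact_mod_cast hN1
    have htN : t ≤ N := (Nat.le_ceil t).trans (by exact_mod_cast hN)
    have sub : ∀ {τ}, τ ∈ Set.Icc 0 t → τ ∈ Set.Icc (0 : ℝ) N := fun hτ => ⟨hτ.1, hτ.2.trans htN⟩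
    -- the truncated solution solves the truncated system up to the interactions it neglects
    set b : ℝ → (Fin 3 → ℤ) → C3 := fun τ => truncate N (a τ) with hb
    set e : ℝ → (Fin 3 → ℤ) → C3 := fun τ n =>
      quad (A τ) s (b τ) (b τ) n - quad (A τ) s (a τ) (a τ) n with he
    have hbS : ∀ τ, ∀ n ∉ box N, b τ n = 0 := fun τ n hn => truncate_of_notMem _ hn
    have hap : IsApprox (box N) t μ s A e b := by
      refine ⟨fun τ _ => hbS τ, fun τ hτ m => ?_, fun τ hτ m hm => ?_⟩
      · by_cases hm : m ∈ box N
        · rw [hb]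
          simp only
          rw [truncate_of_mem _ hm, truncate_of_mem _ (neg_mem_box hm), h.real τ hτ.1]
        · have hm' : -m ∉ box N := fun h => hm (by simpa using neg_mem_box h)
          rw [hbS _ _ hm, hbS _ _ hm', conj3_zero]
      · have h1 := (h.deriv τ hτ.1 m).mono (fun x hx => hx.1 : Set.Icc 0 t ⊆ Set.Ici 0)
        have e1 : rhs μ (A τ) s (b τ) m + e τ m = rhs μ (A τ) s (a τ) m := by
          simp only [he, rhs]
          rw [show b τ m = a τ m from truncate_of_mem _ hm]
          abel
        rw [e1]
        exact h1.congr (fun x _ => truncate_of_mem _ hm) (truncate_of_mem _ hm)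
    have herr : ∀ τ ∈ Set.Icc 0 t, energy (box N) s 0 (α + β * τ) (e τ - 0) ≤
        √(256 * Ra ^ 4 * Z / N) ^ 2 := by
      intro τ hτ
      have hA : A τ ≤ α + β * τ + δ := (P.hA τ hτ.1).trans (by linarith)
      have hN1' : (1 : ℝ) ≤ √N := Real.one_le_sqrt.2 (by exact_mod_cast hN1)
      have hRN : Ra / √N ≤ Ra := div_le_self hRa hN1'
      have B := (hba τ hτ).mono (p := 2) (by linarith) le_rfl
      have B' := (hba τ hτ).truncate N |>.mono (p := 2) (by linarith) le_rfl
      have D := (hba τ hτ).sub_truncate (p := 2) (by linarith) hN1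
      have D' : GevBound s 2 (α + β * τ + δ) Ra (a τ - truncate N (a τ)) :=
        ⟨D.1, fun F => (D.2 F).trans (pow_le_pow_left₀ (by positivity) hRN 2)⟩
      have h1 : ∀ m ∈ box N, ‖(e τ - 0) m‖ ≤ 16 * (Ra * Ra) / √N * (wnum m ^ (1 : ℝ) *
          Real.exp (-((α + β * τ + δ) * wnum m ^ s))) := by
        intro m _
        have q1 := norm_quad_le hs P.hs1 hA (by positivity : 0 ≤ Ra / √N) hRa D B m
        have q2 := norm_quad_le hs P.hs1 hA hRa (by positivity : 0 ≤ Ra / √N) B' D m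
        have q3 := quad_sub_quad hs P.hs1 hA hRa B B' D' m
        have q4 : (e τ - 0) m = -(quad (A τ) s (a τ - truncate N (a τ)) (a τ) m +
            quad (A τ) s (truncate N (a τ)) (a τ - truncate N (a τ)) m) := by
          rw [← q3, sub_zero]
          simp only [he, hb]; abel
        rw [q4, norm_neg, Real.rpow_one]
        refine (norm_add_le _ _).trans ((add_le_add q1 q2).trans (le_of_eq ?_))
        ring
      have h2 := energy_zero_le_of_norm_le (zero_notMem_box N) hs hδ 1 h1
      rw [Real.sq_sqrt (by positivity)]
      refine h2.trans (le_of_eq ?_)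
      rw [div_pow, Real.sq_sqrt hNpos.le]; ring
    have hinit : energy (box N) s 0 α (b 0 - u N 0) = 0 := by
      refine Finset.sum_eq_zero fun m hm => ?_
      rw [Pi.sub_apply, show b 0 m = a 0 m from truncate_of_mem _ hm, h.initial,
        G.initial N m hm, sub_self, norm_zero]
      simp
    have key := hM₀ (box N) t α √(256 * Ra ^ 4 * Z / N) A (u N) b 0 e (zero_notMem_box N) ht
      (fun τ hτ => P.hA τ hτ.1) ((G.approx N).mono htN) hap
      (fun τ hτ => (mul_le_mul_of_nonneg_left (sqrt_energy_le (G.bound N τ (sub hτ)) P.hR.le le_rfl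
        (by linarith)) (by have := P.hC; positivity)).trans P.hCR)
      (fun τ hτ => (hw (box N) (α + β * τ) (b τ) (zero_notMem_box N)).trans
        (mul_le_mul_of_nonneg_left (sqrt_energy_le ((hba τ hτ).truncate N) hRa le_rfl le_rfl)
          hCw.le)) (fun τ hτ => herr τ hτ) t ⟨ht, le_rfl⟩
    rw [Real.sq_sqrt (by positivity), hinit, zero_add] at key
    have h1 := norm_sq_le_energy (s := s) (φ := α + β * t)
      (by have := P.hα; have := mul_nonneg P.hβ ht; linarith) (b t - u N t) hnN
    rw [Pi.sub_apply, show b t n = a t n from truncate_of_mem _ hnN] at h1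
    exact h1.trans (key.trans (le_of_eq (by ring)))
  have hlim : Filter.Tendsto (fun N : ℕ => Real.exp (M₀ * t) * (256 * Ra ^ 4 * Z * t) / N)
      Filter.atTop (𝓝 0) := tendsto_const_div_atTop_nhds_zero_nat _
  have h2 : Filter.Tendsto (fun N => ‖a t n - u N t n‖ ^ 2) Filter.atTop (𝓝 0) :=
    squeeze_zero' (.of_forall fun _ => sq_nonneg _) key hlim
  have h3 : Filter.Tendsto (fun N => ‖a t n - u N t n‖) Filter.atTop (𝓝 0) := by
    have := h2.sqrt
    simpa [Real.sqrt_sq (norm_nonneg _)] using this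
  rw [tendsto_iff_norm_sub_tendsto_zero]
  simpa only [norm_sub_rev] using h3

end Convergence

/-! ### The limit of the Galerkin approximations -/

lemma norm_rhs_le {s A ψ R μ : ℝ} {a : (Fin 3 → ℤ) → C3} (hs : 0 < s) (hs1 : s ≤ 1) (hA : A ≤ ψ)
    (hψ : 0 ≤ ψ) (hR : 0 ≤ R) (ha : GevBound s 2 ψ R a) (n : Fin 3 → ℤ) :
    ‖rhs μ A s a n‖ ≤ 8 * (R * R) * wnum n + 1 / 2 * μ ^ 2 * wnum n ^ (s + 1) * R := by
  have hk := wnum_nonneg n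
  have he : Real.exp (-(ψ * wnum n ^ s)) ≤ 1 := Real.exp_le_one_iff.2 (by
    have : 0 ≤ ψ * wnum n ^ s := by positivity
    linarith)
  have h1 : ‖quad A s a a n‖ ≤ 8 * (R * R) * wnum n :=
    (norm_quad_le hs hs1 hA hR hR ha ha n).trans
      (mul_le_mul_of_nonneg_left (mul_le_of_le_one_right hk he) (by positivity))
  have h2 : ‖a n‖ ≤ R := (ha.norm_le (by norm_num) hR n).trans (mul_le_of_le_one_right hR he)
  rw [rhs]
  refine (norm_sub_le _ _).trans (add_le_add (by rwa [norm_neg]) ?_)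
  rw [norm_smul, Real.norm_of_nonneg (by positivity)]
  gcongr

lemma tendsto_rhs {ι : Type*} {l : Filter ι} {s μ δ R A₀ : ℝ} {A ψ : ι → ℝ}
    {a : ι → (Fin 3 → ℤ) → C3} {a₀ : (Fin 3 → ℤ) → C3} (hs : 0 < s) (hs1 : s ≤ 1) (hδ : 0 < δ)
    (hR : 0 ≤ R) (h : ∀ᶠ i in l, δ ≤ ψ i ∧ A i ≤ ψ i - δ ∧ GevBound s 2 (ψ i) R (a i))
    (hAl : Filter.Tendsto A l (𝓝 A₀)) (hal : ∀ n, Filter.Tendsto (fun i => a i n) l (𝓝 (a₀ n)))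
    (n : Fin 3 → ℤ) :
    Filter.Tendsto (fun i => rhs μ (A i) s (a i) n) l (𝓝 (rhs μ A₀ s a₀ n)) :=
  (tendsto_quad hs hs1 hδ hR (h.mono fun _ hi => ⟨hi.1, hi.2.1, hi.2.2.norm_le (by norm_num) hR⟩)
    hAl hal n).neg.sub ((hal n).const_smul _)

section Limit

variable {s r μ α β δ η R c C : ℝ} {A : ℝ → ℝ} {a₀ : (Fin 3 → ℤ) → C3}
  {u : ℕ → ℝ → (Fin 3 → ℤ) → C3} {a : ℝ → (Fin 3 → ℤ) → C3}

/-- The coefficients of `u N` converge to those of `a`. -/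
def IsLimit (u : ℕ → ℝ → (Fin 3 → ℤ) → C3) (a : ℝ → (Fin 3 → ℤ) → C3) : Prop :=
  ∀ t, 0 ≤ t → ∀ n, Filter.Tendsto (fun N => u N t n) Filter.atTop (𝓝 (a t n))

lemma eventually_mem_Icc {t : ℝ} (ht : 0 ≤ t) :
    ∀ᶠ N : ℕ in Filter.atTop, t ∈ Set.Icc (0 : ℝ) N := by
  filter_upwards [Filter.eventually_ge_atTop ⌈t⌉₊] with N hN
  exact ⟨ht, (Nat.le_ceil t).trans (by exact_mod_cast hN)⟩

theorem IsGalerkinFamily.exists_isLimit (P : Setting s r μ α β δ η R c C A)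
    (h₀ : InitialData s r α δ R a₀) (G : IsGalerkinFamily s r μ α β δ R A a₀ u) :
    ∃ a, IsLimit u a := by
  have key : ∀ t : ℝ, ∀ n, ∃ x, 0 ≤ t → Filter.Tendsto (fun N => u N t n) Filter.atTop (𝓝 x) := by
    intro t n
    by_cases ht : 0 ≤ t
    swap
    · exact ⟨0, fun h => absurd h ht⟩
    obtain ⟨L, hL⟩ := G.exists_norm_sub_sq_le P h₀ ht
    have hc : CauchySeq fun N => u N t n := by
      refine Metric.cauchySeq_iff'.2 fun ε hε => ?_
      have h1 : ∀ᶠ N : ℕ in Filter.atTop, L / N < ε ^ 2 :=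
        (tendsto_const_div_atTop_nhds_zero_nat L).eventually_lt_const (by positivity)
      obtain ⟨N, hN, hN1, hN2⟩ :=
        (h1.and ((Filter.eventually_ge_atTop 1).and (eventually_mem_Icc ht))).exists
      refine ⟨N, fun M hM => ?_⟩
      rw [dist_eq_norm]
      exact lt_of_pow_lt_pow_left₀ 2 hε.le
        ((hL N M hN1 hN2.2 hM t ⟨ht, le_rfl⟩ n).trans_lt hN)
    obtain ⟨x, hx⟩ := cauchySeq_tendsto_of_complete hc
    exact ⟨x, fun _ => hx⟩
  choose a ha using key
  exact ⟨a, fun t ht n => ha t n ht⟩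

lemma IsLimit.real (G : IsGalerkinFamily s r μ α β δ R A a₀ u) (h : IsLimit u a) {t : ℝ}
    (ht : 0 ≤ t) (n : Fin 3 → ℤ) : a t (-n) = conj3 (a t n) := by
  refine tendsto_nhds_unique (h t ht (-n))
    (((continuous_conj3.tendsto _).comp (h t ht n)).congr' ?_)
  filter_upwards [eventually_mem_Icc ht] with N hN
  exact ((G.approx N).real t hN n).symm

lemma IsLimit.solenoidal (G : IsGalerkinFamily s r μ α β δ R A a₀ u) (h : IsLimit u a) {t : ℝ}
    (ht : 0 ≤ t) (n : Fin 3 → ℤ) : ∑ i, (wave n i : ℂ) * a t n i = 0 := by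
  have h1 : Filter.Tendsto (fun N => ∑ i, (wave n i : ℂ) * u N t n i) Filter.atTop
      (𝓝 (∑ i, (wave n i : ℂ) * a t n i)) := by
    refine tendsto_finsetSum _ fun i _ => Filter.Tendsto.const_mul _ ?_
    exact ((EuclideanSpace.proj (𝕜 := ℂ) i).continuous.tendsto _).comp (h t ht n)
  refine tendsto_nhds_unique h1 (tendsto_const_nhds.congr' ?_)
  filter_upwards [eventually_mem_Icc ht] with N hN
  exact (G.solenoidal N t hN n).symm

lemma IsLimit.gevBound (G : IsGalerkinFamily s r μ α β δ R A a₀ u) (h : IsLimit u a) {t : ℝ}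
    (ht : 0 ≤ t) : GevBound s (2 * r) (α + β * t + δ) R (a t) := by
  constructor
  · refine tendsto_nhds_unique (h t ht 0) (tendsto_const_nhds.congr' ?_)
    filter_upwards [eventually_mem_Icc ht] with N hN
    exact ((G.approx N).support t hN 0 (zero_notMem_box N)).symm
  · intro S
    have h1 : Filter.Tendsto (fun N => energy S s (2 * r) (α + β * t + δ) (u N t)) Filter.atTop
        (𝓝 (energy S s (2 * r) (α + β * t + δ) (a t))) :=
      tendsto_finsetSum _ fun n _ => ((h t ht n).norm.pow 2).const_mul _
    refine le_of_tendsto h1 ?_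
    filter_upwards [eventually_mem_Icc ht] with N hN
    exact (G.bound N t hN).2 S

lemma IsLimit.initial (h₀ : InitialData s r α δ R a₀) (G : IsGalerkinFamily s r μ α β δ R A a₀ u)
    (h : IsLimit u a) : a 0 = a₀ := by
  funext n
  rcases eq_or_ne n 0 with rfl | hn
  · rw [(h.gevBound G le_rfl).1, h₀.bound.1]
  · refine tendsto_nhds_unique (h 0 le_rfl n) (tendsto_const_nhds.congr' ?_)
    filter_upwards [eventually_mem_box hn] with N hN
    exact (G.initial N n hN).symm

lemma Setting.radius_nonneg (P : Setting s r μ α β δ η R c C A) {t : ℝ} (ht : 0 ≤ t) :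
    0 ≤ α + β * t := add_nonneg P.hα (mul_nonneg P.hβ ht)

lemma IsGalerkinFamily.norm_rhs_le (P : Setting s r μ α β δ η R c C A)
    (G : IsGalerkinFamily s r μ α β δ R A a₀ u) {N : ℕ} {t : ℝ} (ht : t ∈ Set.Icc (0 : ℝ) N)
    (n : Fin 3 → ℤ) : ‖rhs μ (A t) s (u N t) n‖ ≤
      8 * (R * R) * wnum n + 1 / 2 * μ ^ 2 * wnum n ^ (s + 1) * R := by
  have h1 := P.hδ
  have h2 := P.hA t ht.1
  have h3 := P.radius_nonneg ht.1
  have h4 := P.hr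
  exact EMHD.norm_rhs_le P.hs P.hs1 (by linarith) (by linarith) P.hR.le
    ((G.bound N t ht).mono (by linarith) le_rfl) n

lemma IsGalerkinFamily.norm_sub_le (P : Setting s r μ α β δ η R c C A)
    (G : IsGalerkinFamily s r μ α β δ R A a₀ u) {N : ℕ} {t t' : ℝ} (ht : t ∈ Set.Icc (0 : ℝ) N)
    (ht' : t' ∈ Set.Icc (0 : ℝ) N) (n : Fin 3 → ℤ) : ‖u N t' n - u N t n‖ ≤
      (8 * (R * R) * wnum n + 1 / 2 * μ ^ 2 * wnum n ^ (s + 1) * R) * |t' - t| := by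
  by_cases hn : n ∈ box N
  · refine Convex.norm_image_sub_le_of_norm_hasDerivWithin_le (f := fun τ => u N τ n)
      (fun x hx => (G.approx N).deriv x hx n hn) (fun x hx => ?_) (convex_Icc _ _) ht ht'
    simpa using G.norm_rhs_le P hx n
  · rw [(G.approx N).support t ht n hn, (G.approx N).support t' ht' n hn, sub_zero, norm_zero]
    have := wnum_nonneg n
    have := P.hR
    positivity

lemma IsLimit.continuousOn (P : Setting s r μ α β δ η R c C A)
    (G : IsGalerkinFamily s r μ α β δ R A a₀ u) (h : IsLimit u a) (n : Fin 3 → ℤ) :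
    ContinuousOn (fun t => a t n) (Set.Ici 0) := by
  set K := 8 * (R * R) * wnum n + 1 / 2 * μ ^ 2 * wnum n ^ (s + 1) * R with hK
  have hK0 : 0 ≤ K := by
    have := wnum_nonneg n
    have := P.hR
    positivity
  have hl : LipschitzOnWith K.toNNReal (fun t => a t n) (Set.Ici 0) := by
    refine LipschitzOnWith.of_dist_le_mul fun t' ht' t ht => ?_
    rw [Real.coe_toNNReal _ hK0, dist_eq_norm, Real.dist_eq]
    refine le_of_tendsto ((h t' ht' n).sub (h t ht n)).norm ?_
    filter_upwards [eventually_mem_Icc ht, eventually_mem_Icc ht'] with N hN hN'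
    exact G.norm_sub_le P hN hN' n
  exact hl.continuousOn

lemma continuous_rhs (P : Setting s r μ α β δ η R c C A) {b : ℝ → (Fin 3 → ℤ) → C3} {θ : ℝ → ℝ}
    (hθ : Continuous θ) (hθ0 : ∀ τ, 0 ≤ θ τ) (hb : ∀ n, Continuous fun τ => b τ n)
    (hB : ∀ τ, GevBound s (2 * r) (α + β * θ τ + δ) R (b τ)) (n : Fin 3 → ℤ) :
    Continuous fun τ => rhs μ (A (θ τ)) s (b τ) n := by
  have hr := P.hr
  refine continuous_iff_continuousAt.2 fun τ =>
    tendsto_rhs (ψ := fun τ => α + β * θ τ + δ) P.hs P.hs1 P.hδ P.hR.le (.of_forall fun x => ?_)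
      ((P.contA.comp hθ).tendsto τ) (fun n => (hb n).tendsto τ) n
  exact ⟨by linarith [P.radius_nonneg (hθ0 x)], by simpa using P.hA _ (hθ0 x),
    (hB x).mono (by linarith) le_rfl⟩

lemma IsGalerkinFamily.continuousOn_rhs (P : Setting s r μ α β δ η R c C A)
    (G : IsGalerkinFamily s r μ α β δ R A a₀ u) (N : ℕ) (n : Fin 3 → ℤ) :
    ContinuousOn (fun τ => rhs μ (A τ) s (u N τ) n) (Set.Icc 0 N) := by
  have hN : (0 : ℝ) ≤ N := Nat.cast_nonneg N
  have hc : ∀ n, ContinuousOn (fun τ => u N τ n) (Set.Icc 0 N) := fun n => by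
    by_cases hn : n ∈ box N
    · exact fun x hx => ((G.approx N).deriv x hx n hn).continuousWithinAt
    · exact continuousOn_const.congr fun x hx => (G.approx N).support x hx n hn
  have hmem : ∀ τ : ℝ, max 0 (min τ N) ∈ Set.Icc (0 : ℝ) N := fun τ =>
    ⟨le_max_left _ _, max_le hN (min_le_right _ _)⟩
  have hθ : Continuous fun τ : ℝ => max 0 (min τ N) := by fun_prop
  have h1 := continuous_rhs P (b := fun τ => u N (max 0 (min τ N))) hθ (fun τ => (hmem τ).1)
    (fun n => (hc n).comp_continuous hθ hmem) (fun τ => G.bound N _ (hmem τ)) n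
  refine h1.continuousOn.congr fun τ hτ => ?_
  simp only [min_eq_left hτ.2, max_eq_right hτ.1]

/-- The integrated equation passes to the limit by dominated convergence. -/
lemma IsLimit.eq_add_integral (P : Setting s r μ α β δ η R c C A)
    (G : IsGalerkinFamily s r μ α β δ R A a₀ u) (h : IsLimit u a) {t : ℝ} (ht : 0 ≤ t)
    {n : Fin 3 → ℤ} (hn : n ≠ 0) : a t n = a₀ n + ∫ τ in 0..t, rhs μ (A τ) s (a τ) n := by
  have hr := P.hr
  have h1 : Filter.Tendsto (fun N => ∫ τ in 0..t, rhs μ (A τ) s (u N τ) n) Filter.atTop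
      (𝓝 (∫ τ in 0..t, rhs μ (A τ) s (a τ) n)) := by
    refine intervalIntegral.tendsto_integral_filter_of_dominated_convergence
      (fun _ => 8 * (R * R) * wnum n + 1 / 2 * μ ^ 2 * wnum n ^ (s + 1) * R) ?_ ?_
      intervalIntegrable_const ?_
    · filter_upwards [eventually_mem_Icc ht] with N hN
      rw [Set.uIoc_of_le ht]
      exact ((G.continuousOn_rhs P N n).mono fun x hx =>
        ⟨hx.1.le, hx.2.trans hN.2⟩).aestronglyMeasurable measurableSet_Ioc
    · filter_upwards [eventually_mem_Icc ht] with N hN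
      refine .of_forall fun x hx => ?_
      rw [Set.uIoc_of_le ht] at hx
      exact G.norm_rhs_le P ⟨hx.1.le, hx.2.trans hN.2⟩ n
    · refine .of_forall fun x hx => ?_
      rw [Set.uIoc_of_le ht] at hx
      have hx0 := hx.1.le
      refine tendsto_rhs (ψ := fun _ => α + β * x + δ) P.hs P.hs1 P.hδ P.hR.le ?_
        tendsto_const_nhds (h x hx0) n
      filter_upwards [eventually_mem_Icc hx0] with N hN
      exact ⟨by linarith [P.radius_nonneg hx0], by linarith [P.hA _ hx0],
        (G.bound N x hN).mono (by linarith) le_rfl⟩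
  refine tendsto_nhds_unique (h t ht n) ((h1.const_add (a₀ n)).congr' ?_)
  filter_upwards [eventually_mem_Icc ht, eventually_mem_box hn] with N hN hnN
  have hsub : Set.Icc 0 t ⊆ Set.Icc (0 : ℝ) N := Set.Icc_subset_Icc_right hN.2
  have hd : ∀ x ∈ Set.Icc (0 : ℝ) N,
      HasDerivWithinAt (fun τ => u N τ n) (rhs μ (A x) s (u N x) n) (Set.Icc 0 N) x :=
    fun x hx => by simpa using (G.approx N).deriv x hx n hnN
  rw [intervalIntegral.integral_eq_sub_of_hasDeriv_right_of_le (f := fun τ => u N τ n) ht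
    (fun x hx => ((hd x (hsub hx)).continuousWithinAt).mono hsub) (fun x hx =>
      ((hd x ⟨hx.1.le, hx.2.le.trans hN.2⟩).hasDerivAt
        (Icc_mem_nhds hx.1 (hx.2.trans_le hN.2))).hasDerivWithinAt)
    (((G.continuousOn_rhs P N n).mono (by rwa [Set.uIcc_of_le ht])).intervalIntegrable),
    G.initial N n hnN]
  abel

theorem IsLimit.isCoeffSolution (P : Setting s r μ α β δ η R c C A)
    (h₀ : InitialData s r α δ R a₀) (G : IsGalerkinFamily s r μ α β δ R A a₀ u)
    (h : IsLimit u a) : IsCoeffSolution s r μ α β δ A a₀ a := by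
  have hr := P.hr
  refine ⟨h.initial h₀ G, fun t ht => h.real G ht, fun T _ =>
    ⟨R, P.hR.le, fun t ht => h.gevBound G ht.1⟩, fun t ht n => ?_⟩
  rcases eq_or_ne n 0 with rfl | hn
  · have h1 : rhs μ (A t) s (a t) 0 = 0 := by
      have h2 := norm_rhs_le (μ := μ) (A := A t) P.hs P.hs1 (by linarith [P.hA t ht, P.hδ])
        (by linarith [P.radius_nonneg ht, P.hδ]) P.hR.le
        ((h.gevBound G ht).mono (p := 2) (by linarith) le_rfl) 0
      rw [wnum_zero, Real.zero_rpow (by linarith [P.hs])] at h2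
      simpa using h2
    rw [h1]
    exact (hasDerivWithinAt_const t _ (0 : C3)).congr (fun τ hτ => (h.gevBound G hτ).1)
      (h.gevBound G ht).1
  · set g : ℝ → C3 := fun τ => rhs μ (A (max 0 τ)) s (a (max 0 τ)) n with hg
    have hθ : Continuous fun τ : ℝ => max 0 τ := by fun_prop
    have hgc : Continuous g := continuous_rhs P (b := fun τ => a (max 0 τ)) hθ
      (fun τ => le_max_left _ _)
      (fun n => (h.continuousOn P G n).comp_continuous hθ fun τ => Set.mem_Ici.2 (le_max_left _ _))
      (fun τ => h.gevBound G (le_max_left _ _)) n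
    have hgt : ∀ τ, 0 ≤ τ → rhs μ (A τ) s (a τ) n = g τ := fun τ hτ => by
      simp only [hg, max_eq_right hτ]
    have heq : ∀ τ, 0 ≤ τ → a τ n = a₀ n + ∫ x in 0..τ, g x := fun τ hτ => by
      rw [h.eq_add_integral P G hτ hn]
      congr 1
      refine intervalIntegral.integral_congr fun x hx => ?_
      rw [Set.uIcc_of_le hτ] at hx
      exact hgt x hx.1
    rw [hgt t ht]
    exact (((hgc.integral_hasStrictDerivAt 0 t).hasDerivAt.const_add (a₀ n)).hasDerivWithinAt).congr
      (fun τ hτ => heq τ hτ) (heq t ht)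

end Limit

/-! ### The energy of the limit -/

/-- The energy of all modes, `∑ |k| ^ p exp (2 ψ |k| ^ s) |a k| ^ 2`. -/
noncomputable def fullEnergy (s p ψ : ℝ) (a : (Fin 3 → ℤ) → C3) : ℝ :=
  ∑' n, gw s p ψ n * ‖a n‖ ^ 2

lemma gw_mul_norm_sq_nonneg (s p ψ : ℝ) (a : (Fin 3 → ℤ) → C3) (n : Fin 3 → ℤ) :
    0 ≤ gw s p ψ n * ‖a n‖ ^ 2 := mul_nonneg (gw_nonneg s p ψ n) (sq_nonneg _)

lemma GevBound.summable {s p ψ R : ℝ} {a : (Fin 3 → ℤ) → C3} (h : GevBound s p ψ R a) :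
    Summable fun n => gw s p ψ n * ‖a n‖ ^ 2 :=
  summable_of_sum_le (gw_mul_norm_sq_nonneg s p ψ a) h.2

lemma GevBound.energy_le_fullEnergy {s p ψ R : ℝ} {a : (Fin 3 → ℤ) → C3} (h : GevBound s p ψ R a)
    (S : Finset (Fin 3 → ℤ)) : energy S s p ψ a ≤ fullEnergy s p ψ a :=
  h.summable.sum_le_tsum S fun n _ => gw_mul_norm_sq_nonneg s p ψ a n

lemma fullEnergy_nonneg (s p ψ : ℝ) (a : (Fin 3 → ℤ) → C3) : 0 ≤ fullEnergy s p ψ a :=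
  tsum_nonneg (gw_mul_norm_sq_nonneg s p ψ a)

lemma GevBound.fullEnergy_mono {s p ψ ψ' R : ℝ} {a : (Fin 3 → ℤ) → C3} (h : GevBound s p ψ' R a)
    (hψ : ψ ≤ ψ') : fullEnergy s p ψ a ≤ fullEnergy s p ψ' a := by
  refine (h.mono le_rfl hψ).summable.tsum_le_tsum (fun n => ?_) h.summable
  rcases eq_or_ne n 0 with rfl | hn
  · rw [h.1]; simp
  · exact mul_le_mul_of_nonneg_right (gw_mono le_rfl hψ hn) (sq_nonneg _)

/-- An upper bound for the energies of all smaller radii is one for the energy. -/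
lemma GevBound.fullEnergy_le_of_lt {s p ψ R X : ℝ} {a : (Fin 3 → ℤ) → C3} (h : GevBound s p ψ R a)
    (hX : ∀ᶠ ρ in 𝓝[<] ψ, fullEnergy s p ρ a ≤ X) : fullEnergy s p ψ a ≤ X := by
  refine h.summable.tsum_le_of_sum_le fun S => ?_
  have hc : Continuous fun ρ => energy S s p ρ a := by
    unfold energy gw
    fun_prop
  refine le_of_tendsto (hc.continuousWithinAt (s := Set.Iio ψ) (x := ψ)) ?_
  filter_upwards [hX, self_mem_nhdsWithin] with ρ hρ hρψ
  exact ((h.mono le_rfl (le_of_lt hρψ)).energy_le_fullEnergy S).trans hρ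

lemma GevBound.gw_mul_norm_sq_le {s p ψ R : ℝ} {a : (Fin 3 → ℤ) → C3} (h : GevBound s p ψ R a)
    (hp : 0 ≤ p) (hR : 0 ≤ R) (q ρ : ℝ) (n : Fin 3 → ℤ) :
    gw s q ρ n * ‖a n‖ ^ 2 ≤
      R ^ 2 * (wnum n ^ q * Real.exp (-(2 * (ψ - ρ) * wnum n ^ s))) := by
  have h1 := pow_le_pow_left₀ (norm_nonneg _) (h.norm_le hp hR n) 2
  have h2 : Real.exp (-(2 * (ψ - ρ) * wnum n ^ s)) =
      Real.exp (2 * ρ * wnum n ^ s) * Real.exp (-(ψ * wnum n ^ s)) ^ 2 := by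
    rw [← Real.exp_nat_mul, ← Real.exp_add]; push_cast; ring_nf
  refine (mul_le_mul_of_nonneg_left h1 (gw_nonneg s q ρ n)).trans (le_of_eq ?_)
  rw [h2, gw]; ring

section Energy

variable {s r μ α β δ η R c C : ℝ} {A : ℝ → ℝ} {a₀ : (Fin 3 → ℤ) → C3}
  {u : ℕ → ℝ → (Fin 3 → ℤ) → C3} {a : ℝ → (Fin 3 → ℤ) → C3}

lemma IsGalerkinFamily.continuousOn (G : IsGalerkinFamily s r μ α β δ R A a₀ u) (N : ℕ)
    (n : Fin 3 → ℤ) : ContinuousOn (fun τ => u N τ n) (Set.Icc 0 N) := by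
  by_cases hn : n ∈ box N
  · exact fun x hx => ((G.approx N).deriv x hx n hn).continuousWithinAt
  · exact continuousOn_const.congr fun x hx => (G.approx N).support x hx n hn

lemma continuousOn_gw_mul {v : ℝ → (Fin 3 → ℤ) → C3} {I : Set ℝ} {n : Fin 3 → ℤ}
    (hv : ContinuousOn (fun τ => v τ n) I) (s q ρ β : ℝ) :
    ContinuousOn (fun τ => gw s q (ρ + β * τ) n * ‖v τ n‖ ^ 2) I := by
  unfold gw
  fun_prop

/-- The two-sided energy balance of the Galerkin approximations. -/
lemma IsGalerkinFamily.energy_sub_bounds (P : Setting s r μ α β δ η R c C A)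
    (G : IsGalerkinFamily s r μ α β δ R A a₀ u) {ρ : ℝ} (hρ : α ≤ ρ) (hρ' : ρ ≤ α + δ) {N : ℕ}
    {t t' : ℝ} (ht : 0 ≤ t) (htt' : t ≤ t') (ht' : t' ≤ N) :
    η * ∑ n ∈ box N, ∫ τ in t..t', gw s (2 * r + s + 1) (ρ + β * τ) n * ‖u N τ n‖ ^ 2 ≤
        energy (box N) s (2 * r) (ρ + β * t) (u N t) -
          energy (box N) s (2 * r) (ρ + β * t') (u N t') ∧
      energy (box N) s (2 * r) (ρ + β * t) (u N t) -
          energy (box N) s (2 * r) (ρ + β * t') (u N t') ≤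
        (μ ^ 2 + c * R) *
          ∑ n ∈ box N, ∫ τ in t..t', gw s (2 * r + s + 1) (ρ + β * τ) n * ‖u N τ n‖ ^ 2 := by
  have hsub : Set.Icc t t' ⊆ Set.Icc (0 : ℝ) N := Set.Icc_subset_Icc ht ht'
  set E : ℝ → ℝ := fun τ => energy (box N) s (2 * r) (ρ + β * τ) (u N τ) with hE
  set D : ℝ → ℝ := fun τ => energy (box N) s (2 * r + s + 1) (ρ + β * τ) (u N τ) with hD
  have hDc : ∀ n, ContinuousOn
      (fun τ => gw s (2 * r + s + 1) (ρ + β * τ) n * ‖u N τ n‖ ^ 2) (Set.Icc t t') := fun n =>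
    continuousOn_gw_mul ((G.continuousOn N n).mono hsub) _ _ _ _
  have hint : ∑ n ∈ box N, ∫ τ in t..t', gw s (2 * r + s + 1) (ρ + β * τ) n * ‖u N τ n‖ ^ 2 =
      ∫ τ in t..t', D τ := by
    rw [hD]
    simp only [energy]
    rw [intervalIntegral.integral_finsetSum]
    exact fun n _ => ((hDc n).mono (by rw [Set.uIcc_of_le htt'])).intervalIntegrable
  have hDcont : ContinuousOn D (Set.Icc t t') := continuousOn_finsetSum _ fun n _ => hDc n
  have hder : ∀ x ∈ Set.Icc (0 : ℝ) N, HasDerivWithinAt E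
      (energyRate (box N) s (2 * r) (ρ + β * x) β (u N x) (rhs μ (A x) s (u N x)))
      (Set.Icc 0 N) x := fun x hx =>
    hasDerivWithinAt_energy fun n hn => by simpa using (G.approx N).deriv x hx n hn
  have hEc : ContinuousOn E (Set.Icc t t') := fun x hx =>
    ((hder x (hsub hx)).continuousWithinAt).mono hsub
  have hder' : ∀ x ∈ Set.Ioo t t', HasDerivWithinAt E
      (energyRate (box N) s (2 * r) (ρ + β * x) β (u N x) (rhs μ (A x) s (u N x)))
      (Set.Ioi x) x := fun x hx =>
    ((hder x (hsub (Set.Ioo_subset_Icc_self hx))).hasDerivAt (Icc_mem_nhds (ht.trans_lt hx.1)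
      (hx.2.trans_le ht'))).hasDerivWithinAt
  have hrate : ∀ x ∈ Set.Ioo t t',
      energyRate (box N) s (2 * r) (ρ + β * x) β (u N x) (rhs μ (A x) s (u N x)) ≤ -η * D x ∧
      -(μ ^ 2 + c * R) * D x ≤
        energyRate (box N) s (2 * r) (ρ + β * x) β (u N x) (rhs μ (A x) s (u N x)) := by
    intro x hx
    have hx' := hsub (Set.Ioo_subset_Icc_self hx)
    have h1 := P.rate (box N) (u N x) (A x) (ρ + β * x) μ β (zero_notMem_box N)
      ((P.hA x hx'.1).trans (by linarith)) P.hβ ((G.approx N).support x hx')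
      ((G.approx N).real x hx')
    have h2 : c * √(energy (box N) s (2 * r) (ρ + β * x) (u N x)) ≤ c * R :=
      mul_le_mul_of_nonneg_left (sqrt_energy_le (G.bound N x hx') P.hR.le le_rfl
        (by linarith)) P.hc
    have h3 : 0 ≤ D x := energy_nonneg _ _ _ _ _
    have h4 := P.hcR
    constructor
    · refine h1.1.trans (mul_le_mul_of_nonneg_right ?_ h3)
      linarith
    · refine (mul_le_mul_of_nonneg_right ?_ h3).trans h1.2
      linarith
  rw [hint]
  have hDi : ∀ k : ℝ, IntegrableOn (fun x => k * D x) (Set.Icc t t') := fun k =>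
    (continuousOn_const.mul hDcont).integrableOn_Icc
  have k1 := intervalIntegral.sub_le_integral_of_hasDeriv_right_of_le htt' hEc hder'
    (hDi (-η)) fun x hx => (hrate x hx).1
  have k2 := intervalIntegral.integral_le_sub_of_hasDeriv_right_of_le htt' hEc hder'
    (hDi (-(μ ^ 2 + c * R))) fun x hx => (hrate x hx).2
  rw [intervalIntegral.integral_const_mul] at k1 k2
  constructor <;> linarith

lemma IsLimit.tendsto_energy (P : Setting s r μ α β δ η R c C A)
    (G : IsGalerkinFamily s r μ α β δ R A a₀ u) (h : IsLimit u a) {ρ : ℝ} (hρ : ρ < α + δ) (q : ℝ)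
    {t : ℝ} (ht : 0 ≤ t) :
    Filter.Tendsto (fun N => energy (box N) s q (ρ + β * t) (u N t)) Filter.atTop
      (𝓝 (fullEnergy s q (ρ + β * t) (a t))) := by
  have hr := P.hr
  have h1 : Filter.Tendsto (fun N => ∑' n, gw s q (ρ + β * t) n * ‖u N t n‖ ^ 2) Filter.atTop
      (𝓝 (fullEnergy s q (ρ + β * t) (a t))) := by
    refine tendsto_tsum_of_dominated_convergence
      ((summable_wnum_rpow_mul_exp P.hs (δ := 2 * (α + δ - ρ)) (by linarith) q).mul_left (R ^ 2))
      (fun n => ((h t ht n).norm.pow 2).const_mul _) ?_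
    filter_upwards [eventually_mem_Icc ht] with N hN n
    rw [Real.norm_of_nonneg (gw_mul_norm_sq_nonneg _ _ _ _ _)]
    refine ((G.bound N t hN).gw_mul_norm_sq_le (by linarith) P.hR.le q (ρ + β * t) n).trans
      (le_of_eq ?_)
    ring_nf
  refine h1.congr' ?_
  filter_upwards [eventually_mem_Icc ht] with N hN
  refine tsum_eq_sum fun n hn => ?_
  rw [(G.approx N).support t hN n hn, norm_zero]
  simp

lemma IsLimit.tendsto_integral (P : Setting s r μ α β δ η R c C A)
    (G : IsGalerkinFamily s r μ α β δ R A a₀ u) (h : IsLimit u a) (ρ q : ℝ)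
    {t t' : ℝ} (ht : 0 ≤ t) (htt' : t ≤ t') (n : Fin 3 → ℤ) :
    Filter.Tendsto (fun N => ∫ τ in t..t', gw s q (ρ + β * τ) n * ‖u N τ n‖ ^ 2) Filter.atTop
      (𝓝 (∫ τ in t..t', gw s q (ρ + β * τ) n * ‖a τ n‖ ^ 2)) := by
  have hr := P.hr
  refine intervalIntegral.tendsto_integral_filter_of_dominated_convergence
    (fun _ => R ^ 2 * (wnum n ^ q * Real.exp (-(2 * (α + δ - ρ) * wnum n ^ s)))) ?_ ?_
    intervalIntegrable_const ?_
  · filter_upwards [eventually_mem_Icc (ht.trans htt')] with N hN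
    rw [Set.uIoc_of_le htt']
    exact (continuousOn_gw_mul ((G.continuousOn N n).mono fun x hx =>
      ⟨ht.trans hx.1.le, hx.2.trans hN.2⟩) _ _ _ _).aestronglyMeasurable measurableSet_Ioc
  · filter_upwards [eventually_mem_Icc (ht.trans htt')] with N hN
    refine .of_forall fun x hx => ?_
    rw [Set.uIoc_of_le htt'] at hx
    rw [Real.norm_of_nonneg (gw_mul_norm_sq_nonneg _ _ _ _ _)]
    refine ((G.bound N x ⟨ht.trans hx.1.le, hx.2.trans hN.2⟩).gw_mul_norm_sq_le (by linarith)
      P.hR.le q (ρ + β * x) n).trans (le_of_eq ?_)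
    ring_nf
  · refine .of_forall fun x hx => ?_
    rw [Set.uIoc_of_le htt'] at hx
    exact ((h x (ht.trans hx.1.le) n).norm.pow 2).const_mul _

/-- The dissipation of the mode `n` over the time interval `[t, t']`. -/
noncomputable def dissipation (s q ρ β : ℝ) (a : ℝ → (Fin 3 → ℤ) → C3) (t t' : ℝ)
    (n : Fin 3 → ℤ) : ℝ := ∫ τ in t..t', gw s q (ρ + β * τ) n * ‖a τ n‖ ^ 2

lemma dissipation_nonneg (s q ρ β : ℝ) (a : ℝ → (Fin 3 → ℤ) → C3) {t t' : ℝ} (htt' : t ≤ t')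
    (n : Fin 3 → ℤ) : 0 ≤ dissipation s q ρ β a t t' n :=
  intervalIntegral.integral_nonneg htt' fun _ _ => gw_mul_norm_sq_nonneg _ _ _ _ _

lemma IsLimit.dissipation_mono (P : Setting s r μ α β δ η R c C A)
    (G : IsGalerkinFamily s r μ α β δ R A a₀ u) (h : IsLimit u a) (q : ℝ) {ρ ρ' : ℝ}
    (hρ : ρ ≤ ρ') {t₀ t t' t₁ : ℝ} (h0 : 0 ≤ t₀) (h1 : t₀ ≤ t) (h2 : t ≤ t') (h3 : t' ≤ t₁)
    (n : Fin 3 → ℤ) : dissipation s q ρ β a t t' n ≤ dissipation s q ρ' β a t₀ t₁ n := by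
  have hc : ∀ ρ, ContinuousOn (fun τ => gw s q (ρ + β * τ) n * ‖a τ n‖ ^ 2) (Set.Ici 0) :=
    fun ρ => continuousOn_gw_mul (h.continuousOn P G n) _ _ _ _
  have hi : ∀ ρ, ∀ {x y}, 0 ≤ x → x ≤ y →
      IntervalIntegrable (fun τ => gw s q (ρ + β * τ) n * ‖a τ n‖ ^ 2) volume x y :=
    fun ρ x y hx hxy => ((hc ρ).mono (by
      rw [Set.uIcc_of_le hxy]; exact fun z hz => hx.trans hz.1)).intervalIntegrable
  calc dissipation s q ρ β a t t' n ≤ dissipation s q ρ' β a t t' n := by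
        refine intervalIntegral.integral_mono_on h2 (hi ρ (h0.trans h1) h2)
          (hi ρ' (h0.trans h1) h2) fun x hx => ?_
        rcases eq_or_ne n 0 with rfl | hn
        · rw [(h.gevBound G ((h0.trans h1).trans hx.1)).1]; simp
        · exact mul_le_mul_of_nonneg_right (gw_mono le_rfl (by linarith) hn) (sq_nonneg _)
    _ ≤ dissipation s q ρ' β a t₀ t₁ n := by
        refine intervalIntegral.integral_mono_interval h1 h2 h3
          (.of_forall fun x => gw_mul_norm_sq_nonneg _ _ _ _ _)
          (hi ρ' h0 (h1.trans (h2.trans h3)))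

lemma IsLimit.summable_dissipation (P : Setting s r μ α β δ η R c C A)
    (G : IsGalerkinFamily s r μ α β δ R A a₀ u) (h : IsLimit u a) {T : ℝ} (hT : 0 ≤ T) :
    Summable (dissipation s (2 * r + s + 1) (α + δ) β a 0 T) := by
  refine summable_of_sum_le (c := R ^ 2 / η) (dissipation_nonneg _ _ _ _ _ hT) fun S => ?_
  refine le_of_tendsto
    (tendsto_finsetSum S fun n _ => h.tendsto_integral P G _ (2 * r + s + 1) le_rfl hT n) ?_
  have hS : ∀ᶠ N in Filter.atTop, ∀ n ∈ S, n ≠ 0 → n ∈ box N := by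
    refine (Filter.eventually_all_finset S).2 fun n _ => ?_
    by_cases hn : n = 0
    · exact .of_forall fun _ h => absurd hn h
    · exact (eventually_mem_box hn).mono fun _ h _ => h
  filter_upwards [hS, eventually_mem_Icc hT] with N hN hTN
  rw [le_div_iff₀ P.hη]
  have h1 := (G.energy_sub_bounds P (ρ := α + δ) (by linarith [P.hδ]) le_rfl le_rfl hT hTN.2).1
  have h2 := energy_le_of_gevBound (S := box N) (G.bound N 0 ⟨le_rfl, Nat.cast_nonneg N⟩)
    (p := 2 * r) le_rfl (ψ := α + δ + β * 0) (by linarith)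
  have h3 := energy_nonneg (box N) s (2 * r) (α + δ + β * T) (u N T)
  refine le_trans ?_ (h1.trans (by linarith))
  rw [mul_comm]
  refine mul_le_mul_of_nonneg_left ?_ P.hη.le
  have h0 : ∫ τ in 0..T, gw s (2 * r + s + 1) (α + δ + β * τ) 0 * ‖u N τ 0‖ ^ 2 = 0 := by
    refine intervalIntegral.integral_zero_ae (.of_forall fun x hx => ?_)
    rw [Set.uIoc_of_le hT] at hx
    rw [(G.bound N x ⟨hx.1.le, hx.2.trans hTN.2⟩).1]
    simp
  rw [← Finset.sum_erase S h0]
  refine Finset.sum_le_sum_of_subset_of_nonneg (fun n hn => ?_)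
    fun n _ _ => dissipation_nonneg _ _ _ _ _ hT n
  exact hN n (Finset.mem_of_mem_erase hn) (Finset.ne_of_mem_erase hn)

/-- The energy balance of the limit at a slightly smaller radius, where all series converge
absolutely and uniformly. -/
lemma IsLimit.fullEnergy_sub_bounds (P : Setting s r μ α β δ η R c C A)
    (G : IsGalerkinFamily s r μ α β δ R A a₀ u) (h : IsLimit u a) {ρ : ℝ} (hρ : α ≤ ρ)
    (hρ' : ρ < α + δ) {t t' : ℝ} (ht : 0 ≤ t) (htt' : t ≤ t') :
    fullEnergy s (2 * r) (ρ + β * t') (a t') ≤ fullEnergy s (2 * r) (ρ + β * t) (a t) ∧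
    fullEnergy s (2 * r) (ρ + β * t) (a t) ≤ fullEnergy s (2 * r) (ρ + β * t') (a t') +
      (μ ^ 2 + c * R) * ∑' n, dissipation s (2 * r + s + 1) ρ β a t t' n := by
  have hr := P.hr
  have ht' := ht.trans htt'
  have e1 := h.tendsto_energy P G hρ' (2 * r) ht
  have e2 := h.tendsto_energy P G hρ' (2 * r) ht'
  have e3 : Filter.Tendsto (fun N => ∑ n ∈ box N,
      ∫ τ in t..t', gw s (2 * r + s + 1) (ρ + β * τ) n * ‖u N τ n‖ ^ 2) Filter.atTop
      (𝓝 (∑' n, dissipation s (2 * r + s + 1) ρ β a t t' n)) := by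
    have h1 : Filter.Tendsto (fun N => ∑' n, dissipation s (2 * r + s + 1) ρ β (u N) t t' n)
        Filter.atTop (𝓝 (∑' n, dissipation s (2 * r + s + 1) ρ β a t t' n)) := by
      refine tendsto_tsum_of_dominated_convergence
        (((summable_wnum_rpow_mul_exp P.hs (δ := 2 * (α + δ - ρ)) (by linarith)
          (2 * r + s + 1)).mul_left (R ^ 2)).mul_right |t' - t|)
        (fun n => h.tendsto_integral P G _ _ ht htt' n) ?_
      filter_upwards [eventually_mem_Icc ht'] with N hN n
      refine intervalIntegral.norm_integral_le_of_norm_le_const fun x hx => ?_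
      rw [Set.uIoc_of_le htt'] at hx
      rw [Real.norm_of_nonneg (gw_mul_norm_sq_nonneg _ _ _ _ _)]
      refine ((G.bound N x ⟨ht.trans hx.1.le, hx.2.trans hN.2⟩).gw_mul_norm_sq_le (by linarith)
        P.hR.le _ (ρ + β * x) n).trans (le_of_eq ?_)
      ring_nf
    refine h1.congr' ?_
    filter_upwards [eventually_mem_Icc ht'] with N hN
    refine tsum_eq_sum fun n hn => ?_
    refine intervalIntegral.integral_zero_ae (.of_forall fun x hx => ?_)
    rw [Set.uIoc_of_le htt'] at hx
    rw [(G.approx N).support x ⟨ht.trans hx.1.le, hx.2.trans hN.2⟩ n hn]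
    simp
  constructor
  · refine le_of_tendsto_of_tendsto e2 e1 ?_
    filter_upwards [eventually_mem_Icc ht'] with N hN
    have h1 := (G.energy_sub_bounds P hρ hρ'.le ht htt' hN.2).1
    have h2 : 0 ≤ ∑ n ∈ box N, dissipation s (2 * r + s + 1) ρ β (u N) t t' n :=
      Finset.sum_nonneg fun n _ => dissipation_nonneg _ _ _ _ _ htt' n
    have h3 := mul_nonneg P.hη.le h2
    simp only [dissipation] at h3
    linarith
  · refine le_of_tendsto_of_tendsto e1 (e2.add (e3.const_mul _)) ?_
    filter_upwards [eventually_mem_Icc ht'] with N hN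
    have h1 := (G.energy_sub_bounds P hρ hρ'.le ht htt' hN.2).2
    linarith

lemma eventually_radius {α δ x : ℝ} (hδ : 0 < δ) :
    ∀ᶠ ρ in 𝓝[<] (α + δ + x), α ≤ ρ - x ∧ ρ - x < α + δ := by
  filter_upwards [Ioo_mem_nhdsLT (by linarith : α + x < α + δ + x)] with ρ hρ
  exact ⟨by linarith [hρ.1], by linarith [hρ.2]⟩

theorem IsLimit.fullEnergy_antitone (P : Setting s r μ α β δ η R c C A)
    (G : IsGalerkinFamily s r μ α β δ R A a₀ u) (h : IsLimit u a) {t t' : ℝ} (ht : 0 ≤ t)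
    (htt' : t ≤ t') : fullEnergy s (2 * r) (α + δ + β * t') (a t') ≤
      fullEnergy s (2 * r) (α + δ + β * t) (a t) := by
  have h1 := (h.gevBound G ht).mono (p := 2 * r) (ψ := α + δ + β * t) le_rfl (by linarith)
  have h2 := (h.gevBound G (ht.trans htt')).mono (p := 2 * r) (ψ := α + δ + β * t') le_rfl
    (by linarith)
  refine h2.fullEnergy_le_of_lt ?_
  filter_upwards [eventually_radius P.hδ] with ρ hρ
  have h3 := (h.fullEnergy_sub_bounds P G hρ.1 hρ.2 ht htt').1
  rw [sub_add_cancel] at h3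
  exact h3.trans (h1.fullEnergy_mono (by linarith [hρ.2]))

lemma IsLimit.fullEnergy_le_add (P : Setting s r μ α β δ η R c C A)
    (G : IsGalerkinFamily s r μ α β δ R A a₀ u) (h : IsLimit u a) {t t' : ℝ} (ht : 0 ≤ t)
    (htt' : t ≤ t') : fullEnergy s (2 * r) (α + δ + β * t) (a t) ≤
      fullEnergy s (2 * r) (α + δ + β * t') (a t') +
        (μ ^ 2 + c * R) * ∑' n, dissipation s (2 * r + s + 1) (α + δ) β a t t' n := by
  have ht' := ht.trans htt'
  have h1 := (h.gevBound G ht).mono (p := 2 * r) (ψ := α + δ + β * t) le_rfl (by linarith)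
  have h2 := (h.gevBound G ht').mono (p := 2 * r) (ψ := α + δ + β * t') le_rfl (by linarith)
  refine h1.fullEnergy_le_of_lt ?_
  filter_upwards [eventually_radius P.hδ] with ρ hρ
  have h3 := (h.fullEnergy_sub_bounds P G hρ.1 hρ.2 ht htt').2
  rw [sub_add_cancel] at h3
  refine h3.trans (add_le_add (h2.fullEnergy_mono (by linarith [hρ.2]))
    (mul_le_mul_of_nonneg_left ?_ (add_nonneg (sq_nonneg _) (mul_nonneg P.hc P.hR.le))))
  have hm : ∀ {ρ}, ρ ≤ α + δ → ∀ n, dissipation s (2 * r + s + 1) ρ β a t t' n ≤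
      dissipation s (2 * r + s + 1) (α + δ) β a 0 t' n := fun hρ n =>
    h.dissipation_mono P G _ hρ le_rfl ht htt' le_rfl n
  have hs := h.summable_dissipation P G ht'
  refine Summable.tsum_le_tsum (fun n => h.dissipation_mono P G _ hρ.2.le ht le_rfl htt' le_rfl n)
    (hs.of_nonneg_of_le (dissipation_nonneg _ _ _ _ _ htt') (hm hρ.2.le))
    (hs.of_nonneg_of_le (dissipation_nonneg _ _ _ _ _ htt') (hm le_rfl))

/-- The energy is continuous in time: by `fullEnergy_le_add` its variation over a short time
interval is controlled by the dissipation, which is integrable. -/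
theorem IsLimit.tendsto_fullEnergy (P : Setting s r μ α β δ η R c C A)
    (G : IsGalerkinFamily s r μ α β δ R A a₀ u) (h : IsLimit u a) (t : ℝ≥0) :
    Filter.Tendsto (fun τ : ℝ≥0 => fullEnergy s (2 * r) (α + δ + β * τ) (a τ)) (𝓝 t)
      (𝓝 (fullEnergy s (2 * r) (α + δ + β * t) (a t))) := by
  have hr := P.hr
  set J : ℝ≥0 → (Fin 3 → ℤ) → ℝ := fun τ =>
    dissipation s (2 * r + s + 1) (α + δ) β a (min t τ : ℝ≥0) (max t τ : ℝ≥0) with hJ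
  have hmm : ∀ τ : ℝ≥0, ((min t τ : ℝ≥0) : ℝ) ≤ (max t τ : ℝ≥0) := fun τ =>
    NNReal.coe_le_coe.2 min_le_max
  have hmc : Continuous fun τ : ℝ≥0 => |((max t τ : ℝ≥0) : ℝ) - (min t τ : ℝ≥0)| := by fun_prop
  have hJ0 : Filter.Tendsto (fun τ => ∑' n, J τ n) (𝓝 t) (𝓝 (∑' _ : Fin 3 → ℤ, (0 : ℝ))) := by
    refine tendsto_tsum_of_dominated_convergence
      (h.summable_dissipation P G (T := t + 1) (by positivity)) (fun n => ?_) ?_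
    · set B := R ^ 2 * (wnum n ^ (2 * r + s + 1) * Real.exp (-(2 * 0 * wnum n ^ s))) with hB
      have h1 : ∀ τ, ‖J τ n‖ ≤ B * |((max t τ : ℝ≥0) : ℝ) - (min t τ : ℝ≥0)| := by
        intro τ
        refine intervalIntegral.norm_integral_le_of_norm_le_const fun x hx => ?_
        rw [Set.uIoc_of_le (hmm τ)] at hx
        rw [Real.norm_of_nonneg (gw_mul_norm_sq_nonneg _ _ _ _ _)]
        refine ((h.gevBound G ((NNReal.coe_nonneg _).trans hx.1.le)).gw_mul_norm_sq_le
          (by linarith) P.hR.le _ (α + δ + β * x) n).trans (le_of_eq ?_)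
        rw [hB]
        ring_nf
      refine squeeze_zero_norm h1 ?_
      have h2 := (hmc.const_mul B).tendsto t
      simpa using h2
    · filter_upwards [Iio_mem_nhds (show t < t + 1 by simp)] with τ hτ n
      rw [Real.norm_of_nonneg (dissipation_nonneg _ _ _ _ _ (hmm τ) n)]
      refine h.dissipation_mono P G _ le_rfl le_rfl (NNReal.coe_nonneg _) (hmm τ) ?_ n
      have h3 : max t τ ≤ t + 1 := max_le (by simp) (le_of_lt hτ)
      exact_mod_cast h3
  rw [tsum_zero] at hJ0
  rw [tendsto_iff_norm_sub_tendsto_zero]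
  refine squeeze_zero (fun _ => norm_nonneg _) (fun τ => ?_)
    (by simpa using hJ0.const_mul (μ ^ 2 + c * R))
  rw [Real.norm_eq_abs]
  rcases le_total t τ with h1 | h1
  · have k1 := h.fullEnergy_antitone P G (NNReal.coe_nonneg t) (NNReal.coe_le_coe.2 h1)
    have k2 := h.fullEnergy_le_add P G (NNReal.coe_nonneg t) (NNReal.coe_le_coe.2 h1)
    simp only [hJ, min_eq_left h1, max_eq_right h1]
    rw [abs_sub_comm, abs_of_nonneg (sub_nonneg.2 k1)]
    exact sub_le_iff_le_add'.2 k2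
  · have k1 := h.fullEnergy_antitone P G (NNReal.coe_nonneg τ) (NNReal.coe_le_coe.2 h1)
    have k2 := h.fullEnergy_le_add P G (NNReal.coe_nonneg τ) (NNReal.coe_le_coe.2 h1)
    simp only [hJ, min_eq_right h1, max_eq_left h1]
    rw [abs_of_nonneg (sub_nonneg.2 k1)]
    exact sub_le_iff_le_add'.2 k2

end Energy

/-- Coefficientwise convergence and convergence of the norms imply strong convergence in a
weighted `ℓ²` space. -/
lemma tendsto_tsum_norm_sub_sq {ι X : Type*} {V : Type*} [NormedAddCommGroup V]
    {l : Filter X} {w : ι → ℝ} (hw : ∀ i, 0 ≤ w i) {f : X → ι → V} {g : ι → V}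
    (hf : ∀ x, Summable fun i => w i * ‖f x i‖ ^ 2) (hg : Summable fun i => w i * ‖g i‖ ^ 2)
    (hfg : ∀ i, Filter.Tendsto (fun x => f x i) l (𝓝 (g i)))
    (hE : Filter.Tendsto (fun x => ∑' i, w i * ‖f x i‖ ^ 2) l (𝓝 (∑' i, w i * ‖g i‖ ^ 2))) :
    Filter.Tendsto (fun x => ∑' i, w i * ‖f x i - g i‖ ^ 2) l (𝓝 0) := by
  set E := ∑' i, w i * ‖g i‖ ^ 2 with hEdef
  have hpt : ∀ x i, w i * ‖f x i - g i‖ ^ 2 ≤ 2 * (w i * ‖f x i‖ ^ 2) + 2 * (w i * ‖g i‖ ^ 2) := by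
    intro x i
    have h1 := pow_le_pow_left₀ (norm_nonneg _) (norm_sub_le (f x i) (g i)) 2
    nlinarith [hw i, mul_le_mul_of_nonneg_left h1 (hw i),
      mul_nonneg (hw i) (sq_nonneg (‖f x i‖ - ‖g i‖))]
  have hnn : ∀ x i, 0 ≤ w i * ‖f x i - g i‖ ^ 2 := fun x i => mul_nonneg (hw i) (sq_nonneg _)
  have hsum : ∀ x, Summable fun i => w i * ‖f x i - g i‖ ^ 2 := fun x =>
    Summable.of_nonneg_of_le (hnn x) (hpt x) (((hf x).mul_left 2).add (hg.mul_left 2))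
  rw [Metric.tendsto_nhds]
  intro ε hε
  obtain ⟨S, hS⟩ : ∃ S : Finset ι, E - ε / 8 < ∑ i ∈ S, w i * ‖g i‖ ^ 2 :=
    (hg.hasSum.eventually_const_lt (by linarith)).exists
  have hlim : Filter.Tendsto (fun x => ∑ i ∈ S, w i * ‖f x i - g i‖ ^ 2 +
      2 * ((∑' i, w i * ‖f x i‖ ^ 2) - ∑ i ∈ S, w i * ‖f x i‖ ^ 2) +
      2 * (E - ∑ i ∈ S, w i * ‖g i‖ ^ 2)) l (𝓝 (∑ i ∈ S, w i * ‖g i - g i‖ ^ 2 +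
      2 * (E - ∑ i ∈ S, w i * ‖g i‖ ^ 2) + 2 * (E - ∑ i ∈ S, w i * ‖g i‖ ^ 2))) := by
    refine Filter.Tendsto.add (Filter.Tendsto.add ?_ ((hE.sub ?_).const_mul 2)) tendsto_const_nhds
    · exact tendsto_finsetSum _ fun i _ => (((hfg i).sub_const _).norm.pow 2).const_mul _
    · exact tendsto_finsetSum _ fun i _ => ((hfg i).norm.pow 2).const_mul _
  have h0 : ∑ i ∈ S, w i * ‖g i - g i‖ ^ 2 = 0 := Finset.sum_eq_zero fun i _ => by simp
  rw [h0] at hlim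
  filter_upwards [hlim.eventually_lt_const (show _ < ε by linarith)] with x hx
  rw [Real.dist_eq, sub_zero, abs_of_nonneg (tsum_nonneg (hnn x))]
  refine lt_of_le_of_lt ?_ hx
  have h1 := (((hf x).mul_left 2).add (hg.mul_left 2)).sub (hsum x)
  have h2 := h1.sum_le_tsum S fun i _ => sub_nonneg.2 (hpt x i)
  rw [Summable.tsum_sub (((hf x).mul_left 2).add (hg.mul_left 2)) (hsum x),
    Summable.tsum_add ((hf x).mul_left 2) (hg.mul_left 2), tsum_mul_left, tsum_mul_left,
    Finset.sum_sub_distrib, Finset.sum_add_distrib, ← Finset.mul_sum, ← Finset.mul_sum] at h2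
  linarith

/-! ### Real vector fields and their Fourier coefficients -/

lemma mFourierCoeff_eq (f : Torus3 → ℂ) (n : Fin 3 → ℤ) :
    UnitAddTorus.mFourierCoeff f n = ∫ x, UnitAddTorus.mFourier (-n) x * f x ∂haar := rfl

lemma mFourierCoeff_congr {f g : Torus3 → ℂ} (h : f =ᵐ[haar] g) (n : Fin 3 → ℤ) :
    UnitAddTorus.mFourierCoeff f n = UnitAddTorus.mFourierCoeff g n := by
  rw [mFourierCoeff_eq, mFourierCoeff_eq]
  refine integral_congr_ae ?_
  filter_upwards [h] with x hx
  rw [hx]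

lemma mFourierCoeff_conj (f : Torus3 → ℂ) (n : Fin 3 → ℤ) :
    UnitAddTorus.mFourierCoeff (fun x => starRingEnd ℂ (f x)) n =
      starRingEnd ℂ (UnitAddTorus.mFourierCoeff f (-n)) := by
  rw [mFourierCoeff_eq, mFourierCoeff_eq, ← integral_conj]
  refine integral_congr_ae (.of_forall fun x => ?_)
  simp only [map_mul, neg_neg, UnitAddTorus.mFourier_neg]

lemma ae_eq_of_mFourierCoeff_eq {f g : ScalarL2}
    (h : ∀ n, UnitAddTorus.mFourierCoeff f n = UnitAddTorus.mFourierCoeff g n) : f = g := by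
  refine (UnitAddTorus.mFourierBasis (d := Fin 3)).repr.injective ?_
  refine lp.ext (funext fun n => ?_)
  rw [UnitAddTorus.mFourierBasis_repr, UnitAddTorus.mFourierBasis_repr, h]

lemma mFourier_norm_apply (n : Fin 3 → ℤ) (x : Torus3) : ‖UnitAddTorus.mFourier n x‖ = 1 := by
  simp only [UnitAddTorus.mFourier, ContinuousMap.coe_mk, norm_prod, fourier_apply,
    Circle.norm_coe, Finset.prod_const_one]

lemma integrable_mFourier_mul {f : Torus3 → ℂ} (hf : Integrable f haar) (n : Fin 3 → ℤ) :
    Integrable (fun x => UnitAddTorus.mFourier n x * f x) haar :=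
  hf.bdd_mul (c := 1) (UnitAddTorus.mFourier n).continuous.aestronglyMeasurable
    (.of_forall fun x => (mFourier_norm_apply n x).le)

lemma mFourierCoeff_add {f g : Torus3 → ℂ} (hf : Integrable f haar) (hg : Integrable g haar)
    (n : Fin 3 → ℤ) : UnitAddTorus.mFourierCoeff (fun x => f x + g x) n =
      UnitAddTorus.mFourierCoeff f n + UnitAddTorus.mFourierCoeff g n := by
  rw [mFourierCoeff_eq, mFourierCoeff_eq, mFourierCoeff_eq,
    ← integral_add (integrable_mFourier_mul hf _) (integrable_mFourier_mul hg _)]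
  simp only [mul_add]

lemma mFourierCoeff_sub {f g : Torus3 → ℂ} (hf : Integrable f haar) (hg : Integrable g haar)
    (n : Fin 3 → ℤ) : UnitAddTorus.mFourierCoeff (fun x => f x - g x) n =
      UnitAddTorus.mFourierCoeff f n - UnitAddTorus.mFourierCoeff g n := by
  rw [mFourierCoeff_eq, mFourierCoeff_eq, mFourierCoeff_eq,
    ← integral_sub (integrable_mFourier_mul hf _) (integrable_mFourier_mul hg _)]
  simp only [mul_sub]

lemma mFourierCoeff_sum {ι : Type*} (s : Finset ι) {f : ι → Torus3 → ℂ}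
    (hf : ∀ j ∈ s, Integrable (f j) haar) (n : Fin 3 → ℤ) :
    UnitAddTorus.mFourierCoeff (fun x => ∑ j ∈ s, f j x) n =
      ∑ j ∈ s, UnitAddTorus.mFourierCoeff (f j) n := by
  simp only [mFourierCoeff_eq]
  rw [← integral_finsetSum _ fun j hj => integrable_mFourier_mul (hf j hj) _]
  simp only [Finset.mul_sum]

lemma component_ae (u : VectorL2) (i : Fin 3) :
    component u i =ᵐ[haar] fun x => ((u x i : ℝ) : ℂ) := by
  unfold component
  filter_upwards [ContinuousLinearMap.coeFn_compLp
    (Complex.ofRealCLM.comp (EuclideanSpace.proj (𝕜 := ℝ) i)) u] with x hx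
  rw [hx]
  rfl

lemma coeff_apply (u : VectorL2) (n : Fin 3 → ℤ) (i : Fin 3) :
    coeff u n i = UnitAddTorus.mFourierCoeff (component u i) n := rfl

lemma coeff_neg (u : VectorL2) (n : Fin 3 → ℤ) : coeff u (-n) = conj3 (coeff u n) := by
  ext i
  rw [conj3_apply, coeff_apply, coeff_apply]
  conv_rhs => rw [← neg_neg n, ← mFourierCoeff_conj]
  refine mFourierCoeff_congr ?_ _
  filter_upwards [component_ae u i] with x hx
  rw [hx, Complex.conj_ofReal]

lemma integrable_vectorL2 (u : VectorL2) : Integrable u haar :=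
  (Lp.memLp u).integrable (by norm_num)

lemma coeff_zero (u : VectorL2) (i : Fin 3) :
    coeff u 0 i = (((∫ x, u x ∂haar) i : ℝ) : ℂ) := by
  have h1 : (∫ x, u x ∂haar) i = ∫ x, u x i ∂haar :=
    ((EuclideanSpace.proj (𝕜 := ℝ) i).integral_comp_comm (integrable_vectorL2 u)).symm
  rw [h1, ← integral_complex_ofReal, coeff_apply, mFourierCoeff_eq]
  refine integral_congr_ae ?_
  filter_upwards [component_ae u i] with x hx
  rw [hx, neg_zero, UnitAddTorus.mFourier_zero, ContinuousMap.one_apply, one_mul]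

lemma integral_eq_zero_iff (u : VectorL2) : ∫ x, u x ∂haar = 0 ↔ coeff u 0 = 0 := by
  constructor
  · intro h
    ext i
    rw [coeff_zero, h]
    simp
  · intro h
    ext i
    have := coeff_zero u i
    rw [h, PiLp.zero_apply] at this
    rw [PiLp.zero_apply]
    exact Complex.ofReal_eq_zero.1 this.symm

lemma coeff_injective : Function.Injective coeff := by
  intro u v h
  have h1 : ∀ i, component u i = component v i := fun i =>
    ae_eq_of_mFourierCoeff_eq fun n => by rw [← coeff_apply, ← coeff_apply, h]
  refine Lp.ext ?_
  filter_upwards [component_ae u 0, component_ae u 1, component_ae u 2, component_ae v 0,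
    component_ae v 1, component_ae v 2] with x u0 u1 u2 v0 v1 v2
  rw [h1, v0] at u0
  rw [h1, v1] at u1
  rw [h1, v2] at u2
  ext i
  fin_cases i
  · exact_mod_cast u0.symm
  · exact_mod_cast u1.symm
  · exact_mod_cast u2.symm

lemma memℓp_two_of_summable {f : (Fin 3 → ℤ) → ℂ} (h : Summable fun n => ‖f n‖ ^ 2) :
    Memℓp f 2 := memℓp_gen (by simpa using h)

/-- A square summable family with the reality condition is the family of Fourier coefficients of
a real vector field. -/
theorem exists_coeff_eq {a : (Fin 3 → ℤ) → C3} (ha : ∀ n, a (-n) = conj3 (a n))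
    (hs : Summable fun n => ‖a n‖ ^ 2) : ∃ u : VectorL2, coeff u = a := by
  have hm : ∀ i, Memℓp (fun n => a n i) 2 := fun i =>
    memℓp_two_of_summable (hs.of_nonneg_of_le (fun _ => sq_nonneg _) fun n =>
      pow_le_pow_left₀ (norm_nonneg _) (PiLp.norm_apply_le (a n) i) 2)
  set f : Fin 3 → ScalarL2 := fun i =>
    (UnitAddTorus.mFourierBasis (d := Fin 3)).repr.symm ⟨_, hm i⟩ with hf
  have hfc : ∀ i n, UnitAddTorus.mFourierCoeff (f i) n = a n i := fun i n => by
    rw [← UnitAddTorus.mFourierBasis_repr, hf, LinearIsometryEquiv.apply_symm_apply]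
  have hv : MemLp (fun x => (WithLp.toLp 2 fun i => (f i x).re : EuclideanSpace ℝ (Fin 3))) 2
      haar := MemLp.of_eval_piLp fun i => (Lp.memLp (f i)).re
  refine ⟨hv.toLp _, funext fun n => ?_⟩
  ext i
  have hfi : Integrable (f i) haar := (Lp.memLp (f i)).integrable (by norm_num)
  have hfi' : Integrable (fun x => starRingEnd ℂ (f i x)) haar :=
    (LinearIsometryEquiv.integrable_comp_iff Complex.conjLIE).2 hfi
  -- the real part of `f i` is half the sum of `f i` and its conjugate
  have h1 : component (hv.toLp _) i =ᵐ[haar]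
      fun x => (1 / 2 : ℂ) * f i x + (1 / 2 : ℂ) * starRingEnd ℂ (f i x) := by
    filter_upwards [component_ae (hv.toLp _) i, hv.coeFn_toLp] with x hx hx'
    rw [hx, hx', ← mul_add, Complex.add_conj]
    push_cast
    ring
  have h2 : ∀ (g : Torus3 → ℂ), UnitAddTorus.mFourierCoeff (fun x => (1 / 2 : ℂ) * g x) n =
      1 / 2 * UnitAddTorus.mFourierCoeff g n := fun g => by
    rw [mFourierCoeff_eq, mFourierCoeff_eq, ← integral_const_mul]
    refine integral_congr_ae (.of_forall fun x => ?_)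
    simp only
    ring
  rw [coeff_apply, mFourierCoeff_congr h1, mFourierCoeff_add (hfi.const_mul _) (hfi'.const_mul _),
    h2, h2, mFourierCoeff_conj, hfc, hfc, ha, conj3_apply, Complex.conj_conj]
  ring

/-- The Fourier coefficients of a product are the convolution of the Fourier coefficients. -/
theorem hasSum_mFourierCoeff_mul (f g : ScalarL2) (n : Fin 3 → ℤ) :
    HasSum (fun m => UnitAddTorus.mFourierCoeff f (n - m) * UnitAddTorus.mFourierCoeff g m)
      (UnitAddTorus.mFourierCoeff (fun x => f x * g x) n) := by
  -- Parseval's identity for `g` and the conjugate of `exp (-i n x) f`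
  have hm : MemLp (fun x => UnitAddTorus.mFourier n x * starRingEnd ℂ (f x)) 2 haar := by
    refine (Lp.memLp f).of_le ((UnitAddTorus.mFourier n).continuous.aestronglyMeasurable.mul
      (Complex.continuous_conj.comp_aestronglyMeasurable (Lp.aestronglyMeasurable f)))
      (.of_forall fun x => ?_)
    rw [norm_mul, mFourier_norm_apply, one_mul, RCLike.norm_conj]
  have h := UnitAddTorus.hasSum_prod_mFourierCoeff (hm.toLp _) g
  have h1 : ∀ m, starRingEnd ℂ (UnitAddTorus.mFourierCoeff (hm.toLp _) m) =
      UnitAddTorus.mFourierCoeff f (n - m) := by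
    intro m
    rw [mFourierCoeff_congr hm.coeFn_toLp, mFourierCoeff_eq, mFourierCoeff_eq, ← integral_conj]
    refine integral_congr_ae (.of_forall fun x => ?_)
    simp only
    rw [show -(n - m) = m + -n by abel, UnitAddTorus.mFourier_add]
    simp only [map_mul, UnitAddTorus.mFourier_neg, Complex.conj_conj]
    ring
  have h2 : ∫ x, starRingEnd ℂ (hm.toLp _ x) * g x ∂haar =
      UnitAddTorus.mFourierCoeff (fun x => f x * g x) n := by
    rw [mFourierCoeff_eq]
    refine integral_congr_ae ?_
    filter_upwards [hm.coeFn_toLp] with x hx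
    rw [hx]
    simp only [map_mul, UnitAddTorus.mFourier_neg, Complex.conj_conj]
    ring
  rw [← h2]
  refine h.congr_fun fun m => ?_
  rw [h1]

/-! ### The nonlinearity on the Fourier side -/

/-- The Fourier coefficients of `f` are at most `B |k| ^ p exp (-δ |k| ^ s)`. -/
def Decays (s : ℝ) (p : ℕ) (δ B : ℝ) (f : ScalarL2) : Prop :=
  ∀ n, ‖UnitAddTorus.mFourierCoeff f n‖ ≤ B * (wnum n ^ p * Real.exp (-(δ * wnum n ^ s)))

/-- A multiplier whose symbol is at most `|k| ^ q exp (θ |k| ^ s)` is defined on fields whose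
coefficients decay faster than `exp (-θ |k| ^ s)`. -/
lemma Decays.multiplier {s δ θ B : ℝ} {p : ℕ} (q : ℕ) {f : ScalarL2} (h : Decays s p δ B f)
    (hs : 0 < s) (hθ : θ < δ) {m : (Fin 3 → ℤ) → ℂ}
    (hm : ∀ n, ‖m n‖ ≤ wnum n ^ q * Real.exp (θ * wnum n ^ s)) :
    (∀ n, UnitAddTorus.mFourierCoeff (multiplier m f) n =
      m n * UnitAddTorus.mFourierCoeff f n) ∧ Decays s (p + q) (δ - θ) B (multiplier m f) := by
  have hb : ∀ n, ‖m n * UnitAddTorus.mFourierCoeff f n‖ ≤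
      B * (wnum n ^ (p + q) * Real.exp (-((δ - θ) * wnum n ^ s))) := by
    intro n
    have hk := wnum_nonneg n
    rw [norm_mul]
    refine (mul_le_mul (hm n) (h n) (norm_nonneg _) (by positivity)).trans (le_of_eq ?_)
    rw [show -((δ - θ) * wnum n ^ s) = θ * wnum n ^ s + -(δ * wnum n ^ s) by ring, Real.exp_add,
      pow_add]
    ring
  have hsum : Summable fun n => ‖m n * UnitAddTorus.mFourierCoeff f n‖ ^ 2 := by
    have h1 := (summable_wnum_rpow_mul_exp hs (δ := 2 * (δ - θ)) (by linarith)
      ((2 * (p + q) : ℕ) : ℝ)).mul_left (B ^ 2)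
    refine h1.of_nonneg_of_le (fun _ => sq_nonneg _) fun n => ?_
    refine (pow_le_pow_left₀ (norm_nonneg _) (hb n) 2).trans (le_of_eq ?_)
    rw [Real.rpow_natCast, mul_pow, mul_pow, ← pow_mul, ← Real.exp_nat_mul, mul_comm (p + q)]
    push_cast
    ring_nf
  have hcoef := mFourierCoeff_multiplier m f (memℓp_two_of_summable hsum)
  exact ⟨hcoef, fun n => by rw [hcoef]; exact hb n⟩

lemma Decays.expLambda {s δ θ B : ℝ} {p : ℕ} {f : ScalarL2} (h : Decays s p δ B f)
    (hs : 0 < s) (hθ : θ < δ) :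
    (∀ n, UnitAddTorus.mFourierCoeff (expLambda θ s f) n =
      (Real.exp (θ * wnum n ^ s) : ℂ) * UnitAddTorus.mFourierCoeff f n) ∧
      Decays s p (δ - θ) B (expLambda θ s f) :=
  h.multiplier 0 hs hθ fun n => by
    rw [pow_zero, one_mul, Complex.norm_real, Real.norm_of_nonneg (Real.exp_pos _).le]
    exact le_rfl

lemma Decays.partialD {s δ B : ℝ} {p : ℕ} {f : ScalarL2} (h : Decays s p δ B f)
    (hs : 0 < s) (hδ : 0 < δ) (j : Fin 3) :
    (∀ n, UnitAddTorus.mFourierCoeff (partialD j f) n =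
      Complex.I * (wave n j : ℂ) * UnitAddTorus.mFourierCoeff f n) ∧
      Decays s (p + 1) δ B (partialD j f) := by
  have h1 := h.multiplier 1 hs hδ (m := fun n => Complex.I * (wave n j : ℂ)) fun n => by
    rw [norm_mul, Complex.norm_I, one_mul, Complex.norm_real, pow_one, zero_mul, Real.exp_zero,
      mul_one]
    exact PiLp.norm_apply_le (wave n) j
  rwa [sub_zero] at h1

lemma Decays.sub {s δ B : ℝ} {p : ℕ} {f g : ScalarL2} (hf : Decays s p δ B f)
    (hg : Decays s p δ B g) :
    (∀ n, UnitAddTorus.mFourierCoeff (f - g : ScalarL2) n =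
      UnitAddTorus.mFourierCoeff f n - UnitAddTorus.mFourierCoeff g n) ∧
      Decays s p δ (2 * B) (f - g) := by
  have h1 : ∀ n, UnitAddTorus.mFourierCoeff (f - g : ScalarL2) n =
      UnitAddTorus.mFourierCoeff f n - UnitAddTorus.mFourierCoeff g n := fun n => by
    rw [← UnitAddTorus.mFourierBasis_repr, ← UnitAddTorus.mFourierBasis_repr,
      ← UnitAddTorus.mFourierBasis_repr, map_sub]
    rfl
  refine ⟨h1, fun n => ?_⟩
  rw [h1]
  refine (norm_sub_le _ _).trans ((add_le_add (hf n) (hg n)).trans (le_of_eq ?_))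
  ring

lemma Decays.curl {s δ B : ℝ} {p : ℕ} {F : Fin 3 → ScalarL2} (h : ∀ i, Decays s p δ B (F i))
    (hs : 0 < s) (hδ : 0 < δ) (i : Fin 3) :
    (∀ n, UnitAddTorus.mFourierCoeff (curl F i) n =
      Complex.I * (wave n (i + 1) : ℂ) * UnitAddTorus.mFourierCoeff (F (i + 2)) n -
      Complex.I * (wave n (i + 2) : ℂ) * UnitAddTorus.mFourierCoeff (F (i + 1)) n) ∧
      Decays s (p + 1) δ (2 * B) (curl F i) := by
  have h1 := (h (i + 2)).partialD hs hδ (i + 1)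
  have h2 := (h (i + 1)).partialD hs hδ (i + 2)
  have h3 := h1.2.sub h2.2
  refine ⟨fun n => ?_, h3.2⟩
  rw [← h1.1, ← h2.1]
  exact h3.1 n

/-- For a divergence free amplitude `u`, the interaction of two modes is the Fourier image of
`(u · ∇) curl v - (curl v · ∇) u`. -/
lemma interaction_apply_eq (n m : Fin 3 → ℤ) {u : C3} (v : C3)
    (hu : ∑ j, (wave (n - m) j : ℂ) * u j = 0) (i : Fin 3) :
    interaction n m u v i =
      ∑ j, u j * (Complex.I * (wave m j : ℂ) * (Complex.I * (wave m (i + 1) : ℂ) * v (i + 2) -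
        Complex.I * (wave m (i + 2) : ℂ) * v (i + 1))) -
      ∑ j, (Complex.I * (wave m (j + 1) : ℂ) * v (j + 2) -
        Complex.I * (wave m (j + 2) : ℂ) * v (j + 1)) *
          (Complex.I * (wave (n - m) j : ℂ) * u i) := by
  have key : interaction n m u v i =
      -(∑ j, u j * ((wave m j : ℂ) * ((wave m (i + 1) : ℂ) * v (i + 2) -
        (wave m (i + 2) : ℂ) * v (i + 1))) -
      ∑ j, ((wave m (j + 1) : ℂ) * v (j + 2) - (wave m (j + 2) : ℂ) * v (j + 1)) *
          ((wave (n - m) j : ℂ) * u i)) := by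
    have hn : ∀ j, (wave n j : ℂ) = wave (n - m) j + wave m j := fun j => by
      rw [wave_sub, PiLp.sub_apply]; push_cast; ring
    rw [Fin.sum_univ_three] at hu
    have e1 : (1 + 1 : Fin 3) = 2 := rfl
    have e2 : (1 + 2 : Fin 3) = 0 := rfl
    have e3 : (2 + 1 : Fin 3) = 0 := rfl
    have e4 : (2 + 2 : Fin 3) = 1 := rfl
    fin_cases i
    · simp only [Fin.sum_univ_three, interaction, PiLp.neg_apply, cross_apply_zero,
        cross_apply_one, cross_apply_two, cwave_apply, hn, Fin.zero_eta, zero_add, e1, e2, e3, e4]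
      linear_combination (-((wave m 1 : ℂ) * v 2 - (wave m 2 : ℂ) * v 1)) * hu
    · simp only [Fin.sum_univ_three, interaction, PiLp.neg_apply, cross_apply_zero,
        cross_apply_one, cross_apply_two, cwave_apply, hn, Fin.mk_one, zero_add, e1, e2, e3, e4]
      linear_combination (-((wave m 2 : ℂ) * v 0 - (wave m 0 : ℂ) * v 2)) * hu
    · simp only [Fin.sum_univ_three, interaction, PiLp.neg_apply, cross_apply_zero,
        cross_apply_one, cross_apply_two, cwave_apply, hn, Fin.reduceFinMk, zero_add, e1, e2, e3,
        e4]
      linear_combination (-((wave m 0 : ℂ) * v 1 - (wave m 1 : ℂ) * v 0)) * hu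
  rw [key, neg_eq_neg_one_mul, ← Complex.I_mul_I, mul_sub, Finset.mul_sum, Finset.mul_sum]
  congr 1 <;> refine Finset.sum_congr rfl fun j _ => ?_ <;> ring

lemma integrable_mul_scalarL2 (f g : ScalarL2) : Integrable (fun x => f x * g x) haar :=
  MemLp.integrable_mul (Lp.memLp f) (Lp.memLp g)

lemma hasSum_mFourierCoeff_bracketP (F G : Fin 3 → ScalarL2) (i : Fin 3) (n : Fin 3 → ℤ) :
    HasSum (fun m => ∑ j, UnitAddTorus.mFourierCoeff (F j) (n - m) *
        UnitAddTorus.mFourierCoeff (partialD j (G i)) m -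
      ∑ j, UnitAddTorus.mFourierCoeff (G j) m *
        UnitAddTorus.mFourierCoeff (partialD j (F i)) (n - m))
      (UnitAddTorus.mFourierCoeff (bracketP F G i) n) := by
  have h1 : UnitAddTorus.mFourierCoeff (bracketP F G i) n =
      ∑ j, UnitAddTorus.mFourierCoeff (fun x => F j x * partialD j (G i) x) n -
        ∑ j, UnitAddTorus.mFourierCoeff (fun x => G j x * partialD j (F i) x) n := by
    have h2 := mFourierCoeff_sum Finset.univ (f := fun j x =>
      F j x * partialD j (G i) x - G j x * partialD j (F i) x) (fun j _ =>
        (integrable_mul_scalarL2 _ _).sub (integrable_mul_scalarL2 _ _)) n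
    rw [← Finset.sum_sub_distrib]
    refine h2.trans (Finset.sum_congr rfl fun j _ => ?_)
    exact mFourierCoeff_sub (integrable_mul_scalarL2 _ _) (integrable_mul_scalarL2 _ _) n
  rw [h1]
  refine (hasSum_sum fun j _ => hasSum_mFourierCoeff_mul _ _ n).sub (hasSum_sum fun j _ => ?_)
  have h3 := (Equiv.subLeft n).hasSum_iff.2
    (hasSum_mFourierCoeff_mul (G j) (partialD j (F i)) n)
  refine h3.congr_fun fun m => ?_
  simp

/-- For solenoidal fields of the Gevrey class the nonlinearity is given by `quad`. -/
theorem coeffQ_eq_quad {s A ψ R : ℝ} (hs : 0 < s) (hs1 : s ≤ 1) (hψ : 0 < ψ) (hA : A < ψ)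
    (hR : 0 ≤ R) {u : VectorL2} (hu : ∀ n, ∑ i, (wave n i : ℂ) * coeff u n i = 0)
    (hb : GevBound s 2 ψ R (coeff u)) (n : Fin 3 → ℤ) :
    coeffQ A s (component u) (curl (component u)) n = quad A s (coeff u) (coeff u) n := by
  have d0 : ∀ l, Decays s 0 ψ R (component u l) := fun l n => by
    rw [pow_zero, one_mul, ← coeff_apply]
    exact (PiLp.norm_apply_le _ l).trans (hb.norm_le (by norm_num) hR n)
  have dF := fun l => (d0 l).expLambda hs hA
  have dC := fun l => Decays.curl d0 hs hψ l
  have dG := fun l => (dC l).2.expLambda hs hA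
  have hA' : 0 < ψ - A := by linarith
  have dDF := fun l j => (dF l).2.partialD hs hA' j
  have dDG := fun l j => (dG l).2.partialD hs hA' j
  ext i
  have h1 := (hasSum_mFourierCoeff_bracketP (fun l => expLambda A s (component u l))
    (fun l => expLambda A s (curl (component u) l)) i n).mul_left
    (Real.exp (-A * wnum n ^ s) : ℂ)
  have h2 := (EuclideanSpace.proj (𝕜 := ℂ) i).hasSum
    (summable_quad hs hs1 hA.le hR hR hb hb n).hasSum
  refine h1.unique (h2.congr_fun fun m => ?_)
  simp only [(dDF _ _).1, (dDG _ _).1, (dF _).1, (dG _).1, (dC _).1, ← coeff_apply]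
  have h3 : (Real.exp (A * (wnum (n - m) ^ s + wnum m ^ s - wnum n ^ s)) : ℂ) =
      Real.exp (-A * wnum n ^ s) * (Real.exp (A * wnum (n - m) ^ s) *
        Real.exp (A * wnum m ^ s)) := by
    rw [← Complex.ofReal_mul, ← Complex.ofReal_mul, ← Real.exp_add, ← Real.exp_add]
    ring_nf
  have h4 : EuclideanSpace.proj (𝕜 := ℂ) i (Real.exp (A * (wnum (n - m) ^ s + wnum m ^ s -
      wnum n ^ s)) • interaction n m (coeff u (n - m)) (coeff u m)) =
      (Real.exp (A * (wnum (n - m) ^ s + wnum m ^ s - wnum n ^ s)) : ℂ) *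
        interaction n m (coeff u (n - m)) (coeff u m) i := Complex.real_smul
  rw [h4, h3, interaction_apply_eq n m _ (hu (n - m))]
  simp only [Fin.sum_univ_three]
  ring

/-! ### From coefficient families to vector fields -/

lemma gw_zero_radius (s p : ℝ) (n : Fin 3 → ℤ) : gw s p 0 n = wnum n ^ p := by
  rw [gw, mul_zero, zero_mul, Real.exp_zero, mul_one]

lemma gevrey_term_eq (σ s φ : ℝ) (a : (Fin 3 → ℤ) → C3) (n : Fin 3 → ℤ) :
    Real.exp (2 * φ * ‖wave n‖ ^ s) * ‖wave n‖ ^ (2 * σ * s) * ‖a n‖ ^ 2 =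
      gw s (2 * (σ * s)) φ n * ‖a n‖ ^ 2 := by
  rw [gw, wnum, ← mul_assoc 2 σ s, mul_comm (Real.exp _)]

lemma gevreyNorm_eq (σ s φ : ℝ) (u : VectorL2) :
    gevreyNorm σ s φ u = √(fullEnergy s (2 * (σ * s)) φ (coeff u)) := by
  simp only [gevreyNorm, gevrey_term_eq, fullEnergy]

lemma mem_gevreyClass_iff {σ s φ : ℝ} {u : VectorL2} : u ∈ gevreyClass σ s φ ↔
    (Summable fun n => gw s (2 * (σ * s)) 0 n * ‖coeff u n‖ ^ 2) ∧
      Summable fun n => gw s (2 * (σ * s)) φ n * ‖coeff u n‖ ^ 2 := by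
  simp only [gevreyClass, homSobolev, Set.mem_ofPred_eq, gevrey_term_eq, gw_zero_radius, wnum]

lemma GevBound.mem_gevreyClass {σ s φ R : ℝ} (hφ : 0 ≤ φ) {u : VectorL2}
    (h : GevBound s (2 * (σ * s)) φ R (coeff u)) : u ∈ gevreyClass σ s φ :=
  mem_gevreyClass_iff.2 ⟨(h.mono le_rfl hφ).summable, h.summable⟩

lemma gevBound_of_fullEnergy_le {σ s φ R : ℝ} {u : VectorL2} (h0 : u ∈ solenoidal)
    (h1 : u ∈ gevreyClass σ s φ) (h2 : fullEnergy s (2 * (σ * s)) φ (coeff u) ≤ R ^ 2) :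
    GevBound s (2 * (σ * s)) φ R (coeff u) :=
  ⟨(integral_eq_zero_iff u).1 h0.1, fun S => ((mem_gevreyClass_iff.1 h1).2.sum_le_tsum S
    fun n _ => gw_mul_norm_sq_nonneg _ _ _ _ n).trans h2⟩

/-- The coefficients of `exp (ψ Λˢ) a`. -/
noncomputable def expWeight (s ψ : ℝ) (a : (Fin 3 → ℤ) → C3) (n : Fin 3 → ℤ) : C3 :=
  Real.exp (ψ * ‖wave n‖ ^ s) • a n

lemma rpow_mul_norm_expWeight_sq (σ s ψ : ℝ) (a : (Fin 3 → ℤ) → C3) (n : Fin 3 → ℤ) :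
    ‖wave n‖ ^ (2 * σ * s) * ‖expWeight s ψ a n‖ ^ 2 =
      gw s (2 * (σ * s)) ψ n * ‖a n‖ ^ 2 := by
  rw [← gevrey_term_eq, expWeight, norm_smul, Real.norm_of_nonneg (Real.exp_pos _).le, mul_pow,
    ← Real.exp_nat_mul]
  push_cast
  ring_nf

/-- The norm of a continuous curve in the Gevrey class is locally bounded. -/
lemma ContinuousGevrey.exists_fullEnergy_le {σ s : ℝ} {ψ : ℝ≥0 → ℝ} {U : ℝ≥0 → VectorL2}
    (h : ContinuousGevrey σ s ψ U) (T : ℝ≥0) :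
    ∃ M, ∀ t ∈ Set.Icc 0 T, fullEnergy s (2 * (σ * s)) (ψ t) (coeff (U t)) ≤ M := by
  refine isCompact_Icc.induction_on (p := fun K => ∃ M, ∀ t ∈ K,
    fullEnergy s (2 * (σ * s)) (ψ t) (coeff (U t)) ≤ M) ⟨0, fun t ht => ht.elim⟩
    (fun _ _ hst ⟨M, hM⟩ => ⟨M, fun t ht => hM t (hst ht)⟩)
    (fun _ _ ⟨M, hM⟩ ⟨M', hM'⟩ => ⟨max M M', fun t ht => ht.elim
      (fun h => (hM t h).trans (le_max_left _ _)) fun h => (hM' t h).trans (le_max_right _ _)⟩)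
    fun t _ => ?_
  have hev := (h.2 t).eventually_le_const zero_lt_one
  refine ⟨_, mem_nhdsWithin_of_mem_nhds hev,
    2 + 2 * fullEnergy s (2 * (σ * s)) (ψ t) (coeff (U t)), fun τ hτ => ?_⟩
  have s1 := (mem_gevreyClass_iff.1 (h.1 τ)).2
  have s2 := (mem_gevreyClass_iff.1 (h.1 t)).2
  set f : (Fin 3 → ℤ) → C3 := expWeight s (ψ τ) (coeff (U τ)) with hf
  set g : (Fin 3 → ℤ) → C3 := expWeight s (ψ t) (coeff (U t)) with hg
  have hτ' : ∑' n, ‖wave n‖ ^ (2 * σ * s) * ‖f n - g n‖ ^ 2 ≤ 1 := hτ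
  simp only [← rpow_mul_norm_expWeight_sq] at s1 s2
  simp only [fullEnergy, ← rpow_mul_norm_expWeight_sq]
  have hw : ∀ n, 0 ≤ ‖wave n‖ ^ (2 * σ * s) := fun n => by positivity
  have s3 : Summable fun n => ‖wave n‖ ^ (2 * σ * s) * ‖f n - g n‖ ^ 2 := by
    refine ((s1.mul_left 2).add (s2.mul_left 2)).of_nonneg_of_le (fun n => by positivity)
      fun n => ?_
    have h1 := pow_le_pow_left₀ (norm_nonneg _) (norm_sub_le (f n) (g n)) 2
    nlinarith [mul_le_mul_of_nonneg_left h1 (hw n),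
      mul_nonneg (hw n) (sq_nonneg (‖f n‖ - ‖g n‖))]
  calc ∑' n, ‖wave n‖ ^ (2 * σ * s) * ‖f n‖ ^ 2
      ≤ ∑' n, (2 * (‖wave n‖ ^ (2 * σ * s) * ‖f n - g n‖ ^ 2) +
          2 * (‖wave n‖ ^ (2 * σ * s) * ‖g n‖ ^ 2)) := by
        refine s1.tsum_le_tsum (fun n => ?_) ((s3.mul_left 2).add (s2.mul_left 2))
        have h1 := pow_le_pow_left₀ (norm_nonneg _) (norm_add_le (f n - g n) (g n)) 2
        rw [sub_add_cancel] at h1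
        nlinarith [mul_le_mul_of_nonneg_left h1 (hw n),
          mul_nonneg (hw n) (sq_nonneg (‖f n - g n‖ - ‖g n‖))]
    _ = 2 * ∑' n, ‖wave n‖ ^ (2 * σ * s) * ‖f n - g n‖ ^ 2 +
          2 * ∑' n, ‖wave n‖ ^ (2 * σ * s) * ‖g n‖ ^ 2 := by
        rw [Summable.tsum_add (s3.mul_left 2) (s2.mul_left 2), tsum_mul_left, tsum_mul_left]
    _ ≤ _ := by linarith

section Solutions

variable {s σ μ α β δ η R c C : ℝ} {ω : C(ℝ≥0, ℝ)} {U₀ : VectorL2}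

lemma IsGlobalSolution.isCoeffSolution {U : ℝ≥0 → VectorL2} (hs : 0 < s) (hs1 : s ≤ 1)
    (hσ : 1 ≤ σ * s) (hα : 0 ≤ α) (hβ : 0 ≤ β) (hδ : 0 < δ) (hω : ω ∈ goodPaths μ α β)
    (h : IsGlobalSolution μ σ s (fun t => α + β * t + δ) ω U₀ U) :
    IsCoeffSolution s (σ * s) μ α β δ (fun t => μ * ω t.toNNReal) (coeff U₀)
      (fun t => coeff (U t.toNNReal)) := by
  have hbd : ∀ T : ℝ≥0, ∃ R, 0 ≤ R ∧ ∀ t ∈ Set.Icc 0 T,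
      GevBound s (2 * (σ * s)) (α + β * t + δ) R (coeff (U t)) := fun T => by
    obtain ⟨M, hM⟩ := h.continuous.exists_fullEnergy_le T
    refine ⟨√M, Real.sqrt_nonneg M, fun t ht => ?_⟩
    refine gevBound_of_fullEnergy_le (h.solenoidal t) (h.continuous.1 t) ?_
    rw [Real.sq_sqrt ((fullEnergy_nonneg _ _ _ _).trans (hM t ht))]
    exact hM t ht
  refine ⟨?_, fun t _ n => coeff_neg _ n, fun T hT => ?_, fun t ht n => ?_⟩
  · simp only [Real.toNNReal_zero, h.initial]
  · obtain ⟨R, hR, hb⟩ := hbd T.toNNReal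
    refine ⟨R, hR, fun t ht => ?_⟩
    have h1 := hb t.toNNReal ⟨zero_le, Real.toNNReal_le_toNNReal ht.2⟩
    rwa [Real.coe_toNNReal t ht.1] at h1
  · obtain ⟨R, hR, hb⟩ := hbd t.toNNReal
    have h1 := h.equation n t.toNNReal
    have hpos : 0 ≤ β * (t.toNNReal : ℝ) := mul_nonneg hβ (NNReal.coe_nonneg _)
    rw [coeffQ_eq_quad (R := R) hs hs1 (by linarith) ((hω.2 t.toNNReal).trans_lt
      (by linarith : _ < α + β * t.toNNReal + δ)) hR (h.solenoidal _).2
      ((hb _ ⟨zero_le, le_rfl⟩).mono (by linarith) le_rfl), Real.coe_toNNReal t ht] at h1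
    exact h1

/-- The limit of the Galerkin approximations is the family of coefficients of a solution. -/
theorem IsLimit.exists_isGlobalSolution {u : ℕ → ℝ → (Fin 3 → ℤ) → C3}
    {a : ℝ → (Fin 3 → ℤ) → C3}
    (P : Setting s (σ * s) μ α β δ η R c C fun t => μ * ω t.toNNReal)
    (h₀ : InitialData s (σ * s) α δ R (coeff U₀))
    (G : IsGalerkinFamily s (σ * s) μ α β δ R (fun t => μ * ω t.toNNReal) (coeff U₀) u)
    (h : IsLimit u a) : ∃ U : ℝ≥0 → VectorL2, (∀ t : ℝ≥0, coeff (U t) = a t) ∧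
      IsGlobalSolution μ σ s (fun t => α + β * t + δ) ω U₀ U := by
  have hr := P.hr
  have hb : ∀ t : ℝ≥0, GevBound s (2 * (σ * s)) (α + β * t + δ) R (a t) := fun t =>
    h.gevBound G t.2
  have hψ : ∀ t : ℝ≥0, 0 < α + β * t + δ := fun t => by
    have := P.radius_nonneg (NNReal.coe_nonneg t)
    linarith [P.hδ]
  have hex : ∀ t : ℝ≥0, ∃ u : VectorL2, coeff u = a t := fun t => by
    refine exists_coeff_eq (h.real G t.2) ?_
    have h1 := ((hb t).mono (p := 0) (ψ := 0) (by linarith) (hψ t).le).summable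
    simpa only [gw_zero_radius, Real.rpow_zero, one_mul] using h1
  choose U hU using hex
  refine ⟨U, hU, fun t => ⟨?_, ?_⟩, ⟨fun t => ?_, fun t => ?_⟩, coeff_injective ?_, fun n t => ?_⟩
  · rw [integral_eq_zero_iff, hU]
    exact (hb t).1
  · rw [hU]
    exact h.solenoidal G t.2
  · have h1 := hb t
    rw [← hU] at h1
    exact h1.mem_gevreyClass (hψ t).le
  · have hrew : ∀ τ : ℝ≥0, (fun n => ‖wave n‖ ^ (2 * σ * s) *
        ‖expWeight s (α + β * τ + δ) (a τ) n‖ ^ 2) =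
        fun n => gw s (2 * (σ * s)) (α + β * τ + δ) n * ‖a τ n‖ ^ 2 := fun τ =>
      funext fun n => rpow_mul_norm_expWeight_sq _ _ _ _ _
    have h1 := tendsto_tsum_norm_sub_sq (l := 𝓝 t) (w := fun n => ‖wave n‖ ^ (2 * σ * s))
      (f := fun τ : ℝ≥0 => expWeight s (α + β * τ + δ) (a τ))
      (g := expWeight s (α + β * t + δ) (a t)) (fun n => by positivity)
      (fun τ => by rw [hrew]; exact (hb τ).summable) (by rw [hrew]; exact (hb t).summable)
      (fun n => by
        have h2 : Continuous fun τ : ℝ≥0 => a τ n :=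
          (h.continuousOn P G n).comp_continuous NNReal.continuous_coe fun τ => τ.2
        have h3 : Continuous fun τ : ℝ≥0 => Real.exp ((α + β * τ + δ) * ‖wave n‖ ^ s) := by
          fun_prop
        exact (h3.smul h2).tendsto t)
      (by
        simp only [hrew]
        have h2 := h.tendsto_fullEnergy P G t
        simp only [add_right_comm α δ] at h2
        exact h2)
    simp only [hU]
    exact h1
  · have h1 : a ((0 : ℝ≥0) : ℝ) = coeff U₀ := h.initial h₀ G
    rw [hU, h1]
  · have h1 := (h.isCoeffSolution P h₀ G).deriv t t.2 n
    have h2 : coeffQ (μ * ω t) s (component (U t)) (curl (component (U t))) n =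
        quad (μ * ω t) s (a t) (a t) n := by
      have hbU : GevBound s 2 (α + β * t + δ) R (coeff (U t)) := by
        rw [hU]
        exact (hb t).mono (by linarith) le_rfl
      have h3 := P.hA t t.2
      rw [Real.toNNReal_coe] at h3
      rw [coeffQ_eq_quad P.hs P.hs1 (hψ t) (h3.trans_lt (by linarith [P.hδ])) P.hR.le
        (by rw [hU]; exact h.solenoidal G t.2) hbU, hU]
    rw [h2, hU]
    simp only [Real.toNNReal_coe] at h1
    refine h1.congr (fun τ hτ => ?_) (by rw [Real.toNNReal_coe, hU])
    rw [hU, Real.coe_toNNReal τ hτ]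

end Solutions

end EMHD

theorem proposition5p3 (s σ : ℝ) (hs : 3 / 4 < s) (hs' : s ≤ 1)
    (hσ : 7 / (4 * s) < σ) (hσ' : σ < 2) :
    ∃ c : ℝ, 0 < c ∧
      ∀ μ α β δ : ℝ, 0 < μ → 0 < α → 0 < β → β < 1 / 2 * μ ^ 2 → 0 < δ →
      ∀ U₀ : EMHD.VectorL2, U₀ ∈ EMHD.solenoidal → U₀ ∈ EMHD.gevreyClass σ s (α + δ) →
      EMHD.gevreyNorm σ s (α + δ) U₀ < 1 / c * (μ ^ 2 - 2 * β) →
      ∀ ω ∈ EMHD.goodPaths μ α β,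
        ∃ U : ℝ≥0 → EMHD.VectorL2,
          EMHD.IsGlobalSolution μ σ s (fun t => α + β * t + δ) ω U₀ U ∧
          (∀ U' : ℝ≥0 → EMHD.VectorL2,
            EMHD.IsGlobalSolution μ σ s (fun t => α + β * t + δ) ω U₀ U' → U' = U) ∧
          Antitone fun t : ℝ≥0 => EMHD.gevreyNorm σ s (α + β * t + δ) (U t) := by
  have hs0 : 0 < s := by linarith
  have hr : 7 / 4 < σ * s := by
    rw [div_lt_iff₀ (by positivity)] at hσ
    linarith
  obtain ⟨c₀, hc₀, hrate⟩ := EMHD.exists_energyRate_bounds (r := σ * s) (by linarith) hs0 hs'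
    (by linarith)
  obtain ⟨C, hC, hwiener⟩ := EMHD.exists_wiener_le (s := s) (r := σ * s) (by linarith)
  refine ⟨max c₀ (16 * C), lt_max_of_lt_left hc₀, ?_⟩
  intro μ α β δ hμ hα hβ hβμ hδ U₀ hU₀ hU₀' hN ω hω
  set c := max c₀ (16 * C) with hc
  have hcpos : 0 < c := lt_max_of_lt_left hc₀
  -- a radius `R` strictly between the norm of the data and the critical value
  obtain ⟨R, hNR, hRc⟩ := exists_between hN
  have hN0 : 0 ≤ EMHD.gevreyNorm σ s (α + δ) U₀ := Real.sqrt_nonneg _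
  have hR : 0 < R := hN0.trans_lt hNR
  have hcR : c * R < μ ^ 2 - 2 * β := by
    rw [one_div, inv_mul_eq_div, lt_div_iff₀ hcpos] at hRc
    linarith
  have hc₀R : c₀ * R ≤ c * R := mul_le_mul_of_nonneg_right (le_max_left _ _) hR.le
  have hCR : 16 * C * R ≤ c * R := mul_le_mul_of_nonneg_right (le_max_right _ _) hR.le
  have P : EMHD.Setting s (σ * s) μ α β δ (μ ^ 2 - 2 * β - c * R) R c₀ C
      fun t => μ * ω t.toNNReal :=
    { hs := hs0, hs1 := hs', hr := by linarith, hα := hα.le, hβ := hβ.le, hδ := hδ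
      hη := by linarith, hR := hR, hc := hc₀.le, hcR := by linarith
      hC := hC.le, hCR := by linarith, rate := hrate, wiener_le := hwiener
      contA := continuous_const.mul (ω.continuous.comp continuous_real_toNNReal)
      hA := fun t ht => by
        have h1 := hω.2 t.toNNReal
        rwa [Real.coe_toNNReal t ht] at h1 }
  have h₀ : EMHD.InitialData s (σ * s) α δ R (EMHD.coeff U₀) := by
    refine ⟨EMHD.coeff_neg U₀, hU₀.2, EMHD.gevBound_of_fullEnergy_le hU₀ hU₀' ?_⟩
    rw [EMHD.gevreyNorm_eq] at hNR
    exact (Real.sqrt_le_left hR.le).1 hNR.le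
  obtain ⟨u, G⟩ := P.exists_galerkinFamily h₀
  obtain ⟨a, ha⟩ := G.exists_isLimit P h₀
  obtain ⟨U, hU, hsol⟩ := ha.exists_isGlobalSolution P h₀ G
  refine ⟨U, hsol, fun U' hsol' => funext fun t => EMHD.coeff_injective (funext fun n => ?_),
    fun t t' htt' => ?_⟩
  · have h1 := (hsol'.isCoeffSolution hs0 hs' (by linarith) hα.le hβ.le hδ hω).tendsto P G t.2 n
    have h2 := tendsto_nhds_unique h1 (ha t t.2 n)
    rw [hU, ← h2]
    simp only [NNReal.val_eq_coe, Real.toNNReal_coe]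
  · simp only [EMHD.gevreyNorm_eq, hU]
    refine Real.sqrt_le_sqrt ?_
    have h1 := ha.fullEnergy_antitone P G t.2 (NNReal.coe_le_coe.2 htt')
    simpa only [add_right_comm α δ, NNReal.val_eq_coe] using h1
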